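/- Let $N\ge 1$ and let $\Omega\subset\mathbb R^N$ be a nonempty open set with finite Lebesgue measure $|\Omega|$. Let $H^1_0(\Omega)$ be the closure of $C_c^\infty(\Omega)$ in the Sobolev space $H^1(\Omega)$ and put $\mathcal V(\Omega)=(H^1_0(\Omega))^N\times H^1_0(\Omega)$. For $\lambda,\mu,k,t>0$, a number $\gamma\in\mathbb R$ is called an eigenvalue of the Reissner–Mindlin system in $\Omega$ if there is $(\beta,w)\in\mathcal V(\Omega)$, $(\beta,w)\neq 0$, such that $$\frac{\mu}{12}\int_\Omega\nabla\beta:\nabla\eta\,dx+\frac{\mu+\lambda}{12}\int_\Omega\operatorname{div}\beta\,\operatorname{div}\eta\,dx+\frac{\mu k}{t^2}\int_\Omega(\nabla w-\beta)\cdot(\nabla v-\eta)\,dx=\gamma\int_\Omega\Big(wv+\frac{t^2}{12}\beta\cdot\eta\Big)dx$$ for all $(\eta,v)\in\mathcal V(\Omega)$; its multiplicity is the dimension of the space of solutions $(\beta,w)$. The eigenvalues are positive, have finite multiplicity and form a divergent sequence; let $\gamma_{1,t}[\Omega]\le\gamma_{2,t}[\Omega]\le\cdots$ be this sequence, each eigenvalue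 being repeated according to its multiplicity. A diffeomorphism $\phi$ from $\Omega$ onto an open set $\phi(\Omega)\subset\mathbb R^N$ is said to be of class $C^{1,1}$ if $\phi$ and its inverse are continuously differentiable with Lipschitz continuous gradients. Put $$\delta(\phi)=\max_{1\le|\alpha|\le 2}\ \sup_{x\in\Omega}|D^\alpha(\phi(x)-x)|,$$ where second order derivatives, which exist almost everywhere, are understood with the essential supremum (here and below). Theorem. For all $M_1,M_2>0$ there exists a constant $c>0$, depending only on $N,\lambda,\mu,M_1,M_2$ and $|\Omega|$ (in particular not on $n$, $t$, $k$, $\phi$), such that, for all $t>0$ and $k>0$ and all diffeomorphisms $\phi$ of class $C^{1,1}$ from $\Omega$ onto an open set $\phi(\Omega)\subset\mathbb R^N$ with $$\max_{1\le|\alpha|\le 2}\ \sup_{x\in\Omega}|D^\alpha\phi(x)|<M_1,\qquad \inf_{x\in\Omega}|\det\nabla\phi(x)|>M_2,\qquad \delta(\phi)<c^{-1},$$ the eigenvalue sequences $\gamma_{n,t}[\Omega]$ and $\gamma_{n,t}[\phi(\Omega)]$ are well defined as above, and $$\big|\gamma_{n,t}[\phi(\Omega)]-\gamma_{n,t}[\Omega]\big|\le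 c\,\gamma_{n,t}[\Omega]\,\delta(\phi)\qquad\text{for all } n\ge 1.$$ -/

import Mathlib

open MeasureTheory Set Filter Topology
open scoped ENNReal NNReal ContDiff

noncomputable section

namespace ReissnerMindlin

/-- `ℝ^N` with the Euclidean norm and Lebesgue measure. -/
abbrev Space (N : ℕ) : Type := EuclideanSpace ℝ (Fin N)

/-- The `i`-th vector of the canonical basis of `ℝ^N`. -/
abbrev basisVec {N : ℕ} (i : Fin N) : Space N := EuclideanSpace.single i (1 : ℝ)

/-- The partial derivative `∂f/∂x_i` at `x` (of scalar or vector valued functions). -/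
def partialDeriv {N : ℕ} {F : Type*} [NormedAddCommGroup F] [NormedSpace ℝ F]
    (i : Fin N) (f : Space N → F) (x : Space N) : F :=
  fderiv ℝ f x (basisVec i)

/-! ### The Sobolev space `H^1_0(Ω)` -/

/-- Smooth functions with compact support in `Ω`. -/
structure IsTestFunction {N : ℕ} (Ω : Set (Space N)) (f : Space N → ℝ) : Prop where
  smooth : ContDiff ℝ ∞ f
  compact_support : HasCompactSupport f
  support_subset : tsupport f ⊆ Ω

/-- The real Hilbert space `L^2(Ω)`. -/
abbrev L2 {N : ℕ} (Ω : Set (Space N)) : Type := Lp ℝ 2 (volume.restrict Ω)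

/-- `L^2(Ω) × L^2(Ω)^N`. A function `u` of `H^1(Ω)` is represented in it by the pair
`(u, (∂_1 u, …, ∂_N u))` of its value and its weak partial derivatives; the topology of
`L^2(Ω) × L^2(Ω)^N` induces that of the Sobolev norm of `H^1(Ω)`. -/
abbrev L2Pair {N : ℕ} (Ω : Set (Space N)) : Type := L2 Ω × (Fin N → L2 Ω)

/-- `g = (g_1, …, g_N)` is the weak gradient of `u` in `Ω`. -/
def IsWeakGradient {N : ℕ} (Ω : Set (Space N)) (u : L2 Ω) (g : Fin N → L2 Ω) : Prop :=
  ∀ f : Space N → ℝ, IsTestFunction Ω f → ∀ i : Fin N,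
    ∫ x in Ω, u x * partialDeriv i f x = -∫ x in Ω, g i x * f x

theorem IsTestFunction.partialDeriv_continuous {N : ℕ} {Ω : Set (Space N)} {f : Space N → ℝ}
    (hf : IsTestFunction Ω f) (i : Fin N) : Continuous (partialDeriv i f) := by
  have h : Continuous (fderiv ℝ f) := hf.smooth.continuous_fderiv (by simp)
  exact h.clm_apply continuous_const

theorem IsTestFunction.partialDeriv_compact {N : ℕ} {Ω : Set (Space N)} {f : Space N → ℝ}
    (hf : IsTestFunction Ω f) (i : Fin N) : HasCompactSupport (partialDeriv i f) :=
  hf.compact_support.fderiv_apply (𝕜 := ℝ) (v := basisVec i)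

/-- The space `C_c^∞(Ω)` of smooth functions with compact support in `Ω`, as a subspace of
`H^1(Ω)`: the pairs of a test function and its gradient. -/
def testPairs {N : ℕ} (Ω : Set (Space N)) : Submodule ℝ (L2Pair Ω) where
  carrier := {p | ∃ f : Space N → ℝ, IsTestFunction Ω f ∧
    p.1 =ᵐ[volume.restrict Ω] f ∧ ∀ i, p.2 i =ᵐ[volume.restrict Ω] partialDeriv i f}
  add_mem' := by
    rintro p q ⟨f, hf, hf1, hf2⟩ ⟨g, hg, hg1, hg2⟩
    refine ⟨f + g, ⟨hf.smooth.add hg.smooth, hf.compact_support.add hg.compact_support,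
      (tsupport_add f g).trans (union_subset hf.support_subset hg.support_subset)⟩, ?_, ?_⟩
    · exact (Lp.coeFn_add p.1 q.1).trans (hf1.add hg1)
    · intro i
      refine (Lp.coeFn_add (p.2 i) (q.2 i)).trans (((hf2 i).add (hg2 i)).trans ?_)
      refine Eventually.of_forall fun x => ?_
      have h1 : DifferentiableAt ℝ f x := hf.smooth.differentiable (by simp) x
      have h2 : DifferentiableAt ℝ g x := hg.smooth.differentiable (by simp) x
      simp [partialDeriv, fderiv_add h1 h2]
  zero_mem' := by
    refine ⟨0, ⟨contDiff_const, HasCompactSupport.zero, by simp⟩, Lp.coeFn_zero _ _ _, ?_⟩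
    intro i
    refine (Lp.coeFn_zero _ _ _).trans (Eventually.of_forall fun x => ?_)
    simp [partialDeriv]
  smul_mem' := by
    rintro a p ⟨f, hf, hf1, hf2⟩
    refine ⟨a • f, ⟨hf.smooth.const_smul a, hf.compact_support.smul_left (f := fun _ => a),
      (tsupport_smul_subset_right (fun _ => a) f).trans hf.support_subset⟩, ?_, ?_⟩
    · exact (Lp.coeFn_smul a p.1).trans (hf1.const_smul a)
    · intro i
      refine (Lp.coeFn_smul a (p.2 i)).trans (((hf2 i).const_smul a).trans ?_)
      refine Eventually.of_forall fun x => ?_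
      have h1 : DifferentiableAt ℝ f x := hf.smooth.differentiable (by simp) x
      simp [partialDeriv, fderiv_const_smul h1 a]

/-- `H^1_0(Ω)`: the closure of `C_c^∞(Ω)` in the Sobolev norm. (Since `H^1(Ω)` is closed in
`L^2(Ω) × L^2(Ω)^N`, this is the closure in `H^1(Ω)`; see `isWeakGradient_of_H10`.) -/
def H10 {N : ℕ} (Ω : Set (Space N)) : Submodule ℝ (L2Pair Ω) := (testPairs Ω).topologicalClosure

/-- The function `u ∈ L^2(Ω)` underlying an element of `H^1_0(Ω)`. -/
def val {N : ℕ} {Ω : Set (Space N)} : H10 Ω →ₗ[ℝ] L2 Ω :=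
  LinearMap.fst ℝ (L2 Ω) (Fin N → L2 Ω) ∘ₗ (H10 Ω).subtype

/-- The weak partial derivative `∂_i u` of an element `u` of `H^1_0(Ω)`. -/
def wderiv {N : ℕ} {Ω : Set (Space N)} (i : Fin N) : H10 Ω →ₗ[ℝ] L2 Ω :=
  LinearMap.proj i ∘ₗ LinearMap.snd ℝ (L2 Ω) (Fin N → L2 Ω) ∘ₗ (H10 Ω).subtype

/-- The second component of an element of `H^1_0(Ω)` is the weak gradient of the first. -/
theorem isWeakGradient_of_H10 {N : ℕ} {Ω : Set (Space N)} (u : H10 Ω) :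
    IsWeakGradient Ω (val u) (fun i => wderiv i u) := by
  intro f hf i
  have hm : MemLp f 2 (volume.restrict Ω) :=
    (hf.smooth.continuous.memLp_of_hasCompactSupport hf.compact_support).restrict Ω
  have hd : MemLp (partialDeriv i f) 2 (volume.restrict Ω) :=
    ((hf.partialDeriv_continuous i).memLp_of_hasCompactSupport
      (hf.partialDeriv_compact i)).restrict Ω
  have key : ∀ p : L2Pair Ω, (inner ℝ (hd.toLp _) p.1 + inner ℝ (hm.toLp _) (p.2 i) : ℝ) =
      (∫ x in Ω, p.1 x * partialDeriv i f x) + ∫ x in Ω, p.2 i x * f x := by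
    intro p
    rw [L2.inner_def, L2.inner_def]
    congr 1
    · refine integral_congr_ae ?_
      filter_upwards [hd.coeFn_toLp] with x hx
      simp [hx]
    · refine integral_congr_ae ?_
      filter_upwards [hm.coeFn_toLp] with x hx
      simp [hx]
  have hclosed : IsClosed {p : L2Pair Ω |
      (inner ℝ (hd.toLp _) p.1 + inner ℝ (hm.toLp _) (p.2 i) : ℝ) = 0} :=
    isClosed_eq (by fun_prop) continuous_const
  have hsub : (testPairs Ω : Set (L2Pair Ω)) ⊆ {p : L2Pair Ω |
      (inner ℝ (hd.toLp _) p.1 + inner ℝ (hm.toLp _) (p.2 i) : ℝ) = 0} := by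
    rintro p ⟨g, hg, hg1, hg2⟩
    rw [mem_ofPred_eq, key p]
    have e1 : ∫ x in Ω, p.1 x * partialDeriv i f x = ∫ x, g x * partialDeriv i f x := by
      rw [← setIntegral_eq_integral_of_forall_compl_eq_zero (s := Ω)
        (f := fun x => g x * partialDeriv i f x)]
      · refine integral_congr_ae ?_
        filter_upwards [hg1] with x hx
        rw [hx]
      · intro x hx
        rw [image_eq_zero_of_notMem_tsupport fun h => hx (hg.support_subset h), zero_mul]
    have e2 : ∫ x in Ω, p.2 i x * f x = ∫ x, partialDeriv i g x * f x := by
      rw [← setIntegral_eq_integral_of_forall_compl_eq_zero (s := Ω)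
        (f := fun x => partialDeriv i g x * f x)]
      · refine integral_congr_ae ?_
        filter_upwards [hg2 i] with x hx
        rw [hx]
      · intro x hx
        rw [image_eq_zero_of_notMem_tsupport fun h => hx (hf.support_subset h), mul_zero]
    rw [e1, e2]
    have := integral_mul_fderiv_eq_neg_fderiv_mul_of_integrable (μ := (volume : Measure (Space N)))
      (f := g) (g := f) (v := basisVec i)
      (((hg.partialDeriv_continuous i).mul hf.smooth.continuous).integrable_of_hasCompactSupport
        (hf.compact_support.mul_left))
      ((hg.smooth.continuous.mul (hf.partialDeriv_continuous i)).integrable_of_hasCompactSupport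
        (hg.compact_support.mul_right))
      ((hg.smooth.continuous.mul hf.smooth.continuous).integrable_of_hasCompactSupport
        (hg.compact_support.mul_right))
      (fun x _ => hg.smooth.differentiable (by simp) x)
      (fun x _ => hf.smooth.differentiable (by simp) x)
    simp only [partialDeriv]
    linarith
  have hu := closure_minimal hsub hclosed u.2
  rw [mem_ofPred_eq, key] at hu
  exact eq_neg_of_add_eq_zero_left hu

/-! ### The Reissner-Mindlin eigenvalue problem -/

/-- The energy space `V(Ω) = H^1_0(Ω)^N × H^1_0(Ω)` of the pairs `(β, w)`. -/
abbrev EnergySpace {N : ℕ} (Ω : Set (Space N)) : Type := (Fin N → H10 Ω) × H10 Ω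

/-- The positive constants of the system: Lamé constants `lam`, `mu`, correction factor `k` and
thickness `t`. -/
structure Params where
  lam : ℝ
  mu : ℝ
  k : ℝ
  t : ℝ
  lam_pos : 0 < lam
  mu_pos : 0 < mu
  k_pos : 0 < k
  t_pos : 0 < t

/-- `div β ∈ L^2(Ω)`. -/
def divergence {N : ℕ} {Ω : Set (Space N)} (β : Fin N → H10 Ω) : L2 Ω := ∑ i, wderiv i (β i)

/-- The `i`-th component of `∇w - β ∈ L^2(Ω)^N`. -/
def shear {N : ℕ} {Ω : Set (Space N)} (U : EnergySpace Ω) (i : Fin N) : L2 Ω :=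
  wderiv i U.2 - val (U.1 i)

/-- The bilinear form
`μ/12 ∫ ∇β : ∇η + (μ+λ)/12 ∫ div β div η + μk/t² ∫ (∇w - β)·(∇v - η)`
at `U = (β, w)`, `W = (η, v)`. Here `inner ℝ f g = ∫_Ω f g dx` for `f, g ∈ L^2(Ω)`. -/
def energyForm {N : ℕ} (P : Params) {Ω : Set (Space N)} (U W : EnergySpace Ω) : ℝ :=
  P.mu / 12 * ∑ i, ∑ j, inner ℝ (wderiv j (U.1 i)) (wderiv j (W.1 i))
    + (P.mu + P.lam) / 12 * inner ℝ (divergence U.1) (divergence W.1)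
    + P.mu * P.k / P.t ^ 2 * ∑ i, inner ℝ (shear U i) (shear W i)

/-- The scalar product `∫ (w v + t²/12 β·η)` at `U = (β, w)`, `W = (η, v)`. -/
def massForm {N : ℕ} (P : Params) {Ω : Set (Space N)} (U W : EnergySpace Ω) : ℝ :=
  inner ℝ (val U.2) (val W.2) + P.t ^ 2 / 12 * ∑ i, inner ℝ (val (U.1 i)) (val (W.1 i))

/-- The space of the solutions `U = (β, w) ∈ V(Ω)` of the weak eigenvalue equation with
eigenvalue `γ`: its nonzero elements are the eigenvectors associated with `γ`. -/
def eigenspace {N : ℕ} (P : Params) (Ω : Set (Space N)) (γ : ℝ) :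
    Submodule ℝ (EnergySpace Ω) where
  carrier := {U | ∀ W : EnergySpace Ω, energyForm P U W = γ * massForm P U W}
  add_mem' := by
    intro U U' hU hU' W
    have h1 : energyForm P (U + U') W = energyForm P U W + energyForm P U' W := by
      have hd : divergence (U + U').1 = divergence U.1 + divergence U'.1 := by
        simp [divergence, Finset.sum_add_distrib]
      have hs : ∀ i, shear (U + U') i = shear U i + shear U' i := by
        intro i
        simp only [shear, Prod.fst_add, Prod.snd_add, Pi.add_apply,
          map_add]
        abel
      simp only [energyForm, hd, hs, inner_add_left, Finset.sum_add_distrib]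
      simp only [Prod.fst_add, Pi.add_apply, map_add,
        inner_add_left, Finset.sum_add_distrib]
      ring
    have h2 : massForm P (U + U') W = massForm P U W + massForm P U' W := by
      simp only [massForm, Prod.fst_add, Prod.snd_add, Pi.add_apply, map_add,
        inner_add_left, Finset.sum_add_distrib]
      ring
    rw [h1, h2, hU W, hU' W]
    ring
  zero_mem' := by
    intro W
    simp [energyForm, massForm, divergence, shear]
  smul_mem' := by
    intro a U hU W
    have h1 : energyForm P (a • U) W = a * energyForm P U W := by
      have hd : divergence (a • U).1 = a • divergence U.1 := by
        simp [divergence, Finset.smul_sum]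
      have hs : ∀ i, shear (a • U) i = a • shear U i := by
        intro i
        simp [shear, smul_sub]
      simp only [energyForm, hd, hs, real_inner_smul_left, ← Finset.mul_sum]
      simp only [Prod.smul_fst, Pi.smul_apply, map_smul,
        real_inner_smul_left, ← Finset.mul_sum]
      ring
    have h2 : massForm P (a • U) W = a * massForm P U W := by
      simp only [massForm, Prod.smul_fst, Prod.smul_snd, Pi.smul_apply,
        map_smul, real_inner_smul_left, ← Finset.mul_sum]
      ring
    rw [h1, h2, hU W]
    ring

/-- The `n`-th eigenvalue `γ_{n,t}[Ω]`, `n ≥ 1`, in nondecreasing order and repeated according to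
multiplicity: the least `x` such that the eigenvalues in `]-∞, x]` have total multiplicity at
least `n`. -/
def eigenvalue {N : ℕ} (P : Params) (Ω : Set (Space N)) (n : ℕ) : ℝ :=
  sInf {x : ℝ | (n : Cardinal) ≤ Module.rank ℝ ↥(⨆ y ∈ Iic x, eigenspace P Ω y)}

/-- `γ_1, γ_2, …` is a nondecreasing divergent sequence of positive numbers that lists all
eigenvalues, each of them finitely often and exactly as often as its multiplicity. (The value
`γ 0` is irrelevant.) -/
structure IsEigenvalueSequence {N : ℕ} (P : Params) (Ω : Set (Space N)) (γ : ℕ → ℝ) : Prop where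
  pos : ∀ n, 1 ≤ n → 0 < γ n
  mono : ∀ m n, 1 ≤ m → m ≤ n → γ m ≤ γ n
  diverges : Tendsto γ atTop atTop
  finite_multiplicity : ∀ x : ℝ, FiniteDimensional ℝ (eigenspace P Ω x)
  multiplicity : ∀ x : ℝ, Module.finrank ℝ (eigenspace P Ω x) = {n | 1 ≤ n ∧ γ n = x}.ncard

/-! ### Diffeomorphisms of class `C^{1,1}` -/

/-- `f` is of class `C^1` on the open set `U` with Lipschitz continuous gradient. -/
def IsC11On {N : ℕ} (f : Space N → Space N) (U : Set (Space N)) : Prop :=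
  ContDiffOn ℝ 1 f U ∧ ∃ K : ℝ≥0, LipschitzOnWith K (fderiv ℝ f) U

/-- `φ` is a diffeomorphism of class `C^{1,1}` from `Ω` onto the open set `φ(Ω)`: it is injective
on `Ω`, and both `φ` and its inverse are `C^1` with Lipschitz continuous gradients. -/
structure IsC11Diffeo {N : ℕ} (φ : Space N → Space N) (Ω : Set (Space N)) : Prop where
  injOn : InjOn φ Ω
  isOpen_image : IsOpen (φ '' Ω)
  isC11On : IsC11On φ Ω
  inverse : ∃ ψ : Space N → Space N, LeftInvOn ψ φ Ω ∧ IsC11On ψ (φ '' Ω)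

/-- `max_{1 ≤ |α| ≤ 2} sup_Ω |D^α f|` in `[0, ∞]`. For a map with Lipschitz continuous gradient
the second order derivatives exist almost everywhere, and their supremum is the essential one. -/
def derivSup {N : ℕ} (Ω : Set (Space N)) (f : Space N → Space N) : ℝ≥0∞ :=
  max (⨆ i, ⨆ x ∈ Ω, ‖partialDeriv i f x‖ₑ)
    (⨆ i, ⨆ j, essSup (fun x => ‖partialDeriv i (partialDeriv j f) x‖ₑ) (volume.restrict Ω))

/-- `δ(φ) = max_{1 ≤ |α| ≤ 2} sup_{x ∈ Ω} |D^α (φ(x) - x)|`. -/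
def distortion {N : ℕ} (Ω : Set (Space N)) (φ : Space N → Space N) : ℝ≥0∞ :=
  derivSup Ω (fun x => φ x - x)

end ReissnerMindlin

end

/-!
The eigenvalues on `Ω` and on `φ(Ω)` are compared by means of the change of variables
`(β, w) ↦ (∇φᵀ (β ∘ φ), w ∘ φ)` from the energy space of `φ(Ω)` onto that of `Ω`
(`IsTransport.energyEquiv`). The field `β` is transformed like a gradient, so that the shear field
`∇w - β` becomes `∇φᵀ ((∇w - β) ∘ φ)`. Its squared norm changes by a relative amount of order
`δ(φ)`, whatever the weight `μk/t²` in front of it: this is why the constant does not depend on `t`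
and `k`. The price is paid in the other terms of the energy: `∂_j` of the transformed field contains
the second derivatives of `φ` multiplied by `β ∘ φ`. They are of size `δ(φ)`, and `β` is controlled
by `∇β` through Poincaré's inequality in `φ(Ω)`. Hence the energy and the mass both change by a
relative amount of order `δ(φ)` (`IsTransport.abs_energyForm_energyMap_sub_le`,
`IsTransport.abs_massForm_energyMap_sub_le`), and so do the eigenvalues, by min-max
(`abs_countedEigenvalue_sub_le`).

For open sets of finite measure, without any boundedness, both Poincaré's inequality and Rellich's
theorem are obtained from the averages over balls of radius `R`: for `u` in `H¹₀` they differ from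
`u` by at most `R ‖∇u‖` in `L²` (`norm_sub_averageOp_sq_le`), the averaging operator is compact on
`L²(Ω)`, and its norm is at most `1/2` once the ball has twice the measure of `Ω`. The Poincaré
constant therefore depends on `N` and `|Ω|` only (`norm_val_sq_le`, `isCompactOperator_val`).

The energy is coercive for each `t` and `k`, so that the eigenvalue problem is that of a compact
positive form on a Hilbert space (`hasDiscreteSpectrum`). Eigenvalues are counted by the dimension
of the sum of the eigenspaces up to a level, and min-max is used in the form of Glazman's lemma:
a subspace on which the energy is at most `x` times the mass has a dimension at most that of this
sum for every level beyond `x`.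

That the maps between the spaces `H¹₀` are well defined rests on two facts: Lipschitz functions with
compact support in `Ω` belong to `H¹₀(Ω)` (`mem_H10_of_lipschitzWith`), by mollification and
Rademacher's theorem, and an element of `H¹₀(Ω)` is determined by its value (`val_injective`).
-/

noncomputable section

namespace ReissnerMindlin

/-! ### Compact quadratic forms on a Hilbert space -/

section Hilbert

variable {H K : Type*} [NormedAddCommGroup H] [InnerProductSpace ℝ H] [CompleteSpace H]
  [NormedAddCommGroup K] [InnerProductSpace ℝ K]

local notation "⟪" x ", " y "⟫" => inner ℝ x y

/-- A compact operator that is bounded below on a subspace forces it to be finite-dimensional. -/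
theorem finiteDimensional_of_norm_le_of_isCompactOperator {C : H →L[ℝ] K}
    (hC : IsCompactOperator C) (F : Submodule ℝ H) (c : ℝ≥0) (h : ∀ u ∈ F, ‖u‖ ≤ c * ‖C u‖) :
    FiniteDimensional ℝ F := by
  have hcl : ∀ u ∈ F.topologicalClosure, ‖u‖ ≤ c * ‖C u‖ := fun u hu =>
    closure_minimal (t := {u | ‖u‖ ≤ c * ‖C u‖}) h
      (isClosed_le continuous_norm (by fun_prop)) hu
  have hcomp : CompleteSpace F.topologicalClosure :=
    F.isClosed_topologicalClosure.completeSpace_coe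
  let D : F.topologicalClosure →L[ℝ] K := C ∘L F.topologicalClosure.subtypeL
  have hD : IsCompactOperator D := hC.comp_clm F.topologicalClosure.subtypeL
  have hanti : AntilipschitzWith c D := by
    refine AddMonoidHomClass.antilipschitz_of_bound D fun u => ?_
    exact hcl u u.2
  obtain ⟨Q, hQ, hQ'⟩ := hD
  have hid : IsCompactOperator (id : F.topologicalClosure → F.topologicalClosure) :=
    ⟨D ⁻¹' Q, (hanti.isClosedEmbedding D.uniformContinuous).isCompact_preimage hQ, hQ'⟩
  have := FiniteDimensional.of_isCompactOperator_id (𝕜 := ℝ) hid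
  exact Submodule.finiteDimensional_of_le F.le_topologicalClosure

variable [CompleteSpace K]

/-- The solutions `u` of the abstract eigenvalue equation `⟪u, w⟫ = γ ⟪C u, C w⟫` for all `w`. -/
def formEigenspace (C : H →L[ℝ] K) (γ : ℝ) : Submodule ℝ H :=
  LinearMap.ker (ContinuousLinearMap.id ℝ H - γ • (C.adjoint ∘L C) : H →L[ℝ] H).toLinearMap

theorem mem_formEigenspace_iff_eq {C : H →L[ℝ] K} {γ : ℝ} {u : H} :
    u ∈ formEigenspace C γ ↔ u = γ • C.adjoint (C u) := by
  simp [formEigenspace, sub_eq_zero]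

theorem mem_formEigenspace {C : H →L[ℝ] K} {γ : ℝ} {u : H} :
    u ∈ formEigenspace C γ ↔ ∀ w, ⟪u, w⟫ = γ * ⟪C u, C w⟫ := by
  rw [mem_formEigenspace_iff_eq]
  constructor
  · intro h w
    conv_lhs => rw [h]
    rw [real_inner_smul_left, ContinuousLinearMap.adjoint_inner_left]
  · intro h
    refine ext_inner_right ℝ fun w => ?_
    rw [h w, real_inner_smul_left, ContinuousLinearMap.adjoint_inner_left]

theorem formEigenspace_eq_bot_of_nonpos (C : H →L[ℝ] K) {γ : ℝ} (hγ : γ ≤ 0) :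
    formEigenspace C γ = ⊥ := by
  refine (Submodule.eq_bot_iff _).2 fun u hu => ?_
  have h := mem_formEigenspace.1 hu u
  have h2 : ⟪u, u⟫ ≤ 0 := by
    rw [h]
    exact mul_nonpos_of_nonpos_of_nonneg hγ real_inner_self_nonneg
  exact real_inner_self_nonpos.1 h2

theorem formEigenspace_orthogonal {C : H →L[ℝ] K} {γ γ' : ℝ} (h : γ ≠ γ') {u v : H}
    (hu : u ∈ formEigenspace C γ) (hv : v ∈ formEigenspace C γ') :
    ⟪u, v⟫ = 0 ∧ ⟪C u, C v⟫ = 0 := by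
  have h1 := mem_formEigenspace.1 hu v
  have h2 := mem_formEigenspace.1 hv u
  rw [real_inner_comm, real_inner_comm (C u)] at h2
  have h3 : (γ - γ') * ⟪C u, C v⟫ = 0 := by linarith
  have h4 := (mul_eq_zero.1 h3).resolve_left (sub_ne_zero.2 h)
  exact ⟨by rw [h1, h4, mul_zero], h4⟩

theorem formEigenspace_orthogonalFamily (C : H →L[ℝ] K) :
    OrthogonalFamily ℝ (fun γ => formEigenspace C γ) fun γ => (formEigenspace C γ).subtypeₗᵢ :=
  fun _ _ h u v => (formEigenspace_orthogonal h u.2 v.2).1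

/-- On a sum of eigenspaces the Rayleigh quotient is a convex combination of the eigenvalues
involved: both forms are diagonal there. -/
theorem exists_rayleigh_weights (C : H →L[ℝ] K) (S : Set ℝ) {u : H}
    (hu : u ∈ ⨆ y ∈ S, formEigenspace C y) :
    ∃ (s : Finset ℝ) (f : ℝ → ℝ), (∀ y ∈ s, y ∈ S) ∧ (∀ y, 0 ≤ f y) ∧
      ⟪C u, C u⟫ = ∑ y ∈ s, f y ∧ ⟪u, u⟫ = ∑ y ∈ s, y * f y := by
  rw [iSup_subtype', Submodule.mem_iSup_iff_exists_finsupp] at hu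
  obtain ⟨g, hg, rfl⟩ := hu
  classical
  refine ⟨g.support.map (Function.Embedding.subtype _),
    fun y => if h : y ∈ S then ⟪C (g ⟨y, h⟩), C (g ⟨y, h⟩)⟫ else 0, ?_, ?_, ?_, ?_⟩
  · simp only [Finset.mem_map]
    rintro _ ⟨y, -, rfl⟩
    exact y.2
  · intro y
    dsimp only
    split_ifs
    · exact real_inner_self_nonneg
    · exact le_rfl
  · simp only [Finsupp.sum, map_sum, sum_inner, inner_sum, Finset.sum_map]
    refine Finset.sum_congr rfl fun i hi => ?_
    rw [Finset.sum_eq_single i]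
    · simp
    · intro j _ hj
      exact (formEigenspace_orthogonal (fun h => hj (Subtype.ext h)) (hg j) (hg i)).2
    · intro h
      exact absurd hi h
  · simp only [Finsupp.sum, sum_inner, inner_sum, Finset.sum_map]
    refine Finset.sum_congr rfl fun i hi => ?_
    rw [Finset.sum_eq_single i]
    · simpa using mem_formEigenspace.1 (hg i) (g i)
    · intro j _ hj
      exact (formEigenspace_orthogonal (fun h => hj (Subtype.ext h)) (hg j) (hg i)).1
    · intro h
      exact absurd hi h

theorem inner_le_of_mem_iSup_Iic (C : H →L[ℝ] K) {x : ℝ} {u : H}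
    (hu : u ∈ ⨆ y ∈ Iic x, formEigenspace C y) : ⟪u, u⟫ ≤ x * ⟪C u, C u⟫ := by
  obtain ⟨s, f, hs, hf, h1, h2⟩ := exists_rayleigh_weights C _ hu
  rw [h1, h2, Finset.mul_sum]
  exact Finset.sum_le_sum fun y hy => mul_le_mul_of_nonneg_right (hs y hy) (hf y)

theorem le_inner_of_mem_iSup_Ioi (C : H →L[ℝ] K) {x : ℝ} {u : H}
    (hu : u ∈ ⨆ y ∈ Ioi x, formEigenspace C y) : x * ⟪C u, C u⟫ ≤ ⟪u, u⟫ := by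
  obtain ⟨s, f, hs, hf, h1, h2⟩ := exists_rayleigh_weights C _ hu
  rw [h1, h2, Finset.mul_sum]
  exact Finset.sum_le_sum fun y hy => mul_le_mul_of_nonneg_right (hs y hy).le (hf y)

theorem finiteDimensional_iSup_Iic_formEigenspace {C : H →L[ℝ] K} (hC : IsCompactOperator C)
    (x : ℝ) : FiniteDimensional ℝ (⨆ y ∈ Iic x, formEigenspace C y : Submodule ℝ H) := by
  refine finiteDimensional_of_norm_le_of_isCompactOperator hC _ (Real.sqrt x).toNNReal
    fun u hu => ?_
  have h := inner_le_of_mem_iSup_Iic C hu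
  rw [real_inner_self_eq_norm_sq, real_inner_self_eq_norm_sq] at h
  rw [Real.coe_toNNReal _ (Real.sqrt_nonneg x)]
  rcases le_or_gt 0 x with hx | hx
  · refine le_of_sq_le_sq ?_ (by positivity)
    rw [mul_pow, Real.sq_sqrt hx]
    exact h
  · have : ‖u‖ ^ 2 ≤ 0 := h.trans (mul_nonpos_of_nonpos_of_nonneg hx.le (sq_nonneg _))
    have : ‖u‖ = 0 := by nlinarith [norm_nonneg u]
    rw [this]
    positivity

/-- The eigenspaces of a compact form are complete: nothing but zero is orthogonal to them all. -/
theorem iSup_formEigenspace_orthogonal {C : H →L[ℝ] K} (hC : IsCompactOperator C)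
    (hinj : Function.Injective C) : (⨆ y, formEigenspace C y)ᗮ = ⊥ := by
  set T : H →L[ℝ] H := C.adjoint ∘L C with hTdef
  have hT : IsCompactOperator T := hC.clm_comp C.adjoint
  have hT' : T.IsSymmetric := fun u v => by
    simp [T, ContinuousLinearMap.adjoint_inner_left, ContinuousLinearMap.adjoint_inner_right]
  refine eq_bot_mono ?_ (ContinuousLinearMap.orthogonalComplement_iSup_eigenspaces_eq_bot hT hT')
  refine Submodule.orthogonal_le (iSup_le fun μ => ?_)
  intro u hu
  have hu' : T u = μ • u := Module.End.mem_eigenspace_iff.1 hu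
  rcases eq_or_ne μ 0 with rfl | hμ
  · have h0 : ⟪C u, C u⟫ = 0 := by
      rw [← ContinuousLinearMap.adjoint_inner_left]
      change ⟪T u, u⟫ = 0
      rw [hu', zero_smul, inner_zero_left]
    have : u = 0 := hinj (by rw [inner_self_eq_zero.1 h0, map_zero])
    rw [this]
    exact zero_mem _
  · refine Submodule.mem_iSup_of_mem μ⁻¹ (mem_formEigenspace_iff_eq.2 ?_)
    change u = μ⁻¹ • T u
    rw [hu', smul_smul, inv_mul_cancel₀ hμ, one_smul]

/-- On the complement of the eigenspaces up to `x` the Rayleigh quotient is at least `x`: by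
completeness this complement lies in the closure of the sum of the other eigenspaces. -/
theorem le_inner_of_orthogonal {C : H →L[ℝ] K} (hC : IsCompactOperator C)
    (hinj : Function.Injective C) {x : ℝ} {u : H}
    (hu : u ∈ (⨆ y ∈ Iic x, formEigenspace C y)ᗮ) : x * ⟪C u, C u⟫ ≤ ⟪u, u⟫ := by
  set G := ⨆ y ∈ Iic x, formEigenspace C y with hG
  set G' := ⨆ y ∈ Ioi x, formEigenspace C y with hG'
  have : FiniteDimensional ℝ G := finiteDimensional_iSup_Iic_formEigenspace hC x
  have horth : G ⟂ G' := by
    rw [hG, hG']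
    refine Submodule.isOrtho_iSup_left.2 fun y => Submodule.isOrtho_iSup_left.2 fun hy =>
      Submodule.isOrtho_iSup_right.2 fun y' => Submodule.isOrtho_iSup_right.2 fun hy' => ?_
    refine Submodule.isOrtho_iff_inner_eq.2 fun a ha b hb => ?_
    exact (formEigenspace_orthogonal (hy.out.trans_lt hy'.out).ne ha hb).1
  have hclos : u ∈ G'.topologicalClosure := by
    rw [← Submodule.orthogonal_orthogonal_eq_closure]
    refine (Submodule.mem_orthogonal _ _).2 fun v hv => ?_
    obtain ⟨g, hg, v', hv', rfl⟩ := G.exists_add_mem_mem_orthogonal v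
    have hv0 : v' ∈ (⨆ y, formEigenspace C y)ᗮ := by
      refine (Submodule.mem_orthogonal _ _).2 fun w hw => ?_
      have hle : (⨆ y, formEigenspace C y) ≤ G ⊔ G' := by
        refine iSup_le fun y => ?_
        rcases le_or_gt y x with h | h
        · exact (le_iSup₂_of_le (f := fun y (_ : y ∈ Iic x) => formEigenspace C y) y h
            le_rfl).trans le_sup_left
        · exact (le_iSup₂_of_le (f := fun y (_ : y ∈ Ioi x) => formEigenspace C y) y h
            le_rfl).trans le_sup_right
      obtain ⟨p, hp, q, hq, rfl⟩ := Submodule.mem_sup.1 (hle hw)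
      have h1 : ⟪p, v'⟫ = 0 := (Submodule.mem_orthogonal _ _).1 hv' p hp
      have h2 : ⟪q, g + v'⟫ = 0 := (Submodule.mem_orthogonal _ _).1 hv q hq
      have h3 : ⟪q, g⟫ = 0 := horth.symm.inner_eq hq hg
      rw [inner_add_right, h3, zero_add] at h2
      rw [inner_add_left, h1, h2, zero_add]
    rw [iSup_formEigenspace_orthogonal hC hinj, Submodule.mem_bot] at hv0
    rw [hv0, add_zero]
    exact (Submodule.mem_orthogonal _ _).1 hu g hg
  exact closure_minimal (t := {u | x * ⟪C u, C u⟫ ≤ ⟪u, u⟫})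
    (fun w hw => le_inner_of_mem_iSup_Ioi C hw)
    (isClosed_le (by fun_prop) (by fun_prop)) hclos

/-- A form of the min-max principle (Glazman's lemma): a subspace on which the Rayleigh quotient is
at most `x` is not larger than the sum of the eigenspaces up to any `x' > x`. -/
theorem rank_le_of_inner_le {C : H →L[ℝ] K} (hC : IsCompactOperator C)
    (hinj : Function.Injective C) (F : Submodule ℝ H) {x x' : ℝ} (hx : x < x')
    (hF : ∀ u ∈ F, ⟪u, u⟫ ≤ x * ⟪C u, C u⟫) :
    Module.rank ℝ F ≤ Module.rank ℝ (⨆ y ∈ Iic x', formEigenspace C y : Submodule ℝ H) := by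
  -- The orthogonal projection onto the sum of the eigenspaces is injective on `F`.
  set G := ⨆ y ∈ Iic x', formEigenspace C y with hG
  have : FiniteDimensional ℝ G := finiteDimensional_iSup_Iic_formEigenspace hC x'
  refine LinearMap.rank_le_of_injective
    (G.orthogonalProjectionOnto.toLinearMap ∘ₗ F.subtype) ?_
  rw [injective_iff_map_eq_zero]
  intro u hu
  have h1 : (u : H) ∈ Gᗮ := Submodule.orthogonalProjectionOnto_eq_zero_iff.1 hu
  have h2 := le_inner_of_orthogonal hC hinj h1
  have h3 := hF u u.2
  have h4 : ⟪C u, C u⟫ ≤ 0 := by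
    by_contra! h
    nlinarith
  have h5 : (u : H) = 0 := hinj (by rw [real_inner_self_nonpos.1 h4, map_zero])
  exact Subtype.ext h5

/-- On a space of dimension `n` the Rayleigh quotient is bounded, so that Glazman's lemma
yields `n` eigenvalues. -/
theorem exists_le_rank_iSup_formEigenspace {C : H →L[ℝ] K} (hC : IsCompactOperator C)
    (hinj : Function.Injective C) (hinf : ¬ FiniteDimensional ℝ H) (n : ℕ) :
    ∃ x : ℝ, (n : Cardinal) ≤
      Module.rank ℝ (⨆ y ∈ Iic x, formEigenspace C y : Submodule ℝ H) := by
  have hrank : (n : Cardinal) ≤ Module.rank ℝ H := by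
    rw [FiniteDimensional, ← Module.rank_lt_aleph0_iff, not_lt] at hinf
    exact (Cardinal.natCast_lt_aleph0).le.trans hinf
  obtain ⟨s, hs, hli⟩ := exists_finset_linearIndependent_of_le_rank hrank
  let F : Submodule ℝ H := Submodule.span ℝ (s : Set H)
  have hfin : FiniteDimensional ℝ F := FiniteDimensional.span_finset ℝ s
  have hFr : Module.rank ℝ F = n := by
    have := rank_span_set (R := ℝ) hli
    rw [this]
    simp [hs]
  obtain ⟨c, hc, hanti⟩ := LinearMap.exists_antilipschitzWith (C.toLinearMap ∘ₗ F.subtype)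
    (LinearMap.ker_eq_bot.2 (hinj.comp Subtype.val_injective))
  refine ⟨(c : ℝ) ^ 2 + 1, ?_⟩
  rw [← hFr]
  refine rank_le_of_inner_le hC hinj F (lt_add_one _) fun u hu => ?_
  have h := hanti.le_mul_dist ⟨u, hu⟩ 0
  simp only [dist_zero_right, map_zero] at h
  change ‖u‖ ≤ c * ‖C u‖ at h
  rw [real_inner_self_eq_norm_sq, real_inner_self_eq_norm_sq, ← mul_pow]
  exact pow_le_pow_left₀ (norm_nonneg _) h 2

end Hilbert

/-! ### Discrete spectra and their counting function -/

section Counting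

universe u

/-- The sum of the eigenspaces `E y` with `y ≤ x`. -/
def spectralSum {V : Type*} [AddCommGroup V] [Module ℝ V] (E : ℝ → Submodule ℝ V) (x : ℝ) :
    Submodule ℝ V :=
  ⨆ y ∈ Iic x, E y

/-- The least `x` such that the eigenspaces up to `x` have total dimension at least `n`. -/
def countedEigenvalue {V : Type*} [AddCommGroup V] [Module ℝ V] (E : ℝ → Submodule ℝ V)
    (n : ℕ) : ℝ :=
  sInf {x : ℝ | (n : Cardinal) ≤ Module.rank ℝ (spectralSum E x)}

/-- The properties of the eigenspaces `E γ` of a form `a` with respect to a form `m` that determine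
the sequence of eigenvalues and the min-max principle. -/
structure HasDiscreteSpectrum {V : Type*} [AddCommGroup V] [Module ℝ V] (a m : V → ℝ)
    (E : ℝ → Submodule ℝ V) : Prop where
  bot_of_nonpos : ∀ γ ≤ 0, E γ = ⊥
  independent : iSupIndep E
  finite : ∀ x, FiniteDimensional ℝ (spectralSum E x)
  form_le : ∀ x, ∀ u ∈ spectralSum E x, a u ≤ x * m u
  rank_le : ∀ (F : Submodule ℝ V) (x x' : ℝ), x < x' → (∀ u ∈ F, a u ≤ x * m u) →
    Module.rank ℝ F ≤ Module.rank ℝ (spectralSum E x')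
  unbounded : ∀ n : ℕ, ∃ x : ℝ, (n : Cardinal) ≤ Module.rank ℝ (spectralSum E x)

variable {V : Type*} [AddCommGroup V] [Module ℝ V] {E : ℝ → Submodule ℝ V}

theorem le_spectralSum {x y : ℝ} (h : y ≤ x) : E y ≤ spectralSum E x :=
  le_iSup₂_of_le (f := fun y (_ : y ∈ Iic x) => E y) y h le_rfl

theorem spectralSum_le {x : ℝ} {F : Submodule ℝ V} (h : ∀ y ≤ x, E y ≤ F) : spectralSum E x ≤ F :=
  iSup₂_le h

theorem spectralSum_mono {x x' : ℝ} (h : x ≤ x') : spectralSum E x ≤ spectralSum E x' :=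
  spectralSum_le fun _ hy => le_spectralSum (hy.trans h)

namespace HasDiscreteSpectrum

variable {a m : V → ℝ}

theorem finite_eigenspace (h : HasDiscreteSpectrum a m E) (x : ℝ) : FiniteDimensional ℝ (E x) :=
  have := h.finite x
  Submodule.finiteDimensional_of_le (le_spectralSum le_rfl)

theorem le_rank_iff (h : HasDiscreteSpectrum a m E) (n : ℕ) (x : ℝ) :
    (n : Cardinal) ≤ Module.rank ℝ (spectralSum E x) ↔ n ≤ Module.finrank ℝ (spectralSum E x) := by
  have := h.finite x
  rw [← Module.finrank_eq_rank]
  exact Nat.cast_le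

theorem finrank_mono (h : HasDiscreteSpectrum a m E) {x x' : ℝ} (hx : x ≤ x') :
    Module.finrank ℝ (spectralSum E x) ≤ Module.finrank ℝ (spectralSum E x') :=
  have := h.finite x'
  Submodule.finrank_mono (spectralSum_mono hx)

theorem spectralSum_nonpos (h : HasDiscreteSpectrum a m E) {x : ℝ} (hx : x ≤ 0) :
    spectralSum E x = ⊥ :=
  le_bot_iff.1 (spectralSum_le fun y hy => (h.bot_of_nonpos y (hy.trans hx)).le)

theorem disjoint_eigenspace (h : HasDiscreteSpectrum a m E) {x : ℝ} {S : Set ℝ} (hx : x ∉ S) :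
    Disjoint (E x) (⨆ y ∈ S, E y) := by
  refine (h.independent x).mono_right (iSup₂_le fun y hy => ?_)
  exact le_iSup₂_of_le (f := fun y (_ : y ≠ x) => E y) y (fun e => hx (e ▸ hy)) le_rfl

/-- The counting function is continuous from the right: being integer valued, it attains its
minimum over `(x, ∞)` at some `x'`, so that no eigenvalue lies in `(x, x']`. -/
theorem exists_gap (h : HasDiscreteSpectrum a m E) (x : ℝ) :
    ∃ x' > x, spectralSum E x' = spectralSum E x := by
  obtain ⟨⟨x', hx'⟩, hmin⟩ : ∃ x' : Ioi x, ∀ z : Ioi x, Module.finrank ℝ (spectralSum E x') ≤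
      Module.finrank ℝ (spectralSum E z) := by
    have : Nonempty (Ioi x) := ⟨⟨x + 1, lt_add_one x⟩⟩
    exact ⟨Function.argmin fun z : Ioi x => Module.finrank ℝ (spectralSum E z),
      fun z => Function.argmin_le (fun z : Ioi x => Module.finrank ℝ (spectralSum E z)) z⟩
  have f := h.finite x'
  refine ⟨x', hx', le_antisymm (spectralSum_le fun y hy => ?_) (spectralSum_mono hx'.out.le)⟩
  rcases le_or_gt y x with hyx | hyx
  · exact le_spectralSum hyx
  · have hmid : x < (x + y) / 2 := by linarith
    have he : spectralSum E ((x + y) / 2) = spectralSum E x' :=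
      Submodule.eq_of_le_of_finrank_le (spectralSum_mono (by linarith)) (hmin ⟨_, hmid⟩)
    have hd : Disjoint (E y) (spectralSum E ((x + y) / 2)) :=
      h.disjoint_eigenspace (S := Iic ((x + y) / 2)) fun hc => by
        have := hc.out
        linarith
    rw [he] at hd
    rw [hd.eq_bot_of_le (le_spectralSum hy)]
    exact bot_le

/-- The infimum in the definition of `countedEigenvalue` is attained. -/
theorem countedEigenvalue_le_iff (h : HasDiscreteSpectrum a m E) {n : ℕ} (hn : 1 ≤ n) (x : ℝ) :
    countedEigenvalue E n ≤ x ↔ n ≤ Module.finrank ℝ (spectralSum E x) := by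
  have hpos : ∀ y, n ≤ Module.finrank ℝ (spectralSum E y) → 0 < y := by
    intro y hy
    by_contra! hy0
    rw [h.spectralSum_nonpos hy0, finrank_bot] at hy
    omega
  constructor
  · intro hx
    by_contra! hlt
    obtain ⟨x', hx', he⟩ := h.exists_gap x
    have hle : x' ≤ countedEigenvalue E n := by
      refine le_csInf (h.unbounded n) fun y hy => ?_
      by_contra! hyx
      have h1 := (h.le_rank_iff n y).1 hy
      have h2 := h.finrank_mono hyx.le
      rw [he] at h2
      omega
    linarith
  · intro hx
    exact csInf_le ⟨0, fun y hy => (hpos y ((h.le_rank_iff n y).1 hy)).le⟩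
      ((h.le_rank_iff n x).2 hx)

theorem countedEigenvalue_pos (h : HasDiscreteSpectrum a m E) {n : ℕ} (hn : 1 ≤ n) :
    0 < countedEigenvalue E n := by
  rw [← not_le, h.countedEigenvalue_le_iff hn, h.spectralSum_nonpos le_rfl, finrank_bot]
  omega

theorem countedEigenvalue_mono (h : HasDiscreteSpectrum a m E) {n n' : ℕ} (hn : 1 ≤ n)
    (hnn : n ≤ n') : countedEigenvalue E n ≤ countedEigenvalue E n' :=
  (h.countedEigenvalue_le_iff hn _).2
    (hnn.trans ((h.countedEigenvalue_le_iff (hn.trans hnn) _).1 le_rfl))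

theorem tendsto_countedEigenvalue (h : HasDiscreteSpectrum a m E) :
    Tendsto (countedEigenvalue E) atTop atTop := by
  refine tendsto_atTop.2 fun b => ?_
  filter_upwards [eventually_gt_atTop (Module.finrank ℝ (spectralSum E b))] with n hn
  by_contra! hlt
  exact absurd ((h.countedEigenvalue_le_iff (by omega) b).1 hlt.le) (by omega)

/-- The counting function has limits from the left, attained already before `x`. -/
theorem exists_iSup_Iio_eq (h : HasDiscreteSpectrum a m E) (x : ℝ) :
    ∃ y < x, ⨆ z ∈ Iio x, E z = spectralSum E y := by
  obtain ⟨⟨y, hy⟩, hmax⟩ : ∃ y : Iio x, ∀ z : Iio x, Module.finrank ℝ (spectralSum E z) ≤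
      Module.finrank ℝ (spectralSum E y) := by
    have : Nonempty (Iio x) := ⟨⟨x - 1, sub_one_lt x⟩⟩
    let f : Iio x → ℕ := fun z =>
      Module.finrank ℝ (spectralSum E x) - Module.finrank ℝ (spectralSum E z)
    refine ⟨Function.argmin f, fun z => ?_⟩
    have h1 : f (Function.argmin f) ≤ f z := Function.argmin_le f z
    have h2 := h.finrank_mono z.2.out.le
    have h3 := h.finrank_mono (Function.argmin f).2.out.le
    simp only [f] at h1 h2 h3 ⊢
    omega
  refine ⟨y, hy, le_antisymm (iSup₂_le fun z hz => ?_)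
    (spectralSum_le fun z hz => le_iSup₂_of_le (f := fun z (_ : z ∈ Iio x) => E z) z
      (hz.trans_lt hy) le_rfl)⟩
  rcases le_total z y with hzy | hzy
  · exact le_spectralSum hzy
  · have := h.finite z
    rw [Submodule.eq_of_le_of_finrank_le (spectralSum_mono hzy) (hmax ⟨z, hz⟩)]
    exact le_spectralSum le_rfl

/-- The indices `n` with `n`-th eigenvalue `x` are those between the values of the counting
function before `x` and at `x`, and its jump at `x` is the multiplicity. -/
theorem finrank_eigenspace_eq_ncard (h : HasDiscreteSpectrum a m E) (x : ℝ) :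
    Module.finrank ℝ (E x) = {n | 1 ≤ n ∧ countedEigenvalue E n = x}.ncard := by
  obtain ⟨y, hyx, hy⟩ := h.exists_iSup_Iio_eq x
  have f1 := h.finite y
  have f2 := h.finite_eigenspace x
  have hsup : spectralSum E x = E x ⊔ spectralSum E y := by
    refine le_antisymm (spectralSum_le fun z hz => ?_)
      (sup_le (le_spectralSum le_rfl) (spectralSum_mono hyx.le))
    rcases hz.eq_or_lt with rfl | hz
    · exact le_sup_left
    · rw [← hy]
      exact (le_iSup₂_of_le (f := fun z (_ : z ∈ Iio x) => E z) z hz le_rfl).trans le_sup_right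
  have hdisj : E x ⊓ spectralSum E y = ⊥ := by
    rw [← hy]
    exact (h.disjoint_eigenspace (S := Iio x) (lt_irrefl x)).eq_bot
  have hdim := Submodule.finrank_sup_add_finrank_inf_eq (E x) (spectralSum E y)
  rw [← hsup, hdisj, finrank_bot] at hdim
  have hlt : ∀ n, 1 ≤ n → (countedEigenvalue E n < x ↔
      n ≤ Module.finrank ℝ (spectralSum E y)) := by
    intro n hn
    constructor
    · intro hnx
      have h1 := (h.countedEigenvalue_le_iff hn _).1 le_rfl
      refine h1.trans (Submodule.finrank_mono ?_)
      rw [← hy]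
      exact spectralSum_le fun z hz =>
        le_iSup₂_of_le (f := fun z (_ : z ∈ Iio x) => E z) z (hz.trans_lt hnx) le_rfl
    · intro hn'
      exact ((h.countedEigenvalue_le_iff hn y).2 hn').trans_lt hyx
  have hset : {n | 1 ≤ n ∧ countedEigenvalue E n = x} =
      (Finset.Ioc (Module.finrank ℝ (spectralSum E y))
        (Module.finrank ℝ (spectralSum E x)) : Set ℕ) := by
    ext n
    simp only [mem_ofPred_eq, Finset.coe_Ioc, mem_Ioc]
    constructor
    · rintro ⟨hn, hx⟩
      exact ⟨not_le.1 fun hc => ((hlt n hn).2 hc).ne hx, (h.countedEigenvalue_le_iff hn x).1 hx.le⟩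
    · rintro ⟨h1, h2⟩
      have hn : 1 ≤ n := by omega
      exact ⟨hn, ((h.countedEigenvalue_le_iff hn x).2 h2).antisymm
        (not_lt.1 fun hc => absurd ((hlt n hn).1 hc) (by omega))⟩
  rw [hset, ncard_coe_finset, Nat.card_Ioc]
  omega

end HasDiscreteSpectrum

/-- Comparison of eigenvalues: a linear injection that increases the Rayleigh quotient by a factor
of at most `κ * κ'` increases the eigenvalues by no more than this factor. -/
theorem HasDiscreteSpectrum.countedEigenvalue_le {V V' : Type*} [AddCommGroup V] [Module ℝ V]
    [AddCommGroup V'] [Module ℝ V'] {E : ℝ → Submodule ℝ V} {E' : ℝ → Submodule ℝ V'}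
    {a m : V → ℝ} {a' m' : V' → ℝ} (h : HasDiscreteSpectrum a m E)
    (h' : HasDiscreteSpectrum a' m' E') (S : V →ₗ[ℝ] V') (hS : Function.Injective S) {κ κ' : ℝ}
    (hκ : 0 ≤ κ) (ha : ∀ u, a' (S u) ≤ κ * a u) (hm : ∀ u, m u ≤ κ' * m' (S u))
    {n : ℕ} (hn : 1 ≤ n) :
    countedEigenvalue E' n ≤ κ * κ' * countedEigenvalue E n := by
  set γ := countedEigenvalue E n with hγ
  have hγpos : 0 < γ := h.countedEigenvalue_pos hn
  refine le_of_forall_gt_imp_ge_of_dense fun x' hx' => ?_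
  rw [h'.countedEigenvalue_le_iff hn]
  have h1 : n ≤ Module.finrank ℝ (spectralSum E γ) := (h.countedEigenvalue_le_iff hn γ).1 le_rfl
  have f := h.finite γ
  have f' := h'.finite x'
  have h2 := h'.rank_le ((spectralSum E γ).map S) _ x' hx' <| by
    rintro _ ⟨u, hu, rfl⟩
    calc a' (S u) ≤ κ * a u := ha u
      _ ≤ κ * (γ * (κ' * m' (S u))) := by
        gcongr
        exact (h.form_le γ u hu).trans (mul_le_mul_of_nonneg_left (hm u) hγpos.le)
      _ = κ * κ' * γ * m' (S u) := by ring
  rw [← Module.finrank_eq_rank, ← Module.finrank_eq_rank, Nat.cast_le,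
    (Submodule.equivMapOfInjective S hS (spectralSum E γ)).symm.finrank_eq] at h2
  exact h1.trans h2

/-- A pair of forms which become, after a linear change of variables, the scalar product of a
Hilbert space and a compact positive form has discrete spectrum. -/
theorem hasDiscreteSpectrum_of_isCompactOperator {V H : Type u} {K : Type*} [AddCommGroup V]
    [Module ℝ V] [NormedAddCommGroup H] [InnerProductSpace ℝ H] [CompleteSpace H]
    [NormedAddCommGroup K] [InnerProductSpace ℝ K] [CompleteSpace K] (e : V ≃ₗ[ℝ] H)
    {C : H →L[ℝ] K} (hC : IsCompactOperator C) (hinj : Function.Injective C)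
    (hinf : ¬ FiniteDimensional ℝ V) {a m : V → V → ℝ}
    (ha : ∀ u w, a u w = inner ℝ (e u) (e w)) (hm : ∀ u w, m u w = inner ℝ (C (e u)) (C (e w)))
    {E : ℝ → Submodule ℝ V} (hE : ∀ γ u, u ∈ E γ ↔ ∀ w, a u w = γ * m u w) :
    HasDiscreteSpectrum (fun u => a u u) (fun u => m u u) E := by
  have hmap : ∀ γ, (E γ).map (e : V →ₗ[ℝ] H) = formEigenspace C γ := by
    intro γ
    ext u
    rw [Submodule.mem_map_equiv, hE, mem_formEigenspace]
    constructor
    · intro h w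
      simpa [ha, hm] using h (e.symm w)
    · intro h w
      simpa [ha, hm] using h (e w)
  have hsum : ∀ x, (spectralSum E x).map (e : V →ₗ[ℝ] H) =
      ⨆ y ∈ Iic x, formEigenspace C y := by
    intro x
    simp only [spectralSum, Submodule.map_iSup, hmap]
  have hrank : ∀ x, Module.rank ℝ (spectralSum E x) =
      Module.rank ℝ (⨆ y ∈ Iic x, formEigenspace C y : Submodule ℝ H) := by
    intro x
    rw [← hsum, LinearEquiv.rank_map_eq]
  refine ⟨fun γ hγ => ?_, ?_, fun x => ?_, fun x u hu => ?_, fun F x x' hx hF => ?_, fun n => ?_⟩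
  · have := hmap γ
    rw [formEigenspace_eq_bot_of_nonpos C hγ] at this
    exact (Submodule.map_eq_bot_iff (e := e)).1 this
  · have hi := (formEigenspace_orthogonalFamily C).independent
    have : formEigenspace C = fun γ => Submodule.orderIsoMapComap e (E γ) :=
      funext fun γ => (hmap γ).symm
    rw [this] at hi
    exact (iSupIndep_map_orderIso_iff (Submodule.orderIsoMapComap e)).1 hi
  · have := finiteDimensional_iSup_Iic_formEigenspace hC x
    rw [FiniteDimensional, ← Module.rank_lt_aleph0_iff, hrank]
    exact Module.rank_lt_aleph0_iff.2 this
  · rw [ha, hm]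
    refine inner_le_of_mem_iSup_Iic C ?_
    rw [← hsum]
    exact Submodule.mem_map_of_mem hu
  · rw [hrank, ← LinearEquiv.rank_map_eq e]
    refine rank_le_of_inner_le hC hinj _ hx ?_
    rintro _ ⟨u, hu, rfl⟩
    have := hF u hu
    rwa [ha, hm] at this
  · obtain ⟨x, hx⟩ := exists_le_rank_iSup_formEigenspace hC hinj
      (fun h => hinf (LinearEquiv.finiteDimensional e.symm)) n
    exact ⟨x, by rwa [hrank]⟩

end Counting

theorem HasDiscreteSpectrum.isEigenvalueSequence {N : ℕ} {P : Params} {Ω : Set (Space N)}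
    {a m : EnergySpace Ω → ℝ} (h : HasDiscreteSpectrum a m (eigenspace P Ω)) :
    IsEigenvalueSequence P Ω (eigenvalue P Ω) where
  pos _ hn := h.countedEigenvalue_pos hn
  mono _ _ hm hmn := h.countedEigenvalue_mono hm hmn
  diverges := h.tendsto_countedEigenvalue
  finite_multiplicity := h.finite_eigenspace
  multiplicity := h.finrank_eigenspace_eq_ncard

/-! ### Translations, averages over balls, and Rellich's theorem on sets of finite measure -/

theorem sq_lintegral_le_lintegral_sq {α : Type*} [MeasurableSpace α] (ν : Measure α)
    [IsProbabilityMeasure ν] {g : α → ℝ≥0∞} (hg : AEMeasurable g ν) :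
    (∫⁻ s, g s ∂ν) ^ 2 ≤ ∫⁻ s, g s ^ 2 ∂ν := by
  have h := ENNReal.lintegral_mul_le_Lp_mul_Lq ν Real.HolderConjugate.two_two hg
    (aemeasurable_const (b := (1 : ℝ≥0∞)))
  simp only [Pi.mul_apply, mul_one, ENNReal.one_rpow, lintegral_const, measure_univ] at h
  calc (∫⁻ s, g s ∂ν) ^ 2 ≤ ((∫⁻ s, g s ^ (2 : ℝ) ∂ν) ^ (1 / 2 : ℝ)) ^ 2 := by gcongr
    _ = ∫⁻ s, g s ^ 2 ∂ν := by
      rw [← ENNReal.rpow_natCast, ← ENNReal.rpow_mul]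
      simp

section Translation

variable {N : ℕ}

theorem enorm_integral_sq_le {α : Type*} [MeasurableSpace α] (ν : Measure α)
    [IsProbabilityMeasure ν] {g : α → ℝ} (hg : AEStronglyMeasurable g ν) :
    ‖∫ s, g s ∂ν‖ₑ ^ 2 ≤ ∫⁻ s, ‖g s‖ₑ ^ 2 ∂ν :=
  (pow_le_pow_left₀ zero_le (enorm_integral_le_lintegral_enorm g) 2).trans
    (sq_lintegral_le_lintegral_sq ν hg.enorm)

/-- The translation estimate `‖f(· + h) - f‖ ≤ ‖h‖ ‖∇f‖` in `L²`. -/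
theorem lintegral_enorm_translate_sub_sq_le {f : Space N → ℝ} (hf : ContDiff ℝ 1 f) (h : Space N) :
    ∫⁻ x, ‖f (x + h) - f x‖ₑ ^ 2 ≤ ‖h‖ₑ ^ 2 * ∫⁻ x, ‖fderiv ℝ f x‖ₑ ^ 2 := by
  let ν : Measure ℝ := volume.restrict (Ioc 0 1)
  have : IsProbabilityMeasure ν := ⟨by simp [ν]⟩
  have hcont : Continuous (fderiv ℝ f) := hf.continuous_fderiv (by simp)
  have hF : Continuous fun p : Space N × ℝ => fderiv ℝ f (p.1 + p.2 • h) := by fun_prop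
  have hpt : ∀ x, ‖f (x + h) - f x‖ₑ ^ 2 ≤ ∫⁻ s, ‖h‖ₑ ^ 2 * ‖fderiv ℝ f (x + s • h)‖ₑ ^ 2 ∂ν := by
    intro x
    have hd : ∀ s : ℝ, HasDerivAt (fun s : ℝ => f (x + s • h)) (fderiv ℝ f (x + s • h) h) s := by
      intro s
      have h1 : HasDerivAt (fun s : ℝ => x + s • h) h s := by
        simpa using ((hasDerivAt_id s).smul_const h).const_add x
      exact ((hf.differentiable (by simp) _).hasFDerivAt).comp_hasDerivAt s h1
    have hc : Continuous fun s : ℝ => fderiv ℝ f (x + s • h) h := by fun_prop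
    have he := intervalIntegral.integral_eq_sub_of_hasDerivAt (a := 0) (b := 1)
      (fun s _ => hd s) (hc.intervalIntegrable _ _)
    simp only [one_smul, zero_smul, add_zero] at he
    rw [← he, intervalIntegral.integral_of_le zero_le_one]
    refine (enorm_integral_sq_le ν hc.aestronglyMeasurable).trans (lintegral_mono fun s => ?_)
    rw [← mul_pow, mul_comm]
    exact pow_le_pow_left₀ zero_le (ContinuousLinearMap.le_opENorm _ _) 2
  calc ∫⁻ x, ‖f (x + h) - f x‖ₑ ^ 2
      ≤ ∫⁻ x, ∫⁻ s, ‖h‖ₑ ^ 2 * ‖fderiv ℝ f (x + s • h)‖ₑ ^ 2 ∂ν := lintegral_mono hpt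
    _ = ∫⁻ s, (∫⁻ x, ‖h‖ₑ ^ 2 * ‖fderiv ℝ f (x + s • h)‖ₑ ^ 2) ∂ν := by
      refine lintegral_lintegral_swap (Measurable.aemeasurable ?_)
      exact (hF.enorm.measurable.pow_const 2).const_mul _
    _ = ∫⁻ _ : ℝ, (‖h‖ₑ ^ 2 * ∫⁻ x, ‖fderiv ℝ f x‖ₑ ^ 2) ∂ν := by
      refine lintegral_congr fun s => ?_
      rw [lintegral_const_mul _ (by fun_prop)]
      congr 1
      exact lintegral_add_right_eq_self (fun x => ‖fderiv ℝ f x‖ₑ ^ 2) (s • h)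
    _ = _ := by simp

theorem lintegral_enorm_sub_average_sq_le {f : Space N → ℝ} (hf : ContDiff ℝ 1 f)
    (hc : HasCompactSupport f) (ν : Measure (Space N)) [IsProbabilityMeasure ν] {R : ℝ}
    (hR : ∀ᵐ h ∂ν, ‖h‖ ≤ R) :
    ∫⁻ x, ‖f x - ∫ h, f (x + h) ∂ν‖ₑ ^ 2 ≤
      ENNReal.ofReal R ^ 2 * ∫⁻ x, ‖fderiv ℝ f x‖ₑ ^ 2 := by
  have hfc : Continuous f := hf.continuous
  have hpt : ∀ x, ‖f x - ∫ h, f (x + h) ∂ν‖ₑ ^ 2 ≤ ∫⁻ h, ‖f (x + h) - f x‖ₑ ^ 2 ∂ν := by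
    intro x
    obtain ⟨M, hM⟩ := hfc.bounded_above_of_compact_support hc
    have hi : Integrable (fun h => f (x + h)) ν :=
      Integrable.of_bound (by fun_prop) M (Eventually.of_forall fun h => hM _)
    have he : f x - ∫ h, f (x + h) ∂ν = -∫ h, (f (x + h) - f x) ∂ν := by
      rw [integral_sub hi (integrable_const _)]
      simp
    rw [he, enorm_neg]
    exact enorm_integral_sq_le ν (by fun_prop)
  calc ∫⁻ x, ‖f x - ∫ h, f (x + h) ∂ν‖ₑ ^ 2
      ≤ ∫⁻ x, ∫⁻ h, ‖f (x + h) - f x‖ₑ ^ 2 ∂ν := lintegral_mono hpt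
    _ = ∫⁻ h, (∫⁻ x, ‖f (x + h) - f x‖ₑ ^ 2) ∂ν :=
      lintegral_lintegral_swap (Measurable.aemeasurable
        (Continuous.measurable (by fun_prop)))
    _ ≤ ∫⁻ _ : Space N, (ENNReal.ofReal R ^ 2 * ∫⁻ x, ‖fderiv ℝ f x‖ₑ ^ 2) ∂ν := by
      refine lintegral_mono_ae ?_
      filter_upwards [hR] with h hh
      refine (lintegral_enorm_translate_sub_sq_le hf h).trans ?_
      gcongr
      rw [← ofReal_norm]
      exact ENNReal.ofReal_le_ofReal hh
    _ = _ := by simp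

theorem fderiv_apply_eq_sum (f : Space N → ℝ) (x h : Space N) :
    fderiv ℝ f x h = ∑ i, h i * partialDeriv i f x := by
  conv_lhs => rw [← (EuclideanSpace.basisFun (Fin N) ℝ).sum_repr h]
  simp [partialDeriv]

theorem norm_fderiv_sq_le (f : Space N → ℝ) (x : Space N) :
    ‖fderiv ℝ f x‖ ^ 2 ≤ ∑ i, (partialDeriv i f x) ^ 2 := by
  rw [← Real.sqrt_le_sqrt_iff (by positivity), Real.sqrt_sq (norm_nonneg _)]
  refine ContinuousLinearMap.opNorm_le_bound _ (Real.sqrt_nonneg _) fun h => ?_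
  rw [fderiv_apply_eq_sum, EuclideanSpace.norm_eq, ← Real.sqrt_mul (by positivity),
    Real.norm_eq_abs]
  refine Real.abs_le_sqrt ?_
  rw [mul_comm]
  simpa using Finset.sum_mul_sq_le_sq_mul_sq Finset.univ (fun i => h i)
    (fun i => partialDeriv i f x)

end Translation

/-- An operator on a separable Hilbert space that maps weakly convergent sequences to norm
convergent ones is compact. -/
theorem isCompactOperator_of_tendsto_of_weak {H F : Type*} [NormedAddCommGroup H]
    [InnerProductSpace ℝ H] [CompleteSpace H] [TopologicalSpace.SeparableSpace H]
    [NormedAddCommGroup F] [NormedSpace ℝ F] (T : H →L[ℝ] F)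
    (hT : ∀ (u : ℕ → H) (v : H), (∀ n, ‖u n‖ ≤ 1) →
      (∀ w, Tendsto (fun n => inner ℝ (u n) w) atTop (𝓝 (inner ℝ v w))) →
      Tendsto (fun n => T (u n)) atTop (𝓝 (T v))) : IsCompactOperator T := by
  refine (isCompactOperator_iff_image_closedBall_subset_compact T.toLinearMap one_pos).2
    ⟨_, ?_, Subset.rfl⟩
  refine IsSeqCompact.isCompact fun y hy => ?_
  choose u hu huy using hy
  have hu1 : ∀ n, ‖u n‖ ≤ 1 := fun n => by simpa using hu n
  let D := InnerProductSpace.toDual ℝ H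
  obtain ⟨ℓ, hℓ, k, hk, hlim⟩ := WeakDual.isSeqCompact_closedBall ℝ H 0 1
    (x := fun n => StrongDual.toWeakDual (D (u n))) fun n => by
      have : ‖D (u n)‖ ≤ 1 := by rw [LinearIsometryEquiv.norm_map]; exact hu1 n
      simpa using this
  let v : H := D.symm (WeakDual.toStrongDual ℓ)
  have hv : ‖v‖ ≤ 1 := by
    rw [LinearIsometryEquiv.norm_map]
    simpa using hℓ
  refine ⟨T v, ⟨v, by simpa using hv, rfl⟩, k, hk, ?_⟩
  have := hT (fun n => u (k n)) v (fun n => hu1 _) fun w => by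
    have h1 := ((WeakDual.eval_continuous w).tendsto ℓ).comp hlim
    have h2 : ∀ n, inner ℝ (u (k n)) w = (StrongDual.toWeakDual (D (u (k n)))) w := fun n => rfl
    have h3 : inner ℝ v w = ℓ w := by
      have : D v = WeakDual.toStrongDual ℓ := D.apply_symm_apply _
      calc inner ℝ v w = D v w := rfl
        _ = ℓ w := by rw [this]; rfl
    simp only [h2, h3]
    exact h1
  refine this.congr fun n => ?_
  exact huy (k n)

section Average

variable {N : ℕ} {Ω : Set (Space N)}

instance fact_two_ne_top : Fact ((2 : ℝ≥0∞) ≠ ⊤) := ⟨by simp⟩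

theorem norm_sq_eq_integral {α : Type*} [MeasurableSpace α] {μ : Measure α} (u : Lp ℝ 2 μ) :
    ‖u‖ ^ 2 = ∫ x, (u x) ^ 2 ∂μ := by
  rw [← real_inner_self_eq_norm_sq, L2.inner_def]
  exact integral_congr_ae (Eventually.of_forall fun x => by simp [sq])

/-- Dominated convergence in `L²` of a finite measure, for a constant dominating function. -/
theorem tendsto_L2_of_ae_tendsto_of_bounded {α : Type*} [MeasurableSpace α] {μ : Measure α}
    [IsFiniteMeasure μ] {u : ℕ → Lp ℝ 2 μ} {v : Lp ℝ 2 μ} {g : ℕ → α → ℝ} {g' : α → ℝ}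
    (hu : ∀ n, u n =ᵐ[μ] g n) (hv : v =ᵐ[μ] g') (M : ℝ) (hM : ∀ n, ∀ᵐ x ∂μ, |g n x| ≤ M)
    (hlim : ∀ᵐ x ∂μ, Tendsto (fun n => g n x) atTop (𝓝 (g' x))) :
    Tendsto u atTop (𝓝 v) := by
  have hM' : ∀ᵐ x ∂μ, |g' x| ≤ M := by
    filter_upwards [hlim, ae_all_iff.2 hM] with x h1 h2
    exact le_of_tendsto h1.abs (Eventually.of_forall h2)
  have hsq : Tendsto (fun n => ∫ x, (u n x - v x) ^ 2 ∂μ) atTop (𝓝 (∫ _, (0 : ℝ) ∂μ)) := by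
    refine tendsto_integral_of_dominated_convergence (fun _ => (M + M) ^ 2)
      (fun n => (((Lp.stronglyMeasurable (u n)).sub
        (Lp.stronglyMeasurable v)).pow 2).aestronglyMeasurable) (integrable_const _)
      (fun n => ?_) ?_
    · filter_upwards [hu n, hv, hM n, hM'] with x h1 h2 h3 h4
      rw [h1, h2, norm_pow]
      exact pow_le_pow_left₀ (norm_nonneg _) ((norm_sub_le _ _).trans (add_le_add h3 h4)) 2
    · filter_upwards [ae_all_iff.2 hu, hv, hlim] with x h1 h2 h3
      simpa only [h1, h2, sub_self, zero_pow two_ne_zero] using (h3.sub_const (g' x)).pow 2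
  rw [integral_zero] at hsq
  rw [tendsto_iff_norm_sub_tendsto_zero]
  have h : ∀ n, √(∫ x, (u n x - v x) ^ 2 ∂μ) = ‖u n - v‖ := fun n => by
    rw [← Real.sqrt_sq (norm_nonneg (u n - v)), norm_sq_eq_integral]
    congr 1
    refine integral_congr_ae ?_
    filter_upwards [Lp.coeFn_sub (u n) v] with x h1
    rw [h1, Pi.sub_apply]
  simpa only [h, Real.sqrt_zero] using hsq.sqrt

theorem restrict_ball_ne_top (x : Space N) (R : ℝ) :
    volume.restrict Ω (Metric.ball x R) ≠ ⊤ :=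
  ((Measure.restrict_apply_le _ _).trans_lt Metric.isBounded_ball.measure_lt_top).ne

/-- The average of `u ∈ L²(Ω)`, extended by zero outside `Ω`, over the ball of radius `R` about
`x`. -/
def ballAverage (R : ℝ) (u : L2 Ω) (x : Space N) : ℝ :=
  (volume.real (Metric.ball (0 : Space N) R))⁻¹ *
    inner ℝ (indicatorConstLp 2 measurableSet_ball (restrict_ball_ne_top (Ω := Ω) x R) (1 : ℝ)) u

theorem ballAverage_eq_integral (R : ℝ) (u : L2 Ω) (x : Space N) :
    ballAverage R u x = (volume.real (Metric.ball (0 : Space N) R))⁻¹ *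
      ∫ y in Metric.ball x R, u y ∂(volume.restrict Ω) := by
  rw [ballAverage, L2.inner_indicatorConstLp_one]

theorem abs_ballAverage_le (hΩ : volume Ω ≠ ⊤) (R : ℝ) (u : L2 Ω) (x : Space N) :
    |ballAverage R u x| ≤
      (volume.real (Metric.ball (0 : Space N) R))⁻¹ * (Real.sqrt (volume.real Ω) * ‖u‖) := by
  rw [ballAverage, abs_mul, abs_of_nonneg (by positivity)]
  gcongr
  refine (abs_real_inner_le_norm _ _).trans ?_
  gcongr
  rw [norm_indicatorConstLp (by simp) (by simp)]
  simp only [norm_one, one_mul, ENNReal.toReal_ofNat, ← Real.sqrt_eq_rpow]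
  refine Real.sqrt_le_sqrt ?_
  have : IsFiniteMeasure (volume.restrict Ω) := ⟨by simpa using hΩ.lt_top⟩
  calc (volume.restrict Ω).real (Metric.ball x R) ≤ (volume.restrict Ω).real univ :=
        measureReal_mono (subset_univ _)
    _ = volume.real Ω := by simp

theorem stronglyMeasurable_ballAverage (hΩ : volume Ω ≠ ⊤) (R : ℝ) (u : L2 Ω) :
    StronglyMeasurable (ballAverage R u) := by
  have : IsFiniteMeasure (volume.restrict Ω) := ⟨by simpa using hΩ.lt_top⟩
  have h1 : ballAverage R u = fun x => (volume.real (Metric.ball (0 : Space N) R))⁻¹ *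
      ∫ y, (Metric.ball x R).indicator u y ∂(volume.restrict Ω) := by
    funext x
    rw [ballAverage_eq_integral, integral_indicator measurableSet_ball]
  rw [h1]
  refine StronglyMeasurable.const_mul (StronglyMeasurable.integral_prod_right ?_) _
  have h2 : (Function.uncurry fun x y => (Metric.ball x R).indicator u y) =
      {p : Space N × Space N | dist p.2 p.1 < R}.indicator fun p => u p.2 := by
    funext p
    simp only [Function.uncurry, indicator, Metric.mem_ball, mem_ofPred_eq]
  rw [h2]
  exact ((Lp.stronglyMeasurable u).comp_measurable measurable_snd).indicator
    (isOpen_lt (by fun_prop) continuous_const).measurableSet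

theorem memLp_ballAverage (hΩ : volume Ω ≠ ⊤) (R : ℝ) (u : L2 Ω) :
    MemLp (ballAverage R u) 2 (volume.restrict Ω) :=
  have : IsFiniteMeasure (volume.restrict Ω) := ⟨by simpa using hΩ.lt_top⟩
  MemLp.of_bound (stronglyMeasurable_ballAverage hΩ R u).aestronglyMeasurable _
    (Eventually.of_forall fun x => abs_ballAverage_le hΩ R u x)

/-- Averaging over balls of radius `R`, as an operator on `L²(Ω)`. -/
def averageOp (hΩ : volume Ω ≠ ⊤) (R : ℝ) : L2 Ω →L[ℝ] L2 Ω :=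
  LinearMap.mkContinuous
    { toFun := fun u => (memLp_ballAverage hΩ R u).toLp _
      map_add' := fun u v => by
        rw [← MemLp.toLp_add]
        congr 1
        funext x
        simp [ballAverage, inner_add_right, mul_add]
      map_smul' := fun c u => by
        rw [RingHom.id_apply, ← MemLp.toLp_const_smul]
        congr 1
        funext x
        simp only [ballAverage, real_inner_smul_right, Pi.smul_apply, smul_eq_mul]
        ring }
    ((volume.real (Metric.ball (0 : Space N) R))⁻¹ * volume.real Ω) fun u => by
      have hfin : IsFiniteMeasure (volume.restrict Ω) := ⟨by simpa using hΩ.lt_top⟩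
      have h := Lp.norm_le_of_ae_bound (f := (memLp_ballAverage hΩ R u).toLp _)
        (C := (volume.real (Metric.ball (0 : Space N) R))⁻¹ *
          (Real.sqrt (volume.real Ω) * ‖u‖)) (by positivity) (by
            filter_upwards [(memLp_ballAverage hΩ R u).coeFn_toLp] with x hx
            rw [hx]
            exact abs_ballAverage_le hΩ R u x)
      refine h.trans (le_of_eq ?_)
      have hs : Real.sqrt (volume.real Ω) * Real.sqrt (volume.real Ω) = volume.real Ω :=
        Real.mul_self_sqrt measureReal_nonneg
      have hm : (measureUnivNNReal (volume.restrict Ω) : ℝ) = volume.real Ω := by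
        change (volume.restrict Ω).real univ = volume.real Ω
        simp
      rw [hm, ENNReal.toReal_ofNat, ← one_div, ← Real.sqrt_eq_rpow]
      linear_combination (volume.real (Metric.ball (0 : Space N) R))⁻¹ * ‖u‖ * hs

theorem averageOp_coeFn (hΩ : volume Ω ≠ ⊤) (R : ℝ) (u : L2 Ω) :
    averageOp hΩ R u =ᵐ[volume.restrict Ω] ballAverage R u :=
  (memLp_ballAverage hΩ R u).coeFn_toLp

theorem norm_averageOp_le (hΩ : volume Ω ≠ ⊤) (R : ℝ) :
    ‖averageOp hΩ R‖ ≤ (volume.real (Metric.ball (0 : Space N) R))⁻¹ * volume.real Ω :=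
  LinearMap.mkContinuous_norm_le _ (by positivity) _

/-- The averages at a point are continuous for the weak convergence, and they are bounded: by
dominated convergence averaging is completely continuous. -/
theorem isCompactOperator_averageOp (hΩ : volume Ω ≠ ⊤) (R : ℝ) :
    IsCompactOperator (averageOp hΩ R) := by
  have hfin : IsFiniteMeasure (volume.restrict Ω) := ⟨by simpa using hΩ.lt_top⟩
  refine isCompactOperator_of_tendsto_of_weak _ fun u v hu hw => ?_
  refine tendsto_L2_of_ae_tendsto_of_bounded (fun n => averageOp_coeFn hΩ R (u n))
    (averageOp_coeFn hΩ R v)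
    ((volume.real (Metric.ball (0 : Space N) R))⁻¹ * (Real.sqrt (volume.real Ω) * 1))
    (fun n => Eventually.of_forall fun x => (abs_ballAverage_le hΩ R (u n) x).trans ?_)
    (Eventually.of_forall fun x => Tendsto.const_mul _ ?_)
  · gcongr
    exact hu n
  · have := hw (indicatorConstLp 2 measurableSet_ball (restrict_ball_ne_top (Ω := Ω) x R) (1 : ℝ))
    simpa only [real_inner_comm] using this

end Average

/-- An operator that is approximated in norm by its compositions with compact ones is compact. -/
theorem isCompactOperator_of_norm_sub_le {E F : Type*} [NormedAddCommGroup E] [NormedSpace ℝ E]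
    [NormedAddCommGroup F] [NormedSpace ℝ F] [CompleteSpace F] (J : E →L[ℝ] F)
    (A : ℕ → F →L[ℝ] F) (hA : ∀ n, IsCompactOperator (A n)) {ε : ℕ → ℝ}
    (hε : Tendsto ε atTop (𝓝 0)) (hε0 : ∀ n, 0 ≤ ε n) (h : ∀ n u, ‖J u - A n (J u)‖ ≤ ε n * ‖u‖) :
    IsCompactOperator J := by
  have hlim : Tendsto (fun n => A n ∘L J) atTop (𝓝 J) := by
    rw [tendsto_iff_norm_sub_tendsto_zero]
    refine squeeze_zero (fun _ => norm_nonneg _) (fun n => ?_) hε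
    refine ContinuousLinearMap.opNorm_le_bound _ (hε0 n) fun u => ?_
    rw [sub_apply, norm_sub_rev]
    exact h n u
  exact isCompactOperator_of_tendsto hlim (Eventually.of_forall fun n => (hA n).comp_clm J)

section Rellich

variable {N : ℕ} {Ω : Set (Space N)}

theorem enorm_sq_eq_lintegral {α : Type*} [MeasurableSpace α] {μ : Measure α} (u : Lp ℝ 2 μ) :
    ‖u‖ₑ ^ 2 = ∫⁻ x, ‖u x‖ₑ ^ 2 ∂μ := by
  rw [Lp.enorm_def, eLpNorm_eq_lintegral_rpow_enorm_toReal (by simp) (by simp)]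
  rw [← ENNReal.rpow_natCast, ← ENNReal.rpow_mul]
  simp

theorem IsTestFunction.eq_zero {f : Space N → ℝ} (hf : IsTestFunction Ω f) {x : Space N}
    (hx : x ∉ Ω) : f x = 0 :=
  image_eq_zero_of_notMem_tsupport fun h => hx (hf.support_subset h)

theorem IsTestFunction.partialDeriv_eq_zero {f : Space N → ℝ} (hf : IsTestFunction Ω f)
    (i : Fin N) {x : Space N} (hx : x ∉ Ω) : partialDeriv i f x = 0 := by
  have h : fderiv ℝ f x = 0 := by
    by_contra hne
    exact hx (hf.support_subset (support_fderiv_subset ℝ hne))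
  rw [partialDeriv, h]
  rfl

theorem ballAverage_eq_of_isTestFunction {f : Space N → ℝ} (hf : IsTestFunction Ω f)
    {u : L2 Ω} (hu : u =ᵐ[volume.restrict Ω] f) (R : ℝ) (x : Space N) :
    ballAverage R u x = ∫ h, f (x + h)
      ∂((volume (Metric.ball (0 : Space N) R))⁻¹ • volume.restrict (Metric.ball 0 R)) := by
  rw [ballAverage_eq_integral, integral_smul_measure, ENNReal.toReal_inv, smul_eq_mul]
  congr 1
  have h1 : ∫ y in Metric.ball x R, u y ∂(volume.restrict Ω) =
      ∫ y in Metric.ball x R, f y ∂(volume.restrict Ω) :=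
    integral_congr_ae (ae_restrict_of_ae hu)
  have h2 : ∫ y in Metric.ball x R, f y ∂(volume.restrict Ω) = ∫ y in Metric.ball x R, f y := by
    rw [Measure.restrict_restrict measurableSet_ball]
    exact (setIntegral_eq_of_subset_of_forall_sdiff_eq_zero measurableSet_ball inter_subset_left
      fun y hy => hf.eq_zero fun h => hy.2 ⟨hy.1, h⟩).symm
  rw [h1, h2, ← integral_indicator measurableSet_ball, ← integral_indicator measurableSet_ball,
    ← integral_add_left_eq_self _ x]
  congr 1
  funext h
  simp [indicator, Metric.mem_ball, dist_eq_norm]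

/-- Functions of `H¹₀(Ω)` are close in `L²(Ω)` to their averages over small balls. -/
theorem norm_sub_averageOp_sq_le (hΩo : IsOpen Ω) (hΩ : volume Ω ≠ ⊤) {R : ℝ} (hR : 0 < R)
    (u : H10 Ω) :
    ‖val u - averageOp hΩ R (val u)‖ ^ 2 ≤ R ^ 2 * ∑ i, ‖wderiv i u‖ ^ 2 := by
  refine closure_minimal (t := {p : L2Pair Ω | ‖p.1 - averageOp hΩ R p.1‖ ^ 2 ≤
    R ^ 2 * ∑ i, ‖p.2 i‖ ^ 2}) ?_ (isClosed_le (by fun_prop) (by fun_prop)) u.2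
  rintro p ⟨f, hf, hf1, hf2⟩
  let ν := (volume (Metric.ball (0 : Space N) R))⁻¹ • volume.restrict (Metric.ball (0 : Space N) R)
  have hb0 : volume (Metric.ball (0 : Space N) R) ≠ 0 := (Metric.measure_ball_pos _ _ hR).ne'
  have hb1 : volume (Metric.ball (0 : Space N) R) ≠ ⊤ := Metric.isBounded_ball.measure_lt_top.ne
  have hν : IsProbabilityMeasure ν := ⟨by simp [ν, ENNReal.inv_mul_cancel hb0 hb1]⟩
  have hνR : ∀ᵐ h ∂ν, ‖h‖ ≤ R := by
    refine Measure.ae_smul_measure ?_ _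
    filter_upwards [ae_restrict_mem measurableSet_ball] with h hh
    simpa using (mem_ball_zero_iff.1 hh).le
  have h1 : ‖p.1 - averageOp hΩ R p.1‖ₑ ^ 2 ≤
      ENNReal.ofReal R ^ 2 * ∫⁻ x, ‖fderiv ℝ f x‖ₑ ^ 2 := by
    refine le_trans ?_ (lintegral_enorm_sub_average_sq_le (hf.smooth.of_le (by simp))
      hf.compact_support ν hνR)
    rw [enorm_sq_eq_lintegral]
    refine le_trans (le_of_eq (lintegral_congr_ae ?_)) (setLIntegral_le_lintegral Ω _)
    filter_upwards [Lp.coeFn_sub p.1 (averageOp hΩ R p.1), averageOp_coeFn hΩ R p.1, hf1]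
      with x e1 e2 e3
    rw [e1, Pi.sub_apply, e2, e3, ballAverage_eq_of_isTestFunction hf hf1]
  have h2 : ∫⁻ x, ‖fderiv ℝ f x‖ₑ ^ 2 ≤ ∑ i, ‖p.2 i‖ₑ ^ 2 := by
    calc ∫⁻ x, ‖fderiv ℝ f x‖ₑ ^ 2 ≤ ∫⁻ x, ∑ i, ‖partialDeriv i f x‖ₑ ^ 2 := by
          refine lintegral_mono fun x => ?_
          have := ENNReal.ofReal_le_ofReal (norm_fderiv_sq_le f x)
          rw [ENNReal.ofReal_sum_of_nonneg (fun _ _ => sq_nonneg _),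
            ENNReal.ofReal_pow (norm_nonneg _), ofReal_norm] at this
          refine this.trans (Finset.sum_le_sum fun i _ => ?_)
          rw [← sq_abs, ENNReal.ofReal_pow (abs_nonneg _), ← Real.norm_eq_abs, ofReal_norm]
      _ = ∑ i, ∫⁻ x, ‖partialDeriv i f x‖ₑ ^ 2 :=
          lintegral_finsetSum _ fun i _ =>
            ((hf.partialDeriv_continuous i).enorm.measurable.pow_const 2)
      _ = ∑ i, ‖p.2 i‖ₑ ^ 2 := by
          refine Finset.sum_congr rfl fun i _ => ?_
          rw [enorm_sq_eq_lintegral, ← lintegral_indicator hΩo.measurableSet]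
          refine lintegral_congr_ae ?_
          filter_upwards [(ae_restrict_iff' hΩo.measurableSet).1 (hf2 i)] with x hx
          by_cases h : x ∈ Ω
          · rw [indicator_of_mem h, hx h]
          · rw [indicator_of_notMem h, hf.partialDeriv_eq_zero i h]
            simp
  have h3 := h1.trans (mul_le_mul_right h2 _)
  have e1 : ∀ v : L2 Ω, ‖v‖ₑ ^ 2 = ENNReal.ofReal (‖v‖ ^ 2) := fun v => by
    rw [ENNReal.ofReal_pow (norm_nonneg _), ofReal_norm]
  simp only [e1] at h3
  rw [← ENNReal.ofReal_sum_of_nonneg (fun _ _ => sq_nonneg _), ← ENNReal.ofReal_pow hR.le,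
    ← ENNReal.ofReal_mul (sq_nonneg R), ENNReal.ofReal_le_ofReal_iff (by positivity)] at h3
  exact h3

/-- Rellich's theorem: for a set of finite measure the embedding of `H¹₀(Ω)` in `L²(Ω)` is
compact, as a limit of the compact averaging operators. -/
theorem isCompactOperator_val (hΩo : IsOpen Ω) (hΩ : volume Ω ≠ ⊤) :
    IsCompactOperator (val : H10 Ω →ₗ[ℝ] L2 Ω) := by
  let J : H10 Ω →L[ℝ] L2 Ω :=
    ContinuousLinearMap.fst ℝ (L2 Ω) (Fin N → L2 Ω) ∘L (H10 Ω).subtypeL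
  change IsCompactOperator J
  refine isCompactOperator_of_norm_sub_le J (fun n => averageOp hΩ (1 / ((n : ℝ) + 1)))
    (fun n => isCompactOperator_averageOp hΩ _) (ε := fun n => 1 / ((n : ℝ) + 1) * Real.sqrt N)
    (by simpa using tendsto_one_div_add_atTop_nhds_zero_nat.mul_const (Real.sqrt N))
    (fun n => by positivity) fun n u => ?_
  have hpos : (0 : ℝ) < 1 / ((n : ℝ) + 1) := by positivity
  have h := norm_sub_averageOp_sq_le hΩo hΩ hpos u
  have hw : ∀ i, ‖wderiv i u‖ ≤ ‖u‖ := fun i =>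
    (norm_le_pi_norm (u : L2Pair Ω).2 i).trans (norm_snd_le (u : L2Pair Ω))
  have hs : ∑ i, ‖wderiv i u‖ ^ 2 ≤ N * ‖u‖ ^ 2 := by
    calc ∑ i, ‖wderiv i u‖ ^ 2 ≤ ∑ _i : Fin N, ‖u‖ ^ 2 :=
          Finset.sum_le_sum fun i _ => pow_le_pow_left₀ (norm_nonneg _) (hw i) 2
      _ = N * ‖u‖ ^ 2 := by simp
  refine le_of_sq_le_sq (h.trans ?_) (by positivity)
  rw [mul_pow, mul_pow, Real.sq_sqrt (by positivity), mul_assoc]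
  gcongr

/-- Poincaré's inequality: the radius need only be so large that averaging over the balls of radius
`R` at least halves the norm. -/
theorem norm_val_sq_le (hΩo : IsOpen Ω) {R : ℝ} (hR : 0 < R)
    (hΩ : 2 * volume Ω ≤ volume (Metric.ball (0 : Space N) R)) (u : H10 Ω) :
    ‖val u‖ ^ 2 ≤ 4 * R ^ 2 * ∑ i, ‖wderiv i u‖ ^ 2 := by
  have hb0 : 0 < volume (Metric.ball (0 : Space N) R) := Metric.measure_ball_pos _ _ hR
  have hb1 : volume (Metric.ball (0 : Space N) R) ≠ ⊤ := Metric.isBounded_ball.measure_lt_top.ne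
  have hfin : volume Ω ≠ ⊤ := by
    intro h
    rw [h, ENNReal.mul_top (by simp)] at hΩ
    exact hb1 (top_le_iff.1 hΩ)
  have hle : ‖averageOp hfin R‖ ≤ 1 / 2 := by
    refine (norm_averageOp_le hfin R).trans ?_
    have h1 : 0 < volume.real (Metric.ball (0 : Space N) R) := ENNReal.toReal_pos hb0.ne' hb1
    have h2 : 2 * volume.real Ω ≤ volume.real (Metric.ball (0 : Space N) R) := by
      have := ENNReal.toReal_mono hb1 hΩ
      simpa [Measure.real] using this
    rw [inv_mul_le_iff₀ h1]
    linarith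
  have h := norm_sub_averageOp_sq_le hΩo hfin hR u
  have h1 : ‖averageOp hfin R (val u)‖ ≤ 1 / 2 * ‖val u‖ :=
    (ContinuousLinearMap.le_opNorm _ _).trans (by gcongr)
  have h2 : ‖val u‖ ≤ ‖val u - averageOp hfin R (val u)‖ + ‖averageOp hfin R (val u)‖ := by
    simpa using norm_add_le (val u - averageOp hfin R (val u)) (averageOp hfin R (val u))
  have h3 : 1 / 2 * ‖val u‖ ≤ ‖val u - averageOp hfin R (val u)‖ := by linarith
  have h4 := pow_le_pow_left₀ (by positivity) h3 2
  rw [mul_pow] at h4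
  linarith

end Rellich

/-! ### Lipschitz functions with compact support belong to `H¹₀` -/

section Lipschitz

variable {N : ℕ} {Ω : Set (Space N)}

theorem norm_basisVec (i : Fin N) : ‖(basisVec i : Space N)‖ = 1 := by simp

theorem abs_partialDeriv_le {f : Space N → ℝ} {C : ℝ≥0} (hf : LipschitzWith C f) (i : Fin N)
    (x : Space N) : |partialDeriv i f x| ≤ C := by
  have h := ContinuousLinearMap.le_of_opNorm_le (fderiv ℝ f x)
    (norm_fderiv_le_of_lipschitz ℝ hf) (basisVec i)
  rwa [norm_basisVec, mul_one] at h

theorem measurable_partialDeriv (f : Space N → ℝ) (i : Fin N) : Measurable (partialDeriv i f) :=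
  measurable_fderiv_apply_const ℝ f _

theorem locallyIntegrable_partialDeriv {f : Space N → ℝ} {C : ℝ≥0} (hf : LipschitzWith C f)
    (i : Fin N) : LocallyIntegrable (partialDeriv i f) :=
  (memLp_top_of_bound (measurable_partialDeriv f i).aestronglyMeasurable C
    (Eventually.of_forall (abs_partialDeriv_le hf i))).locallyIntegrable le_top

/-- The mollification of a function by a normed bump function. -/
def mollify (ρ : ContDiffBump (0 : Space N)) (g : Space N → ℝ) : Space N → ℝ :=
  convolution (ρ.normed volume) g (ContinuousLinearMap.lsmul ℝ ℝ) volume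

theorem mollify_eq (ρ : ContDiffBump (0 : Space N)) (g : Space N → ℝ) (x : Space N) :
    mollify ρ g x = ∫ y, ρ.normed volume y * g (x - y) := by
  simp [mollify, convolution_def]

theorem abs_mollify_le (ρ : ContDiffBump (0 : Space N)) {g : Space N → ℝ} {M : ℝ}
    (hM : ∀ x, |g x| ≤ M) (x : Space N) : |mollify ρ g x| ≤ M := by
  rw [mollify_eq, ← Real.norm_eq_abs]
  calc ‖∫ y, ρ.normed volume y * g (x - y)‖ ≤ ∫ y, ρ.normed volume y * M := by
        refine norm_integral_le_of_norm_le
          ((ρ.integrable_normed (μ := (volume : Measure (Space N)))).mul_const M)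
          (Eventually.of_forall fun y => ?_)
        rw [norm_mul, Real.norm_of_nonneg (ρ.nonneg_normed y)]
        exact mul_le_mul_of_nonneg_left (hM _) (ρ.nonneg_normed y)
    _ = M := by rw [integral_mul_const, ρ.integral_normed, one_mul]

/-- Mollification commutes with the derivatives of a Lipschitz function, which exist almost
everywhere. -/
theorem partialDeriv_mollify (ρ : ContDiffBump (0 : Space N)) {f : Space N → ℝ} {C : ℝ≥0}
    (hf : LipschitzWith C f) (i : Fin N) (x : Space N) :
    partialDeriv i (mollify ρ f) x = mollify ρ (partialDeriv i f) x := by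
  have hρ : Continuous (ρ.normed (volume : Measure (Space N))) := ρ.continuous_normed
  have hmeas : Measurable (fderiv ℝ f) := measurable_fderiv ℝ f
  have hcont : ∀ z, Continuous fun y => ρ.normed volume y * f (z - y) := fun z =>
    hρ.mul (hf.continuous.comp (by fun_prop))
  have hF' : AEStronglyMeasurable (fun y => ρ.normed volume y • fderiv ℝ f (x - y)) volume :=
    (hρ.measurable.smul (hmeas.comp (by fun_prop))).aestronglyMeasurable
  have key := hasFDerivAt_integral_of_dominated_loc_of_lip (μ := (volume : Measure (Space N)))
    (F := fun z y => ρ.normed volume y * f (z - y))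
    (F' := fun y => ρ.normed volume y • fderiv ℝ f (x - y)) (x₀ := x) (s := univ)
    (bound := fun y => ρ.normed volume y * C) univ_mem
    (Eventually.of_forall fun z => (hcont z).aestronglyMeasurable)
    ((hcont x).integrable_of_hasCompactSupport ρ.hasCompactSupport_normed.mul_right)
    hF'
    (Eventually.of_forall fun y => by
      refine LipschitzOnWith.of_dist_le_mul fun z _ z' _ => ?_
      have h1 := hf.dist_le_mul (z - y) (z' - y)
      rw [dist_sub_right] at h1
      rw [Real.dist_eq, ← mul_sub, abs_mul, abs_of_nonneg (ρ.nonneg_normed y),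
        Real.coe_nnabs, abs_mul, abs_of_nonneg (ρ.nonneg_normed y), NNReal.abs_eq, mul_assoc]
      exact mul_le_mul_of_nonneg_left h1 (ρ.nonneg_normed y))
    (ρ.integrable_normed.mul_const _)
    (by
      filter_upwards [(quasiMeasurePreserving_sub_left volume x).ae hf.ae_differentiableAt]
        with y hy
      have h1 : HasFDerivAt (fun z => f (z - y)) (fderiv ℝ f (x - y)) x := by
        exact hy.hasFDerivAt.comp x ((hasFDerivAt_id x).sub_const y)
      exact h1.const_mul _)
  have he : (mollify ρ f) = fun z => ∫ y, ρ.normed volume y * f (z - y) :=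
    funext fun z => mollify_eq ρ f z
  rw [partialDeriv, he, key.2.fderiv, ContinuousLinearMap.integral_apply key.1, mollify_eq]
  rfl

theorem isTestFunction_mollify (ρ : ContDiffBump (0 : Space N)) {f : Space N → ℝ}
    (hf : Continuous f) (hc : HasCompactSupport f)
    (hsub : Metric.cthickening ρ.rOut (tsupport f) ⊆ Ω) : IsTestFunction Ω (mollify ρ f) where
  smooth := ρ.hasCompactSupport_normed.contDiff_convolution_left _ ρ.contDiff_normed
    hf.locallyIntegrable
  compact_support := ρ.hasCompactSupport_normed.convolution _ hc
  support_subset := by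
    refine (closure_minimal ?_ Metric.isClosed_cthickening).trans hsub
    refine (support_convolution_subset _).trans ?_
    rintro _ ⟨y, hy, z, hz, rfl⟩
    rw [ρ.support_normed_eq, mem_ball_zero_iff] at hy
    refine Metric.mem_cthickening_of_dist_le _ z _ _ (subset_tsupport f hz) ?_
    simpa using hy.le

/-- A Lipschitz function with compact support in `Ω` belongs to `H¹₀(Ω)`, with its almost
everywhere derivatives as weak ones: its mollifications are test functions that converge to it. -/
theorem mem_H10_of_lipschitzWith (hΩo : IsOpen Ω) (hΩ : volume Ω ≠ ⊤) {f : Space N → ℝ} {C : ℝ≥0}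
    (hf : LipschitzWith C f) (hc : HasCompactSupport f) (hsub : tsupport f ⊆ Ω) {p : L2Pair Ω}
    (hp1 : p.1 =ᵐ[volume.restrict Ω] f)
    (hp2 : ∀ i, p.2 i =ᵐ[volume.restrict Ω] partialDeriv i f) : p ∈ H10 Ω := by
  have hfin : IsFiniteMeasure (volume.restrict Ω) := ⟨by simpa using hΩ.lt_top⟩
  obtain ⟨δ, hδ, hδΩ⟩ := hc.isCompact.exists_cthickening_subset_open hΩo hsub
  obtain ⟨M, hM⟩ := hf.continuous.bounded_above_of_compact_support hc
  -- Radii tending to zero, with a bounded ratio `rOut / rIn` as the convergence at almost every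
  -- point requires.
  let ρ : ℕ → ContDiffBump (0 : Space N) := fun n =>
    { rIn := δ / 2 * (1 / ((n : ℝ) + 1))
      rOut := δ * (1 / ((n : ℝ) + 1))
      rIn_pos := by positivity
      rIn_lt_rOut := mul_lt_mul_of_pos_right (half_lt_self hδ) (by positivity) }
  have hρ : Tendsto (fun n => (ρ n).rOut) atTop (𝓝 0) := by
    have h := (tendsto_one_div_add_atTop_nhds_zero_nat (𝕜 := ℝ)).const_mul δ
    rwa [mul_zero] at h
  have hρ2 : ∀ n, (ρ n).rOut ≤ 2 * (ρ n).rIn := fun n => le_of_eq (by simp only [ρ]; ring)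
  have htest : ∀ n, IsTestFunction Ω (mollify (ρ n) f) := fun n => by
    refine isTestFunction_mollify (ρ n) hf.continuous hc
      ((Metric.cthickening_mono ?_ _).trans hδΩ)
    refine mul_le_of_le_one_right hδ.le ?_
    rw [div_le_one (by positivity)]
    linarith [(Nat.cast_nonneg n : (0 : ℝ) ≤ n)]
  have hm : ∀ n, MemLp (mollify (ρ n) f) 2 (volume.restrict Ω) := fun n =>
    ((htest n).smooth.continuous.memLp_of_hasCompactSupport (htest n).compact_support).restrict Ω
  have hd : ∀ n i, MemLp (partialDeriv i (mollify (ρ n) f)) 2 (volume.restrict Ω) := fun n i =>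
    (((htest n).partialDeriv_continuous i).memLp_of_hasCompactSupport
      ((htest n).partialDeriv_compact i)).restrict Ω
  let q : ℕ → L2Pair Ω := fun n => ((hm n).toLp _, fun i => (hd n i).toLp _)
  have hlim : Tendsto q atTop (𝓝 p) := by
    refine Prod.tendsto_iff _ _ |>.2 ⟨?_, tendsto_pi_nhds.2 fun i => ?_⟩
    · refine tendsto_L2_of_ae_tendsto_of_bounded (fun n => (hm n).coeFn_toLp) hp1 M
        (fun n => Eventually.of_forall (abs_mollify_le _ hM)) (Eventually.of_forall fun x => ?_)
      exact ContDiffBump.convolution_tendsto_right_of_continuous hρ hf.continuous x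
    · refine tendsto_L2_of_ae_tendsto_of_bounded (fun n => (hd n i).coeFn_toLp) (hp2 i) C
        (fun n => Eventually.of_forall fun x => ?_) (ae_restrict_of_ae ?_)
      · rw [partialDeriv_mollify _ hf]
        exact abs_mollify_le _ (abs_partialDeriv_le hf i) x
      · simp only [partialDeriv_mollify _ hf]
        exact ContDiffBump.ae_convolution_tendsto_right_of_locallyIntegrable hρ
          (Eventually.of_forall hρ2) (locallyIntegrable_partialDeriv hf i)
  refine mem_closure_of_tendsto hlim (Eventually.of_forall fun n => ?_)
  exact ⟨_, htest n, (hm n).coeFn_toLp, fun i => (hd n i).coeFn_toLp⟩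

end Lipschitz

/-! ### Multiplication and composition operators on `L²` -/

section Operators

theorem norm_le_mul_norm_of_enorm_sq_le {α β : Type*} [MeasurableSpace α] [MeasurableSpace β] {μ : Measure α}
    {ν : Measure β} {u : Lp ℝ 2 μ} {v : Lp ℝ 2 ν} {c : ℝ} (hc : 0 ≤ c)
    (h : ‖u‖ₑ ^ 2 ≤ ENNReal.ofReal c ^ 2 * ‖v‖ₑ ^ 2) : ‖u‖ ≤ c * ‖v‖ := by
  rw [← ofReal_norm, ← ofReal_norm, ← ENNReal.ofReal_pow (norm_nonneg _),
    ← ENNReal.ofReal_pow (norm_nonneg _), ← ENNReal.ofReal_pow hc,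
    ← ENNReal.ofReal_mul (sq_nonneg c), ENNReal.ofReal_le_ofReal_iff (by positivity),
    ← mul_pow] at h
  exact le_of_sq_le_sq h (by positivity)

variable {α : Type*} [MeasurableSpace α] {μ : Measure α}

theorem memLp_two_mul {g : α → ℝ} (hg : MemLp g ∞ μ) (u : Lp ℝ 2 μ) :
    MemLp (fun x => g x * u x) 2 μ :=
  (Lp.memLp u).mul hg

/-- Multiplication by a bounded measurable function, as an operator on `L²`. -/
def mulOp {g : α → ℝ} (hg : MemLp g ∞ μ) : Lp ℝ 2 μ →L[ℝ] Lp ℝ 2 μ :=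
  LinearMap.mkContinuous
    { toFun := fun u => (memLp_two_mul hg u).toLp _
      map_add' := fun u v => by
        rw [← MemLp.toLp_add]
        refine MemLp.toLp_congr _ _ ?_
        filter_upwards [Lp.coeFn_add u v] with x hx
        change g x * (u + v : Lp ℝ 2 μ) x = g x * u x + g x * v x
        rw [hx, Pi.add_apply, mul_add]
      map_smul' := fun c u => by
        rw [RingHom.id_apply, ← MemLp.toLp_const_smul]
        refine MemLp.toLp_congr _ _ ?_
        filter_upwards [Lp.coeFn_smul c u] with x hx
        change g x * (c • u : Lp ℝ 2 μ) x = c * (g x * u x)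
        rw [hx, Pi.smul_apply, smul_eq_mul]
        ring }
    (eLpNorm g ∞ μ).toReal fun u => by
      simp only [LinearMap.coe_mk, AddHom.coe_mk]
      refine Lp.norm_le_mul_norm_of_ae_le_mul ?_
      filter_upwards [(memLp_two_mul hg u).coeFn_toLp,
        ae_le_eLpNormEssSup (f := g) (μ := μ)] with x hx hx'
      rw [hx, norm_mul]
      refine mul_le_mul_of_nonneg_right ?_ (norm_nonneg _)
      rw [← eLpNorm_exponent_top] at hx'
      rw [← toReal_enorm]
      exact ENNReal.toReal_mono hg.eLpNorm_ne_top hx'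

theorem mulOp_coeFn {g : α → ℝ} (hg : MemLp g ∞ μ) (u : Lp ℝ 2 μ) :
    mulOp hg u =ᵐ[μ] fun x => g x * u x :=
  (memLp_two_mul hg u).coeFn_toLp

variable {β : Type*} [MeasurableSpace β] {ν : Measure β}

/-- Composition with `φ` is bounded from `L²(ν)` to `L²(μ)`, with square norm at most `c`. -/
structure IsCompositionBound (φ : α → β) (μ : Measure α) (ν : Measure β) (c : ℝ≥0) : Prop where
  aemeasurable : AEMeasurable φ μ
  map_le : μ.map φ ≤ c • ν

namespace IsCompositionBound

variable {φ : α → β} {c : ℝ≥0}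

theorem quasiMeasurePreserving_ae (h : IsCompositionBound φ μ ν c) {p : β → Prop}
    (hp : ∀ᵐ y ∂ν, p y) : ∀ᵐ x ∂μ, p (φ x) := by
  refine ae_of_ae_map h.aemeasurable ?_
  refine (Measure.absolutelyContinuous_of_le h.map_le).ae_le ?_
  exact Measure.ae_smul_measure hp c

theorem memLp (h : IsCompositionBound φ μ ν c) (u : Lp ℝ 2 ν) :
    MemLp (fun x => u (φ x)) 2 μ :=
  MemLp.comp_of_map
    (((Lp.memLp u).smul_measure (c := (c : ℝ≥0∞)) (by simp)).mono_measure h.map_le) h.aemeasurable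

theorem norm_toLp_le (h : IsCompositionBound φ μ ν c) (u : Lp ℝ 2 ν) :
    ‖(h.memLp u).toLp _‖ ≤ Real.sqrt c * ‖u‖ := by
  refine norm_le_mul_norm_of_enorm_sq_le (Real.sqrt_nonneg _) ?_
  rw [enorm_sq_eq_lintegral, enorm_sq_eq_lintegral, ← ENNReal.ofReal_pow (Real.sqrt_nonneg _),
    Real.sq_sqrt c.coe_nonneg]
  have hmeas : Measurable fun y => ‖u y‖ₑ ^ 2 :=
    (Lp.stronglyMeasurable u).measurable.enorm.pow_const 2
  calc ∫⁻ x, ‖(h.memLp u).toLp _ x‖ₑ ^ 2 ∂μ = ∫⁻ x, ‖u (φ x)‖ₑ ^ 2 ∂μ := by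
        refine lintegral_congr_ae ?_
        filter_upwards [(h.memLp u).coeFn_toLp] with x hx
        rw [hx]
    _ = ∫⁻ y, ‖u y‖ₑ ^ 2 ∂(μ.map φ) := (lintegral_map' hmeas.aemeasurable h.aemeasurable).symm
    _ ≤ ∫⁻ y, ‖u y‖ₑ ^ 2 ∂(c • ν) := lintegral_mono' h.map_le le_rfl
    _ = ENNReal.ofReal c * ∫⁻ y, ‖u y‖ₑ ^ 2 ∂ν := by
      rw [lintegral_smul_measure, ENNReal.ofReal_coe_nnreal]
      rfl

/-- Composition with `φ`, as an operator from `L²(ν)` to `L²(μ)`. -/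
def compOp (h : IsCompositionBound φ μ ν c) : Lp ℝ 2 ν →L[ℝ] Lp ℝ 2 μ :=
  LinearMap.mkContinuous
    { toFun := fun u => (h.memLp u).toLp _
      map_add' := fun u v => by
        rw [← MemLp.toLp_add]
        refine MemLp.toLp_congr _ _ ?_
        filter_upwards [h.quasiMeasurePreserving_ae (Lp.coeFn_add u v)] with x hx
        change (u + v : Lp ℝ 2 ν) (φ x) = u (φ x) + v (φ x)
        rw [hx, Pi.add_apply]
      map_smul' := fun c u => by
        rw [RingHom.id_apply, ← MemLp.toLp_const_smul]
        refine MemLp.toLp_congr _ _ ?_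
        filter_upwards [h.quasiMeasurePreserving_ae (Lp.coeFn_smul c u)] with x hx
        change (c • u : Lp ℝ 2 ν) (φ x) = c * u (φ x)
        rw [hx, Pi.smul_apply, smul_eq_mul] }
    (Real.sqrt c) h.norm_toLp_le

theorem compOp_coeFn (h : IsCompositionBound φ μ ν c) (u : Lp ℝ 2 ν) :
    h.compOp u =ᵐ[μ] fun x => u (φ x) :=
  (h.memLp u).coeFn_toLp

theorem norm_compOp_le (h : IsCompositionBound φ μ ν c) (u : Lp ℝ 2 ν) :
    ‖h.compOp u‖ ≤ Real.sqrt c * ‖u‖ :=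
  h.norm_toLp_le u

theorem compOp_coeFn_of_ae_eq (h : IsCompositionBound φ μ ν c) {u : Lp ℝ 2 ν} {f : β → ℝ}
    (hu : u =ᵐ[ν] f) : h.compOp u =ᵐ[μ] fun x => f (φ x) :=
  (h.compOp_coeFn u).trans (h.quasiMeasurePreserving_ae hu)

theorem compOp_compOp (h : IsCompositionBound φ μ ν c) {ψ : β → α}
    (h' : IsCompositionBound ψ ν μ c) (hinv : ∀ᵐ x ∂μ, ψ (φ x) = x) (u : Lp ℝ 2 μ) :
    h.compOp (h'.compOp u) = u := by
  refine Lp.ext ?_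
  filter_upwards [h.compOp_coeFn_of_ae_eq (h'.compOp_coeFn u), hinv] with x h1 h2
  rw [h1, h2]

end IsCompositionBound

end Operators

/-! ### Change of variables in `H¹₀` -/

theorem map_mem_topologicalClosure {E F : Type*} [NormedAddCommGroup E] [NormedSpace ℝ E]
    [NormedAddCommGroup F] [NormedSpace ℝ F] (T : E →L[ℝ] F) {A : Submodule ℝ E}
    {B : Submodule ℝ F} (h : ∀ p ∈ A, T p ∈ B.topologicalClosure) {p : E}
    (hp : p ∈ A.topologicalClosure) : T p ∈ B.topologicalClosure :=
  closure_minimal (t := T ⁻¹' B.topologicalClosure) h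
    (B.isClosed_topologicalClosure.preimage T.continuous) hp

/-- The determinant of an endomorphism of `ℝ^N` is at most the `N`-th power of its norm: compare
the volume of the image of the unit ball with that of a ball containing it. -/
theorem abs_det_le_norm_pow {N : ℕ} (L : Space N →L[ℝ] Space N) : |L.det| ≤ ‖L‖ ^ N := by
  have h1 := Measure.addHaar_image_continuousLinearMap (volume : Measure (Space N)) L
    (Metric.ball 0 1)
  have h2 : L '' Metric.ball 0 1 ⊆ Metric.closedBall 0 ‖L‖ := by
    rintro _ ⟨x, hx, rfl⟩
    rw [mem_closedBall_zero_iff]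
    exact (L.le_opNorm x).trans
      (mul_le_of_le_one_right (norm_nonneg L) (mem_ball_zero_iff.1 hx).le)
  have h3 := measure_mono (μ := (volume : Measure (Space N))) h2
  rw [h1, Measure.addHaar_closedBall _ _ (norm_nonneg L), finrank_euclideanSpace_fin,
    ENNReal.mul_le_mul_iff_left (Metric.measure_ball_pos _ _ one_pos).ne'
      Metric.isBounded_ball.measure_lt_top.ne, ENNReal.ofReal_le_ofReal_iff (by positivity)] at h3
  exact h3

section Transport

variable {N : ℕ}

/-- Mutually inverse maps `φ : Ω → Ω'` and `ψ : Ω' → Ω` of class `C^{1,1}` between open sets of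
finite measure, with gradients of norm at most `M`. -/
structure IsTransport (φ ψ : Space N → Space N) (Ω Ω' : Set (Space N)) (M : ℝ≥0) : Prop where
  isOpen : IsOpen Ω
  isOpen' : IsOpen Ω'
  finite : volume Ω ≠ ⊤
  finite' : volume Ω' ≠ ⊤
  mapsTo : MapsTo φ Ω Ω'
  mapsTo' : MapsTo ψ Ω' Ω
  leftInv : LeftInvOn ψ φ Ω
  leftInv' : LeftInvOn φ ψ Ω'
  isC11On : IsC11On φ Ω
  isC11On' : IsC11On ψ Ω'
  norm_le : ∀ x ∈ Ω, ‖fderiv ℝ φ x‖ ≤ M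
  norm_le' : ∀ x ∈ Ω', ‖fderiv ℝ ψ x‖ ≤ M

/-- The entry `∂_j φ_m` of the Jacobian matrix. -/
def jac (φ : Space N → Space N) (j m : Fin N) (x : Space N) : ℝ := partialDeriv j φ x m

theorem measurable_jac (φ : Space N → Space N) (j m : Fin N) : Measurable (jac φ j m) := by
  have h : Measurable fun x => fderiv ℝ φ x (basisVec j) := measurable_fderiv_apply_const ℝ φ _
  exact (EuclideanSpace.proj m : Space N →L[ℝ] ℝ).continuous.measurable.comp h

theorem abs_apply_basisVec_le (L : Space N →L[ℝ] Space N) (j m : Fin N) :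
    |L (basisVec j) m| ≤ ‖L‖ := by
  have h := (PiLp.norm_apply_le (L (basisVec j)) m).trans (L.le_opNorm _)
  rwa [norm_basisVec, mul_one] at h

namespace IsTransport

variable {φ ψ : Space N → Space N} {Ω Ω' : Set (Space N)} {M : ℝ≥0}

theorem symm (h : IsTransport φ ψ Ω Ω' M) : IsTransport ψ φ Ω' Ω M :=
  ⟨h.isOpen', h.isOpen, h.finite', h.finite, h.mapsTo', h.mapsTo, h.leftInv', h.leftInv,
    h.isC11On', h.isC11On, h.norm_le', h.norm_le⟩

theorem contDiffAt (h : IsTransport φ ψ Ω Ω' M) {x : Space N} (hx : x ∈ Ω) :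
    ContDiffAt ℝ 1 φ x :=
  h.isC11On.1.contDiffAt (h.isOpen.mem_nhds hx)

theorem hasFDerivAt (h : IsTransport φ ψ Ω Ω' M) {x : Space N} (hx : x ∈ Ω) :
    HasFDerivAt φ (fderiv ℝ φ x) x :=
  ((h.contDiffAt hx).differentiableAt (by simp)).hasFDerivAt

theorem isCompositionBound (h : IsTransport φ ψ Ω Ω' M) :
    IsCompositionBound φ (volume.restrict Ω) (volume.restrict Ω') (M ^ N) where
  aemeasurable := h.isC11On.1.continuousOn.aemeasurable h.isOpen.measurableSet
  map_le := by
    have haem : AEMeasurable φ (volume.restrict Ω) :=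
      h.isC11On.1.continuousOn.aemeasurable h.isOpen.measurableSet
    refine Measure.le_iff.2 fun A hA => ?_
    rw [Measure.map_apply_of_aemeasurable haem hA, Measure.restrict_apply' h.isOpen.measurableSet,
      Measure.smul_apply, Measure.restrict_apply hA]
    have hsub : φ ⁻¹' A ∩ Ω ⊆ ψ '' (A ∩ Ω') := fun x hx =>
      ⟨φ x, ⟨hx.1, h.mapsTo hx.2⟩, h.leftInv hx.2⟩
    refine (measure_mono hsub).trans ?_
    refine (addHaar_image_le_lintegral_abs_det_fderiv volume
      (hA.inter h.isOpen'.measurableSet)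
      (fun y hy => (h.symm.hasFDerivAt hy.2).hasFDerivWithinAt)).trans ?_
    calc ∫⁻ y in A ∩ Ω', ENNReal.ofReal |(fderiv ℝ ψ y).det|
        ≤ ∫⁻ _ in A ∩ Ω', ((M ^ N : ℝ≥0) : ℝ≥0∞) := by
          refine setLIntegral_mono' (hA.inter h.isOpen'.measurableSet) fun y hy => ?_
          rw [← ENNReal.ofReal_coe_nnreal]
          refine ENNReal.ofReal_le_ofReal ((abs_det_le_norm_pow _).trans ?_)
          rw [NNReal.coe_pow]
          exact pow_le_pow_left₀ (norm_nonneg _) (h.norm_le' y hy.2) N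
      _ = (M ^ N : ℝ≥0) • volume (A ∩ Ω') := by
          rw [setLIntegral_const]
          rfl

theorem memLp_jac (h : IsTransport φ ψ Ω Ω' M) (j m : Fin N) :
    MemLp (jac φ j m) ∞ (volume.restrict Ω) := by
  refine memLp_top_of_bound (measurable_jac φ j m).aestronglyMeasurable M ?_
  filter_upwards [ae_restrict_mem h.isOpen.measurableSet] with x hx
  exact (abs_apply_basisVec_le _ j m).trans (h.norm_le x hx)

/-- Composition with `φ` on `L²(Ω')`. -/
def comp (h : IsTransport φ ψ Ω Ω' M) : L2 Ω' →L[ℝ] L2 Ω := h.isCompositionBound.compOp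

/-- Composition of a function and of its gradient with `φ`, according to the chain rule. -/
def pullbackPair (h : IsTransport φ ψ Ω Ω' M) : L2Pair Ω' →L[ℝ] L2Pair Ω :=
  (h.comp ∘L ContinuousLinearMap.fst ℝ (L2 Ω') (Fin N → L2 Ω')).prod
    (ContinuousLinearMap.pi fun j => ∑ m, mulOp (h.memLp_jac j m) ∘L h.comp ∘L
      ContinuousLinearMap.proj m ∘L ContinuousLinearMap.snd ℝ (L2 Ω') (Fin N → L2 Ω'))

theorem pullbackPair_fst (h : IsTransport φ ψ Ω Ω' M) (p : L2Pair Ω') :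
    (h.pullbackPair p).1 = h.comp p.1 := rfl

theorem pullbackPair_snd (h : IsTransport φ ψ Ω Ω' M) (p : L2Pair Ω') (j : Fin N) :
    (h.pullbackPair p).2 j = ∑ m, mulOp (h.memLp_jac j m) (h.comp (p.2 m)) := by
  simp [pullbackPair]

theorem ae_comp (h : IsTransport φ ψ Ω Ω' M) {u : L2 Ω'} {f : Space N → ℝ}
    (hu : u =ᵐ[volume.restrict Ω'] f) : h.comp u =ᵐ[volume.restrict Ω] fun x => f (φ x) :=
  h.isCompositionBound.compOp_coeFn_of_ae_eq hu

/-- The composition of a test function with `φ` is not smooth, but it is Lipschitz with compact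
support in `Ω`. -/
theorem pullbackPair_mem_H10_of_testPair (h : IsTransport φ ψ Ω Ω' M) {p : L2Pair Ω'}
    (hp : p ∈ testPairs Ω') : h.pullbackPair p ∈ H10 Ω := by
  obtain ⟨f, hf, hf1, hf2⟩ := hp
  set g : Space N → ℝ := Ω.indicator (fun x => f (φ x)) with hg
  set K : Set (Space N) := ψ '' tsupport f with hK
  have hKc : IsCompact K := hf.compact_support.isCompact.image_of_continuousOn
    (h.isC11On'.1.continuousOn.mono hf.support_subset)
  have hKΩ : K ⊆ Ω := by
    rintro _ ⟨y, hy, rfl⟩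
    exact h.mapsTo' (hf.support_subset hy)
  have hsupp : Function.support g ⊆ K := by
    intro x hx
    have hxΩ : x ∈ Ω := by
      by_contra hn
      exact hx (indicator_of_notMem hn _)
    rw [Function.mem_support, hg, indicator_of_mem hxΩ] at hx
    exact ⟨φ x, subset_tsupport f hx, h.leftInv hxΩ⟩
  have htsupp : tsupport g ⊆ K := closure_minimal hsupp hKc.isClosed
  have hgc : HasCompactSupport g := HasCompactSupport.of_support_subset_isCompact hKc hsupp
  have heq : ∀ x ∈ Ω, g =ᶠ[𝓝 x] fun x => f (φ x) := fun x hx => by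
    filter_upwards [h.isOpen.mem_nhds hx] with y hy
    exact indicator_of_mem hy _
  have hsm : ContDiff ℝ 1 g := by
    refine contDiff_iff_contDiffAt.2 fun x => ?_
    by_cases hx : x ∈ K
    · exact ((hf.smooth.of_le (by simp)).contDiffAt.comp x
        (h.contDiffAt (hKΩ hx))).congr_of_eventuallyEq (heq x (hKΩ hx))
    · refine (contDiffAt_const (c := (0 : ℝ))).congr_of_eventuallyEq ?_
      filter_upwards [hKc.isClosed.isOpen_compl.mem_nhds hx] with y hy
      exact Function.notMem_support.1 fun hy' => hy (hsupp hy')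
  obtain ⟨C, hC⟩ := hsm.lipschitzWith_of_hasCompactSupport hgc (by simp)
  refine mem_H10_of_lipschitzWith h.isOpen h.finite hC hgc (htsupp.trans hKΩ) ?_ fun j => ?_
  · filter_upwards [h.ae_comp hf1, ae_restrict_mem h.isOpen.measurableSet] with x h1 h2
    rw [pullbackPair_fst, h1, hg, indicator_of_mem h2]
  · rw [pullbackPair_snd]
    filter_upwards [Lp.coeFn_fun_finsetSum Finset.univ fun m => mulOp (h.memLp_jac j m) (h.comp (p.2 m)),
      ae_all_iff.2 fun m => mulOp_coeFn (h.memLp_jac j m) (h.comp (p.2 m)),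
      ae_all_iff.2 fun m => h.ae_comp (hf2 m),
      ae_restrict_mem h.isOpen.measurableSet] with x h1 h2 h3 h4
    rw [h1]
    have hchain : HasFDerivAt (fun x => f (φ x)) (fderiv ℝ f (φ x) ∘L fderiv ℝ φ x) x :=
      (hf.smooth.differentiable (by simp) (φ x)).hasFDerivAt.comp x (h.hasFDerivAt h4)
    rw [partialDeriv, (heq x h4).fderiv_eq, hchain.fderiv, ContinuousLinearMap.comp_apply,
      fderiv_apply_eq_sum]
    refine Finset.sum_congr rfl fun m _ => ?_
    rw [h2, h3]
    rfl

theorem pullbackPair_mem_H10 (h : IsTransport φ ψ Ω Ω' M) {p : L2Pair Ω'} (hp : p ∈ H10 Ω') :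
    h.pullbackPair p ∈ H10 Ω :=
  map_mem_topologicalClosure h.pullbackPair
    (fun _ hq => h.pullbackPair_mem_H10_of_testPair hq) hp

/-- Composition with `φ`, as a map from `H¹₀(Ω')` to `H¹₀(Ω)`. -/
def pullback (h : IsTransport φ ψ Ω Ω' M) : H10 Ω' →ₗ[ℝ] H10 Ω :=
  h.pullbackPair.toLinearMap.restrict fun _ hp => h.pullbackPair_mem_H10 hp

theorem val_pullback (h : IsTransport φ ψ Ω Ω' M) (u : H10 Ω') :
    val (h.pullback u) = h.comp (val u) := rfl

theorem wderiv_pullback (h : IsTransport φ ψ Ω Ω' M) (u : H10 Ω') (j : Fin N) :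
    wderiv j (h.pullback u) = ∑ m, mulOp (h.memLp_jac j m) (h.comp (wderiv m u)) :=
  h.pullbackPair_snd u j

end IsTransport
end Transport

/-! ### Multiplication by Lipschitz functions in `H¹₀` -/

section Multiplier

variable {N : ℕ} {Ω : Set (Space N)}

/-- `g` is bounded and Lipschitz continuous on the open set `Ω` of finite measure. -/
structure IsMultiplier (g : Space N → ℝ) (Ω : Set (Space N)) : Prop where
  isOpen : IsOpen Ω
  finite : volume Ω ≠ ⊤
  lipschitz : ∃ K : ℝ≥0, LipschitzOnWith K g Ω
  bounded : ∃ M : ℝ, ∀ x ∈ Ω, |g x| ≤ M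

theorem lipschitzWith_mul_of_bounded {α : Type*} [PseudoMetricSpace α] {f g : α → ℝ} {Kf Kg : ℝ≥0}
    {Mf Mg : ℝ≥0} (hf : LipschitzWith Kf f) (hg : LipschitzWith Kg g) (hMf : ∀ x, |f x| ≤ Mf)
    (hMg : ∀ x, |g x| ≤ Mg) : LipschitzWith (Mf * Kg + Mg * Kf) fun x => f x * g x := by
  refine LipschitzWith.of_dist_le_mul fun x y => ?_
  have h1 := hf.dist_le_mul x y
  have h2 := hg.dist_le_mul x y
  rw [Real.dist_eq] at h1 h2 ⊢
  have e : f x * g x - f y * g y = f x * (g x - g y) + g y * (f x - f y) := by ring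
  rw [e]
  refine (abs_add_le _ _).trans ?_
  rw [abs_mul, abs_mul]
  push_cast
  rw [add_mul, mul_assoc, mul_assoc]
  exact add_le_add (mul_le_mul (hMf x) h2 (abs_nonneg _) Mf.2)
    (mul_le_mul (hMg y) h1 (abs_nonneg _) Mg.2)

namespace IsMultiplier

variable {g : Space N → ℝ}

/-- A multiplier extends to a bounded Lipschitz function on the whole space. -/
theorem exists_extension (h : IsMultiplier g Ω) :
    ∃ (G : Space N → ℝ) (K M : ℝ≥0), LipschitzWith K G ∧ (∀ x, |G x| ≤ M) ∧ EqOn g G Ω := by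
  obtain ⟨K, hK⟩ := h.lipschitz
  obtain ⟨M, hM⟩ := h.bounded
  obtain ⟨G, hG, he⟩ := hK.extend_real
  refine ⟨fun x => max (-|M|) (min |M| (G x)), K, ⟨|M|, abs_nonneg M⟩,
    (hG.const_min |M|).const_max (-|M|), fun x => ?_, fun x hx => ?_⟩
  · exact abs_le.2 ⟨le_max_left _ _,
      max_le (neg_le_self (abs_nonneg M)) (min_le_left _ _)⟩
  · have h1 := abs_le.1 ((hM x hx).trans (le_abs_self M))
    rw [he hx] at h1
    dsimp only
    rw [he hx, min_eq_right h1.2, max_eq_right h1.1]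

theorem memLp (h : IsMultiplier g Ω) : MemLp g ∞ (volume.restrict Ω) := by
  obtain ⟨K, hK⟩ := h.lipschitz
  obtain ⟨M, hM⟩ := h.bounded
  refine memLp_top_of_bound (hK.continuousOn.aestronglyMeasurable h.isOpen.measurableSet) M ?_
  filter_upwards [ae_restrict_mem h.isOpen.measurableSet] with x hx
  exact hM x hx

theorem memLp_partialDeriv (h : IsMultiplier g Ω) (i : Fin N) :
    MemLp (partialDeriv i g) ∞ (volume.restrict Ω) := by
  obtain ⟨K, hK⟩ := h.lipschitz
  refine memLp_top_of_bound (measurable_partialDeriv g i).aestronglyMeasurable K ?_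
  filter_upwards [ae_restrict_mem h.isOpen.measurableSet] with x hx
  have h1 := ContinuousLinearMap.le_of_opNorm_le (fderiv ℝ g x)
    (norm_fderiv_le_of_lipschitzOn ℝ (h.isOpen.mem_nhds hx) hK) (basisVec i)
  rwa [norm_basisVec, mul_one] at h1

/-- Multiplication of a function and of its gradient by `g`, according to the product rule. -/
def mulPair (h : IsMultiplier g Ω) : L2Pair Ω →L[ℝ] L2Pair Ω :=
  (mulOp h.memLp ∘L ContinuousLinearMap.fst ℝ (L2 Ω) (Fin N → L2 Ω)).prod
    (ContinuousLinearMap.pi fun j =>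
      mulOp h.memLp ∘L ContinuousLinearMap.proj j ∘L
        ContinuousLinearMap.snd ℝ (L2 Ω) (Fin N → L2 Ω) +
      mulOp (h.memLp_partialDeriv j) ∘L ContinuousLinearMap.fst ℝ (L2 Ω) (Fin N → L2 Ω))

theorem mulPair_fst (h : IsMultiplier g Ω) (p : L2Pair Ω) :
    (h.mulPair p).1 = mulOp h.memLp p.1 := rfl

theorem mulPair_snd (h : IsMultiplier g Ω) (p : L2Pair Ω) (j : Fin N) :
    (h.mulPair p).2 j = mulOp h.memLp (p.2 j) + mulOp (h.memLp_partialDeriv j) p.1 := rfl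

theorem mulPair_mem_H10_of_testPair (h : IsMultiplier g Ω) {p : L2Pair Ω}
    (hp : p ∈ testPairs Ω) : h.mulPair p ∈ H10 Ω := by
  obtain ⟨f, hf, hf1, hf2⟩ := hp
  obtain ⟨G, K, M, hG, hM, he⟩ := h.exists_extension
  obtain ⟨K', hK'⟩ := hf.smooth.lipschitzWith_of_hasCompactSupport hf.compact_support (by simp)
  obtain ⟨M', hM'⟩ := hf.smooth.continuous.bounded_above_of_compact_support hf.compact_support
  have hM'0 : 0 ≤ M' := (norm_nonneg _).trans (hM' 0)
  have hlip := lipschitzWith_mul_of_bounded hG hK' hM (Mg := ⟨M', hM'0⟩) hM'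
  have hsupp : tsupport (fun x => G x * f x) ⊆ tsupport f :=
    closure_mono (Function.support_mul_subset_right G f)
  refine mem_H10_of_lipschitzWith h.isOpen h.finite hlip hf.compact_support.mul_left
    (hsupp.trans hf.support_subset) ?_ fun j => ?_
  · rw [mulPair_fst]
    filter_upwards [mulOp_coeFn h.memLp p.1, hf1, ae_restrict_mem h.isOpen.measurableSet]
      with x h1 h2 h3
    rw [h1, h2, he h3]
  · rw [mulPair_snd]
    filter_upwards [Lp.coeFn_add (mulOp h.memLp (p.2 j)) (mulOp (h.memLp_partialDeriv j) p.1),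
      mulOp_coeFn h.memLp (p.2 j), mulOp_coeFn (h.memLp_partialDeriv j) p.1, hf1, hf2 j,
      ae_restrict_mem h.isOpen.measurableSet, ae_restrict_of_ae hG.ae_differentiableAt]
      with x h1 h2 h3 h4 h5 h6 h7
    have hev : g =ᶠ[𝓝 x] G := by
      filter_upwards [h.isOpen.mem_nhds h6] with y hy
      exact he hy
    have hd := (h7.hasFDerivAt.mul (hf.smooth.differentiable (by simp) x).hasFDerivAt).fderiv
    have hd' : fderiv ℝ (fun x => G x * f x) x = G x • fderiv ℝ f x + f x • fderiv ℝ G x := hd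
    rw [h1, Pi.add_apply, h2, h3, h4, h5, he h6]
    simp only [partialDeriv]
    rw [hev.fderiv_eq, hd']
    simp only [add_apply, smul_apply, smul_eq_mul]
    ring

theorem mulPair_mem_H10 (h : IsMultiplier g Ω) {p : L2Pair Ω} (hp : p ∈ H10 Ω) :
    h.mulPair p ∈ H10 Ω :=
  map_mem_topologicalClosure h.mulPair (fun _ hq => h.mulPair_mem_H10_of_testPair hq) hp

/-- Multiplication by `g`, as a map from `H¹₀(Ω)` to itself. -/
def mulH10 (h : IsMultiplier g Ω) : H10 Ω →ₗ[ℝ] H10 Ω :=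
  h.mulPair.toLinearMap.restrict fun _ hp => h.mulPair_mem_H10 hp

theorem wderiv_mulH10 (h : IsMultiplier g Ω) (u : H10 Ω) (j : Fin N) :
    wderiv j (h.mulH10 u) =
      mulOp h.memLp (wderiv j u) + mulOp (h.memLp_partialDeriv j) (val u) := rfl

end IsMultiplier

/-- An element of `H¹₀(Ω)` is determined by its underlying function, since weak gradients are
unique. -/
theorem val_injective (hΩ : IsOpen Ω) : Function.Injective (val : H10 Ω →ₗ[ℝ] L2 Ω) := by
  rw [injective_iff_map_eq_zero]
  intro u hu
  have hw : ∀ i, wderiv i u = 0 := by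
    intro i
    have hloc : LocallyIntegrableOn (wderiv i u) Ω :=
      locallyIntegrableOn_of_locallyIntegrable_restrict
        ((Lp.memLp (wderiv i u)).locallyIntegrable (by simp))
    have h0 := hΩ.ae_eq_zero_of_integral_contDiff_smul_eq_zero hloc fun f h1 h2 h3 => by
      have hf : IsTestFunction Ω f := ⟨h1, h2, h3⟩
      have hg := isWeakGradient_of_H10 u f hf i
      have hz : ∫ x in Ω, val u x * partialDeriv i f x = 0 := by
        rw [hu]
        refine integral_eq_zero_of_ae ?_
        filter_upwards [Lp.coeFn_zero ℝ 2 (volume.restrict Ω)] with x hx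
        rw [hx, Pi.zero_apply, zero_mul]
      rw [hz, eq_comm, neg_eq_zero] at hg
      rw [← hg, ← setIntegral_eq_integral_of_forall_compl_eq_zero (s := Ω)]
      · simp only [smul_eq_mul, mul_comm]
      · intro x hx
        rw [hf.eq_zero hx, zero_smul]
    refine Lp.ext ?_
    filter_upwards [(ae_restrict_iff' hΩ.measurableSet).2 h0,
      Lp.coeFn_zero ℝ 2 (volume.restrict Ω)] with x h1 h2
    rw [h1, h2]
    rfl
  refine Subtype.ext (Prod.ext hu (funext hw))

end Multiplier

/-! ### Change of variables in the energy space -/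

namespace IsTransport

variable {N : ℕ} {φ ψ : Space N → Space N} {Ω Ω' : Set (Space N)} {M : ℝ≥0}

theorem isMultiplier_jac (h : IsTransport φ ψ Ω Ω' M) (i l : Fin N) :
    IsMultiplier (jac φ i l) Ω where
  isOpen := h.isOpen
  finite := h.finite
  lipschitz := by
    obtain ⟨K, hK⟩ := h.isC11On.2
    refine ⟨K, LipschitzOnWith.of_dist_le_mul fun x hx y hy => ?_⟩
    have h1 := abs_apply_basisVec_le (fderiv ℝ φ x - fderiv ℝ φ y) i l
    have h2 := hK.dist_le_mul x hx y hy
    rw [dist_eq_norm] at h2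
    exact (le_of_eq rfl).trans (h1.trans h2)
  bounded := ⟨M, fun x hx => (abs_apply_basisVec_le _ i l).trans (h.norm_le x hx)⟩

/-- The map `(β, w) ↦ (∇φᵀ (β ∘ φ), w ∘ φ)`. The field `β` is transformed in the same way as
gradients are, so that `∇w - β` is transformed in this way as well. -/
def energyMap (h : IsTransport φ ψ Ω Ω' M) : EnergySpace Ω' →ₗ[ℝ] EnergySpace Ω :=
  LinearMap.prod
    (LinearMap.pi fun i => ∑ l, (h.isMultiplier_jac i l).mulH10 ∘ₗ h.pullback ∘ₗ
      LinearMap.proj l ∘ₗ LinearMap.fst ℝ (Fin N → H10 Ω') (H10 Ω'))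
    (h.pullback ∘ₗ LinearMap.snd ℝ (Fin N → H10 Ω') (H10 Ω'))

theorem energyMap_snd (h : IsTransport φ ψ Ω Ω' M) (U : EnergySpace Ω') :
    (h.energyMap U).2 = h.pullback U.2 := rfl

theorem energyMap_fst (h : IsTransport φ ψ Ω Ω' M) (U : EnergySpace Ω') (i : Fin N) :
    (h.energyMap U).1 i = ∑ l, (h.isMultiplier_jac i l).mulH10 (h.pullback (U.1 l)) := by
  simp [energyMap]

theorem val_energyMap_snd (h : IsTransport φ ψ Ω Ω' M) (U : EnergySpace Ω') :
    val (h.energyMap U).2 = h.comp (val U.2) := rfl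

theorem ae_val_energyMap_fst (h : IsTransport φ ψ Ω Ω' M) (U : EnergySpace Ω') (i : Fin N) :
    val ((h.energyMap U).1 i) =ᵐ[volume.restrict Ω]
      fun x => ∑ l, jac φ i l x * h.comp (val (U.1 l)) x := by
  rw [energyMap_fst, map_sum]
  filter_upwards [Lp.coeFn_fun_finsetSum Finset.univ fun l =>
      val ((h.isMultiplier_jac i l).mulH10 (h.pullback (U.1 l))),
    ae_all_iff.2 fun l => mulOp_coeFn (h.isMultiplier_jac i l).memLp (h.comp (val (U.1 l)))]
    with x h1 h2
  rw [h1]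
  exact Finset.sum_congr rfl fun l _ => h2 l

theorem ae_wderiv_pullback (h : IsTransport φ ψ Ω Ω' M) (u : H10 Ω') (j : Fin N) :
    wderiv j (h.pullback u) =ᵐ[volume.restrict Ω]
      fun x => ∑ m, jac φ j m x * h.comp (wderiv m u) x := by
  rw [wderiv_pullback]
  filter_upwards [Lp.coeFn_fun_finsetSum Finset.univ fun m =>
      mulOp (h.memLp_jac j m) (h.comp (wderiv m u)),
    ae_all_iff.2 fun m => mulOp_coeFn (h.memLp_jac j m) (h.comp (wderiv m u))] with x h1 h2
  rw [h1]
  exact Finset.sum_congr rfl fun l _ => h2 l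

theorem ae_wderiv_energyMap_fst (h : IsTransport φ ψ Ω Ω' M) (U : EnergySpace Ω')
    (i j : Fin N) :
    wderiv j ((h.energyMap U).1 i) =ᵐ[volume.restrict Ω] fun x =>
      ∑ l, (jac φ i l x * ∑ m, jac φ j m x * h.comp (wderiv m (U.1 l)) x +
        partialDeriv j (jac φ i l) x * h.comp (val (U.1 l)) x) := by
  rw [energyMap_fst, map_sum]
  filter_upwards [Lp.coeFn_fun_finsetSum Finset.univ fun l =>
      wderiv j ((h.isMultiplier_jac i l).mulH10 (h.pullback (U.1 l))),
    ae_all_iff.2 fun l => mulOp_coeFn (h.isMultiplier_jac i l).memLp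
      (wderiv j (h.pullback (U.1 l))),
    ae_all_iff.2 fun l => mulOp_coeFn ((h.isMultiplier_jac i l).memLp_partialDeriv j)
      (h.comp (val (U.1 l))),
    ae_all_iff.2 fun l => h.ae_wderiv_pullback (U.1 l) j,
    ae_all_iff.2 fun l => Lp.coeFn_add
      (mulOp (h.isMultiplier_jac i l).memLp (wderiv j (h.pullback (U.1 l))))
      (mulOp ((h.isMultiplier_jac i l).memLp_partialDeriv j) (h.comp (val (U.1 l))))]
    with x h1 h2 h3 h4 h5
  rw [h1]
  refine Finset.sum_congr rfl fun l _ => ?_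
  rw [IsMultiplier.wderiv_mulH10, val_pullback, h5, Pi.add_apply, h2, h3, h4]

/-- The chain rule for `ψ ∘ φ = id`. -/
theorem sum_jac_mul_jac (h : IsTransport φ ψ Ω Ω' M) {x : Space N} (hx : x ∈ Ω) (i m : Fin N) :
    ∑ l, jac φ i l x * jac ψ l m (φ x) = if i = m then 1 else 0 := by
  have h1 : HasFDerivAt (fun x => ψ (φ x)) (fderiv ℝ ψ (φ x) ∘L fderiv ℝ φ x) x :=
    (h.symm.hasFDerivAt (h.mapsTo hx)).comp x (h.hasFDerivAt hx)
  have h2 : HasFDerivAt (fun x => ψ (φ x)) (ContinuousLinearMap.id ℝ (Space N)) x := by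
    refine (hasFDerivAt_id x).congr_of_eventuallyEq ?_
    filter_upwards [h.isOpen.mem_nhds hx] with y hy
    exact h.leftInv hy
  have h3 := congrArg (fun L : Space N →L[ℝ] Space N => L (basisVec i) m) (h1.unique h2)
  have h4 : fderiv ℝ φ x (basisVec i) = ∑ l, jac φ i l x • basisVec l := by
    conv_lhs => rw [← (EuclideanSpace.basisFun (Fin N) ℝ).sum_repr (fderiv ℝ φ x (basisVec i))]
    simp [jac, partialDeriv]
  simp only [ContinuousLinearMap.comp_apply, h4, map_sum, map_smul, ContinuousLinearMap.id_apply]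
    at h3
  calc ∑ l, jac φ i l x * jac ψ l m (φ x)
      = (∑ l, jac φ i l x • fderiv ℝ ψ (φ x) (basisVec l)) m := by
        simp [jac, partialDeriv]
    _ = if i = m then 1 else 0 := by
        rw [h3]
        simp [eq_comm]

theorem comp_comp_symm (h : IsTransport φ ψ Ω Ω' M) (u : L2 Ω) : h.comp (h.symm.comp u) = u := by
  refine h.isCompositionBound.compOp_compOp h.symm.isCompositionBound ?_ u
  filter_upwards [ae_restrict_mem h.isOpen.measurableSet] with x hx
  exact h.leftInv hx

theorem energyMap_energyMap_symm (h : IsTransport φ ψ Ω Ω' M) (U : EnergySpace Ω) :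
    h.energyMap (h.symm.energyMap U) = U := by
  refine Prod.ext (funext fun i => val_injective h.isOpen ?_) (val_injective h.isOpen ?_)
  · refine Lp.ext ?_
    filter_upwards [h.ae_val_energyMap_fst (h.symm.energyMap U) i,
      ae_all_iff.2 fun l => h.ae_comp (h.symm.ae_val_energyMap_fst U l),
      ae_all_iff.2 fun m => h.isCompositionBound.compOp_coeFn (h.symm.comp (val (U.1 m))),
      ae_restrict_mem h.isOpen.measurableSet] with x h1 h2 h3 hx
    rw [h1]
    have h4 : ∀ m, h.symm.comp (val (U.1 m)) (φ x) = val (U.1 m) x := fun m => by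
      rw [← h3 m]
      exact congrArg (fun v : L2 Ω => v x) (h.comp_comp_symm (val (U.1 m)))
    simp only [h2, h4, Finset.mul_sum]
    rw [Finset.sum_comm]
    simp only [← mul_assoc, ← Finset.sum_mul, h.sum_jac_mul_jac hx]
    simp
  · rw [val_energyMap_snd, val_energyMap_snd, comp_comp_symm]

/-- The change of variables in the energy space, with inverse that of the inverse map. -/
def energyEquiv (h : IsTransport φ ψ Ω Ω' M) : EnergySpace Ω' ≃ₗ[ℝ] EnergySpace Ω :=
  LinearEquiv.ofLinearMap h.energyMap h.symm.energyMap
    (LinearMap.ext h.energyMap_energyMap_symm) (LinearMap.ext h.symm.energyMap_energyMap_symm)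

end IsTransport

/-! ### Dependence of the forms on the domain -/

theorem norm_le_of_ae_abs_le_sum {α ι : Type*} [MeasurableSpace α] {μ : Measure α} [Fintype ι]
    {v : Lp ℝ 2 μ} {u : ι → Lp ℝ 2 μ} {c : ℝ} (hc : 0 ≤ c)
    (h : ∀ᵐ x ∂μ, |v x| ≤ c * ∑ k, |u k x|) : ‖v‖ ≤ c * ∑ k, ‖u k‖ := by
  have h1 : ‖v‖ ≤ ‖c • ∑ k, |u k|‖ := by
    refine Lp.norm_le_norm_of_ae_le ?_
    filter_upwards [h, Lp.coeFn_smul c (∑ k, |u k|),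
      Lp.coeFn_fun_finsetSum Finset.univ fun k => |u k|,
      ae_all_iff.2 fun k => Lp.coeFn_abs (u k)] with x h1 h2 h3 h4
    rw [h2, Pi.smul_apply, h3]
    simp only [h4, smul_eq_mul]
    rw [Real.norm_eq_abs]
    exact h1.trans (le_abs_self _)
  refine h1.trans ?_
  rw [norm_smul, Real.norm_of_nonneg hc]
  refine mul_le_mul_of_nonneg_left ((norm_sum_le _ _).trans (le_of_eq ?_)) hc
  simp only [norm_abs_eq_norm]

/-- The entries of the first and second derivatives of `φ - id` in `Ω` are at most `ε ≤ 1`; the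
second derivatives need exist almost everywhere only. -/
structure IsNearIdentity {N : ℕ} (φ : Space N → Space N) (Ω : Set (Space N)) (ε : ℝ) : Prop where
  nonneg : 0 ≤ ε
  le_one : ε ≤ 1
  jac_sub_le : ∀ x ∈ Ω, ∀ i l, |jac φ i l x - if i = l then 1 else 0| ≤ ε
  partialDeriv_jac_le : ∀ᵐ x ∂(volume.restrict Ω), ∀ i j l, |partialDeriv j (jac φ i l) x| ≤ ε

theorem abs_sum_mul_sub_le {ι : Type*} [Fintype ι] [DecidableEq ι] {ε : ℝ} {A : ι → ℝ}
    {a : ι} (hA : ∀ l, |A l - if a = l then 1 else 0| ≤ ε) (b : ι → ℝ) :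
    |∑ l, A l * b l - b a| ≤ ε * ∑ l, |b l| := by
  have e : ∑ l, A l * b l - b a = ∑ l, (A l - if a = l then 1 else 0) * b l := by
    simp [sub_mul, Finset.sum_sub_distrib]
  rw [e, Finset.mul_sum]
  refine (Finset.abs_sum_le_sum_abs _ _).trans (Finset.sum_le_sum fun l _ => ?_)
  rw [abs_mul]
  exact mul_le_mul_of_nonneg_right (hA l) (abs_nonneg _)

theorem abs_mul_sub_mul_le {ε a b r s : ℝ} (h0 : 0 ≤ ε) (h1 : ε ≤ 1) (ha : |a - r| ≤ ε)
    (hb : |b - s| ≤ ε) (hr : |r| ≤ 1) (hs : |s| ≤ 1) : |a * b - r * s| ≤ 3 * ε := by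
  have e : a * b - r * s = (a - r) * (b - s) + (a - r) * s + r * (b - s) := by ring
  rw [e]
  refine (abs_add_three _ _ _).trans ?_
  simp only [abs_mul]
  have k1 := mul_le_mul ha hb (abs_nonneg _) h0
  have k2 := mul_le_mul ha hs (abs_nonneg _) h0
  have k3 := mul_le_mul hr hb (abs_nonneg _) zero_le_one
  nlinarith

namespace IsTransport

variable {N : ℕ} {φ ψ : Space N → Space N} {Ω Ω' : Set (Space N)} {M : ℝ≥0} {ε κ : ℝ}

theorem norm_comp_sq_le (h : IsTransport φ ψ Ω Ω' M) (hκ : (M : ℝ) ^ N ≤ 1 + κ) (u : L2 Ω') :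
    ‖h.comp u‖ ^ 2 ≤ (1 + κ) * ‖u‖ ^ 2 := by
  have h1 := pow_le_pow_left₀ (norm_nonneg _) (h.isCompositionBound.norm_compOp_le u) 2
  rw [mul_pow, Real.sq_sqrt (NNReal.coe_nonneg _), NNReal.coe_pow] at h1
  exact h1.trans (mul_le_mul_of_nonneg_right hκ (sq_nonneg _))

theorem norm_comp_le (h : IsTransport φ ψ Ω Ω' M) (hκ : (M : ℝ) ^ N ≤ 1 + κ) (hκ1 : κ ≤ 1)
    (u : L2 Ω') : ‖h.comp u‖ ≤ 2 * ‖u‖ := by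
  refine le_of_sq_le_sq ((h.norm_comp_sq_le hκ u).trans ?_) (by positivity)
  rw [mul_pow]
  exact mul_le_mul_of_nonneg_right (by linarith) (sq_nonneg _)

theorem abs_norm_comp_sq_sub_le (h : IsTransport φ ψ Ω Ω' M) (hκ0 : 0 ≤ κ)
    (hκ : (M : ℝ) ^ N ≤ 1 + κ) (u : L2 Ω') : |‖h.comp u‖ ^ 2 - ‖u‖ ^ 2| ≤ κ * ‖u‖ ^ 2 := by
  have h1 := h.norm_comp_sq_le hκ u
  have h2 := h.symm.norm_comp_sq_le hκ (h.comp u)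
  rw [h.symm.comp_comp_symm] at h2
  refine abs_le.2 ⟨?_, by linarith⟩
  have h3 : 0 ≤ ‖u‖ ^ 2 := sq_nonneg _
  nlinarith [mul_nonneg hκ0 h3, mul_nonneg hκ0 (mul_nonneg hκ0 h3), sq_nonneg ‖h.comp u‖]

/-- If `v` differs little from the transported function `u ∘ φ`, then the norms of `v` and `u`
differ little. -/
theorem abs_norm_sq_sub_norm_sq_le (h : IsTransport φ ψ Ω Ω' M) (hε1 : ε ≤ 1)
    (hκ0 : 0 ≤ κ) (hκ1 : κ ≤ 1) (hκ : (M : ℝ) ^ N ≤ 1 + κ) {u : L2 Ω'} {v : L2 Ω} {D Z : ℝ}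
    (hD : 0 ≤ D) (hu : ‖u‖ ≤ Z) (hv : ‖v - h.comp u‖ ≤ D * ε * Z) :
    |‖v‖ ^ 2 - ‖u‖ ^ 2| ≤ (D * (4 + D) * ε + κ) * Z ^ 2 := by
  have hZ : 0 ≤ Z := (norm_nonneg u).trans hu
  have hDε : D * ε ≤ D := mul_le_of_le_one_right hD hε1
  have h1 := h.norm_comp_le hκ hκ1 u
  have h2 : |‖v‖ - ‖h.comp u‖| ≤ D * ε * Z := (abs_norm_sub_norm_le _ _).trans hv
  have h3 : ‖v‖ ≤ ‖h.comp u‖ + D * ε * Z := by linarith [(abs_le.1 h2).2]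
  have h4 : ‖v‖ + ‖h.comp u‖ ≤ (4 + D) * Z := by nlinarith
  have h5 : |‖v‖ ^ 2 - ‖h.comp u‖ ^ 2| ≤ D * (4 + D) * ε * Z ^ 2 := by
    rw [sq_sub_sq, abs_mul, abs_of_nonneg (by positivity : 0 ≤ ‖v‖ + ‖h.comp u‖)]
    calc (‖v‖ + ‖h.comp u‖) * |‖v‖ - ‖h.comp u‖| ≤ ((4 + D) * Z) * (D * ε * Z) :=
          mul_le_mul h4 h2 (abs_nonneg _) (by positivity)
      _ = D * (4 + D) * ε * Z ^ 2 := by ring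
  have h6 := h.abs_norm_comp_sq_sub_le hκ0 hκ u
  have h7 : κ * ‖u‖ ^ 2 ≤ κ * Z ^ 2 :=
    mul_le_mul_of_nonneg_left (pow_le_pow_left₀ (norm_nonneg _) hu 2) hκ0
  calc |‖v‖ ^ 2 - ‖u‖ ^ 2| ≤ |‖v‖ ^ 2 - ‖h.comp u‖ ^ 2| + |‖h.comp u‖ ^ 2 - ‖u‖ ^ 2| :=
        abs_sub_le _ _ _
    _ ≤ (D * (4 + D) * ε + κ) * Z ^ 2 := by linarith

/-- A component of a field that is transformed like a gradient is close to the transported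
component. -/
theorem norm_sum_jac_sub_le (h : IsTransport φ ψ Ω Ω' M) (hφ : IsNearIdentity φ Ω ε)
    (hκ : (M : ℝ) ^ N ≤ 1 + κ) (hκ1 : κ ≤ 1) {v : L2 Ω} {u : Fin N → L2 Ω'} {i : Fin N}
    (hv : v =ᵐ[volume.restrict Ω] fun x => ∑ l, jac φ i l x * h.comp (u l) x) {Z : ℝ}
    (hZ : ∀ l, ‖u l‖ ≤ Z) : ‖v - h.comp (u i)‖ ≤ 2 * N * ε * Z := by
  have h1 : ‖v - h.comp (u i)‖ ≤ ε * ∑ l, ‖h.comp (u l)‖ := by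
    refine norm_le_of_ae_abs_le_sum hφ.nonneg ?_
    filter_upwards [Lp.coeFn_sub v (h.comp (u i)), hv,
      ae_restrict_mem h.isOpen.measurableSet] with x e1 e2 hx
    rw [e1, Pi.sub_apply, e2]
    exact abs_sum_mul_sub_le (hφ.jac_sub_le x hx i) fun l => h.comp (u l) x
  refine h1.trans ?_
  have h2 : ∑ l, ‖h.comp (u l)‖ ≤ ∑ _l : Fin N, 2 * Z := Finset.sum_le_sum fun l _ =>
    (h.norm_comp_le hκ hκ1 (u l)).trans (by linarith [hZ l])
  simp only [Finset.sum_const, Finset.card_univ, Fintype.card_fin, nsmul_eq_mul] at h2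
  calc ε * ∑ l, ‖h.comp (u l)‖ ≤ ε * (N * (2 * Z)) := mul_le_mul_of_nonneg_left h2 hφ.nonneg
    _ = 2 * N * ε * Z := by ring

theorem ae_shear_energyMap (h : IsTransport φ ψ Ω Ω' M) (U : EnergySpace Ω') (i : Fin N) :
    shear (h.energyMap U) i =ᵐ[volume.restrict Ω]
      fun x => ∑ l, jac φ i l x * h.comp (shear U l) x := by
  filter_upwards [Lp.coeFn_sub (wderiv i (h.energyMap U).2) (val ((h.energyMap U).1 i)),
    h.ae_wderiv_pullback U.2 i, h.ae_val_energyMap_fst U i,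
    ae_all_iff.2 fun l => Lp.coeFn_sub (h.comp (wderiv l U.2)) (h.comp (val (U.1 l)))]
    with x h1 h2 h3 h4
  have h5 : ∀ l, h.comp (shear U l) x = h.comp (wderiv l U.2) x - h.comp (val (U.1 l)) x := by
    intro l
    rw [shear, map_sub, h4, Pi.sub_apply]
  simp only [h5, mul_sub, Finset.sum_sub_distrib]
  rw [shear, h1, Pi.sub_apply, h3, energyMap_snd, h2]

/-- The `L²` norm of the gradient of `β`. -/
def gradNorm (β : Fin N → H10 Ω) : ℝ :=
  Real.sqrt (∑ i, ∑ j, ‖wderiv j (β i)‖ ^ 2)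

theorem norm_wderiv_le_gradNorm (β : Fin N → H10 Ω) (i j : Fin N) :
    ‖wderiv j (β i)‖ ≤ gradNorm β := by
  refine Real.le_sqrt_of_sq_le ?_
  refine le_trans ?_ (Finset.single_le_sum (f := fun i => ∑ j, ‖wderiv j (β i)‖ ^ 2)
    (fun i _ => Finset.sum_nonneg fun j _ => sq_nonneg _) (Finset.mem_univ i))
  exact Finset.single_le_sum (f := fun j => ‖wderiv j (β i)‖ ^ 2)
    (fun j _ => sq_nonneg _) (Finset.mem_univ j)

theorem norm_val_le_gradNorm {C : ℝ} (hC : 0 ≤ C)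
    (hP : ∀ u : H10 Ω, ‖val u‖ ^ 2 ≤ C ^ 2 * ∑ i, ‖wderiv i u‖ ^ 2) (β : Fin N → H10 Ω)
    (i : Fin N) : ‖val (β i)‖ ≤ C * gradNorm β := by
  refine le_of_sq_le_sq ((hP (β i)).trans ?_) (mul_nonneg hC (Real.sqrt_nonneg _))
  rw [mul_pow, gradNorm, Real.sq_sqrt (by positivity)]
  refine mul_le_mul_of_nonneg_left ?_ (sq_nonneg C)
  exact Finset.single_le_sum (f := fun i => ∑ j, ‖wderiv j (β i)‖ ^ 2)
    (fun i _ => Finset.sum_nonneg fun j _ => sq_nonneg _) (Finset.mem_univ i)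

/-- The derivatives of the transformed field `β` are close to the transported ones. The second
derivatives of `φ` come with `β` itself, which Poincaré's inequality bounds by its gradient. -/
theorem norm_wderiv_energyMap_sub_le (h : IsTransport φ ψ Ω Ω' M) (hφ : IsNearIdentity φ Ω ε)
    (hκ : (M : ℝ) ^ N ≤ 1 + κ) (hκ1 : κ ≤ 1) {C : ℝ} (hC : 0 ≤ C)
    (hP : ∀ u : H10 Ω', ‖val u‖ ^ 2 ≤ C ^ 2 * ∑ i, ‖wderiv i u‖ ^ 2) (U : EnergySpace Ω')
    (i j : Fin N) :
    ‖wderiv j ((h.energyMap U).1 i) - h.comp (wderiv j (U.1 i))‖ ≤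
      6 * (N ^ 2 + N * C) * ε * gradNorm U.1 := by
  set G := gradNorm U.1 with hG
  let u : (Fin N × Fin N) ⊕ Fin N → L2 Ω := Sum.elim
    (fun q => h.comp (wderiv q.2 (U.1 q.1))) (fun l => h.comp (val (U.1 l)))
  have h1 : ‖wderiv j ((h.energyMap U).1 i) - h.comp (wderiv j (U.1 i))‖ ≤
      3 * ε * ∑ k, ‖u k‖ := by
    refine norm_le_of_ae_abs_le_sum (mul_nonneg (by norm_num) hφ.nonneg) ?_
    filter_upwards [Lp.coeFn_sub (wderiv j ((h.energyMap U).1 i)) (h.comp (wderiv j (U.1 i))),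
      h.ae_wderiv_energyMap_fst U i j, hφ.partialDeriv_jac_le,
      ae_restrict_mem h.isOpen.measurableSet] with x e1 e2 e3 hx
    rw [e1, Pi.sub_apply, e2, Finset.sum_add_distrib, add_sub_right_comm]
    refine (abs_add_le _ _).trans ?_
    simp only [u, Fintype.sum_sum_type, Sum.elim_inl, Sum.elim_inr, mul_add]
    refine add_le_add ?_ ?_
    · have hA : ∀ q : Fin N × Fin N, |jac φ i q.1 x * jac φ j q.2 x -
          if (i, j) = q then 1 else 0| ≤ 3 * ε := by
        rintro ⟨l, m⟩
        have a1 := hφ.jac_sub_le x hx i l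
        have a2 := hφ.jac_sub_le x hx j m
        have e : (if (i, j) = (l, m) then (1 : ℝ) else 0) =
            (if i = l then 1 else 0) * (if j = m then 1 else 0) := by
          simp only [Prod.mk.injEq, ite_and, ite_mul, one_mul, zero_mul]
        rw [e]
        have s1 : |if i = l then (1 : ℝ) else 0| ≤ 1 := by split_ifs <;> simp
        have s2 : |if j = m then (1 : ℝ) else 0| ≤ 1 := by split_ifs <;> simp
        exact abs_mul_sub_mul_le hφ.nonneg hφ.le_one a1 a2 s1 s2
      have := abs_sum_mul_sub_le hA fun q => h.comp (wderiv q.2 (U.1 q.1)) x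
      refine le_trans (le_of_eq ?_) this
      rw [Fintype.sum_prod_type]
      simp only [Finset.mul_sum, mul_assoc]
    · rw [Finset.mul_sum]
      refine (Finset.abs_sum_le_sum_abs _ _).trans (Finset.sum_le_sum fun l _ => ?_)
      rw [abs_mul]
      exact mul_le_mul_of_nonneg_right ((e3 i j l).trans (by linarith [hφ.nonneg])) (abs_nonneg _)
  have h2 : ∑ k, ‖u k‖ ≤ (N ^ 2 + N * C) * (2 * G) := by
    have b1 : ∀ q : Fin N × Fin N, ‖h.comp (wderiv q.2 (U.1 q.1))‖ ≤ 2 * G := fun q =>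
      (h.norm_comp_le hκ hκ1 _).trans (by linarith [norm_wderiv_le_gradNorm U.1 q.1 q.2])
    have b2 : ∀ l, ‖h.comp (val (U.1 l))‖ ≤ C * (2 * G) := fun l =>
      (h.norm_comp_le hκ hκ1 _).trans (by linarith [norm_val_le_gradNorm hC hP U.1 l])
    simp only [u, Fintype.sum_sum_type, Sum.elim_inl, Sum.elim_inr]
    refine (add_le_add (Finset.sum_le_sum fun q _ => b1 q)
      (Finset.sum_le_sum fun l _ => b2 l)).trans (le_of_eq ?_)
    simp only [Finset.sum_const, Finset.card_univ, Fintype.card_prod, Fintype.card_fin,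
      nsmul_eq_mul]
    push_cast
    ring
  calc _ ≤ 3 * ε * ∑ k, ‖u k‖ := h1
    _ ≤ 3 * ε * ((N ^ 2 + N * C) * (2 * G)) :=
      mul_le_mul_of_nonneg_left h2 (mul_nonneg (by norm_num) hφ.nonneg)
    _ = 6 * (N ^ 2 + N * C) * ε * G := by ring

end IsTransport

section Forms

variable {N : ℕ} (P : Params) {Ω : Set (Space N)}

theorem energyForm_self (U : EnergySpace Ω) :
    energyForm P U U = P.mu / 12 * ∑ i, ∑ j, ‖wderiv j (U.1 i)‖ ^ 2
      + (P.mu + P.lam) / 12 * ‖divergence U.1‖ ^ 2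
      + P.mu * P.k / P.t ^ 2 * ∑ i, ‖shear U i‖ ^ 2 := by
  simp only [energyForm, real_inner_self_eq_norm_sq]

theorem massForm_self (U : EnergySpace Ω) :
    massForm P U U = ‖val U.2‖ ^ 2 + P.t ^ 2 / 12 * ∑ i, ‖val (U.1 i)‖ ^ 2 := by
  simp only [massForm, real_inner_self_eq_norm_sq]

end Forms

theorem abs_sum_sub_sum_le {ι : Type*} [Fintype ι] {a b : ι → ℝ} {c : ℝ}
    (h : ∀ i, |a i - b i| ≤ c) : |∑ i, a i - ∑ i, b i| ≤ Fintype.card ι * c := by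
  rw [← Finset.sum_sub_distrib]
  refine (Finset.abs_sum_le_sum_abs _ _).trans ((Finset.sum_le_sum fun i _ => h i).trans ?_)
  simp

theorem norm_le_sqrt_sum_sq {E ι : Type*} [NormedAddCommGroup E] [Fintype ι] (v : ι → E) (i : ι) :
    ‖v i‖ ≤ Real.sqrt (∑ j, ‖v j‖ ^ 2) :=
  Real.le_sqrt_of_sq_le
    (Finset.single_le_sum (f := fun j => ‖v j‖ ^ 2) (fun _ _ => sq_nonneg _) (Finset.mem_univ i))

/-- The constant in the bound of the relative change of the single terms of the forms, when `C` is
the Poincaré constant, the derivatives of `φ - id` are at most `ε`, and `φ` changes volumes at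
most by the factor `1 + κ`. -/
def termDefect (N : ℕ) (C ε κ : ℝ) : ℝ :=
  6 * (N ^ 2 + N * C) * (4 + 6 * (N ^ 2 + N * C)) * ε + κ

/-- The constant in the bound of the relative change of the forms. -/
def formDefect (N : ℕ) (lam mu C ε κ : ℝ) : ℝ :=
  (N ^ 2 + (mu + lam) / mu * (N + 1) ^ 2 + N + 1) * termDefect N C ε κ

theorem le_termDefect {N : ℕ} {C ε κ : ℝ} (hC : 0 ≤ C) (hε : 0 ≤ ε) : κ ≤ termDefect N C ε κ :=
  le_add_of_nonneg_left (by positivity)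

theorem energyDefect_le {n r K a b c g d s : ℝ} (hn : 0 ≤ n) (hr : 0 ≤ r) (hK : 0 ≤ K)
    (hg : 0 ≤ a * g) (hd : 0 ≤ b * d) (hs : 0 ≤ c * s) (hb : b = r * a) :
    a * (n ^ 2 * (K * g)) + b * ((n + 1) ^ 2 * (K * g)) + c * (n * (K * s)) ≤
      (n ^ 2 + r * (n + 1) ^ 2 + n + 1) * K * (a * g + b * d + c * s) := by
  have e : (n ^ 2 + r * (n + 1) ^ 2 + n + 1) * K * (a * g + b * d + c * s) -
      (a * (n ^ 2 * (K * g)) + r * a * ((n + 1) ^ 2 * (K * g)) + c * (n * (K * s))) =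
      K * ((n + 1) * (a * g) + (n ^ 2 + r * (n + 1) ^ 2 + n + 1) * (b * d) +
        (n ^ 2 + r * (n + 1) ^ 2 + 1) * (c * s)) := by
    ring
  rw [hb] at e hd ⊢
  rw [← sub_nonneg, e]
  have h1 := mul_nonneg hn hg
  have h2 : 0 ≤ n ^ 2 + r * (n + 1) ^ 2 := by positivity
  exact mul_nonneg hK (add_nonneg (add_nonneg (by linarith) (mul_nonneg (by linarith) hd))
    (mul_nonneg (by linarith) hs))

theorem massDefect_le {n r K d c s : ℝ} (hn : 0 ≤ n) (hr : 0 ≤ r) (hK : 0 ≤ K)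
    (hd : 0 ≤ d) (hs : 0 ≤ c * s) :
    K * d + c * (n * (K * s)) ≤ (n ^ 2 + r * (n + 1) ^ 2 + n + 1) * K * (d + c * s) := by
  have e : (n ^ 2 + r * (n + 1) ^ 2 + n + 1) * K * (d + c * s) - (K * d + c * (n * (K * s))) =
      K * ((n ^ 2 + r * (n + 1) ^ 2 + n) * d + (n ^ 2 + r * (n + 1) ^ 2 + 1) * (c * s)) := by
    ring
  rw [← sub_nonneg, e]
  have h1 : 0 ≤ n ^ 2 + r * (n + 1) ^ 2 := by positivity
  exact mul_nonneg hK (add_nonneg (mul_nonneg (by linarith) hd) (mul_nonneg (by linarith) hs))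

namespace IsTransport

variable {N : ℕ} {φ ψ : Space N → Space N} {Ω Ω' : Set (Space N)} {M : ℝ≥0} {ε κ : ℝ}

theorem abs_sum_norm_wderiv_energyMap_sub_le (h : IsTransport φ ψ Ω Ω' M)
    (hφ : IsNearIdentity φ Ω ε) (hκ0 : 0 ≤ κ) (hκ : (M : ℝ) ^ N ≤ 1 + κ) (hκ1 : κ ≤ 1) {C : ℝ}
    (hC : 0 ≤ C) (hP : ∀ u : H10 Ω', ‖val u‖ ^ 2 ≤ C ^ 2 * ∑ i, ‖wderiv i u‖ ^ 2)
    (U : EnergySpace Ω') :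
    |∑ i, ∑ j, ‖wderiv j ((h.energyMap U).1 i)‖ ^ 2 - ∑ i, ∑ j, ‖wderiv j (U.1 i)‖ ^ 2| ≤
      N ^ 2 * (termDefect N C ε κ * gradNorm U.1 ^ 2) := by
  have h1 : ∀ i j, |‖wderiv j ((h.energyMap U).1 i)‖ ^ 2 - ‖wderiv j (U.1 i)‖ ^ 2| ≤
      termDefect N C ε κ * gradNorm U.1 ^ 2 := fun i j =>
    h.abs_norm_sq_sub_norm_sq_le hφ.le_one hκ0 hκ1 hκ (by positivity)
      (norm_wderiv_le_gradNorm U.1 i j) (h.norm_wderiv_energyMap_sub_le hφ hκ hκ1 hC hP U i j)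
  refine (abs_sum_sub_sum_le fun i => abs_sum_sub_sum_le fun j => h1 i j).trans (le_of_eq ?_)
  rw [Fintype.card_fin]
  ring

theorem abs_norm_divergence_energyMap_sub_le (h : IsTransport φ ψ Ω Ω' M)
    (hφ : IsNearIdentity φ Ω ε) (hκ0 : 0 ≤ κ) (hκ : (M : ℝ) ^ N ≤ 1 + κ) (hκ1 : κ ≤ 1) {C : ℝ}
    (hC : 0 ≤ C) (hP : ∀ u : H10 Ω', ‖val u‖ ^ 2 ≤ C ^ 2 * ∑ i, ‖wderiv i u‖ ^ 2)
    (U : EnergySpace Ω') :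
    |‖divergence (h.energyMap U).1‖ ^ 2 - ‖divergence U.1‖ ^ 2| ≤
      (N + 1) ^ 2 * (termDefect N C ε κ * gradNorm U.1 ^ 2) := by
  have hG : 0 ≤ gradNorm U.1 := Real.sqrt_nonneg _
  have hε := hφ.nonneg
  have h1 : ‖divergence U.1‖ ≤ (N + 1) * gradNorm U.1 := by
    refine (norm_sum_le _ _).trans ((Finset.sum_le_sum fun i _ =>
      norm_wderiv_le_gradNorm U.1 i i).trans ?_)
    simp only [Finset.sum_const, Finset.card_univ, Fintype.card_fin, nsmul_eq_mul]
    linarith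
  have h2 : ‖divergence (h.energyMap U).1 - h.comp (divergence U.1)‖ ≤
      6 * (N ^ 2 + N * C) * ε * ((N + 1) * gradNorm U.1) := by
    rw [divergence, divergence, map_sum, ← Finset.sum_sub_distrib]
    refine (norm_sum_le _ _).trans ((Finset.sum_le_sum fun i _ =>
      h.norm_wderiv_energyMap_sub_le hφ hκ hκ1 hC hP U i i).trans ?_)
    simp only [Finset.sum_const, Finset.card_univ, Fintype.card_fin, nsmul_eq_mul]
    have : 0 ≤ 6 * (N ^ 2 + N * C) * ε * gradNorm U.1 := by positivity
    linarith
  refine (h.abs_norm_sq_sub_norm_sq_le hφ.le_one hκ0 hκ1 hκ (by positivity) h1 h2).trans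
    (le_of_eq ?_)
  rw [termDefect]
  ring

/-- Fields that are transformed like gradients have nearly the same norm after the change of
variables. -/
theorem abs_sum_norm_sub_le (h : IsTransport φ ψ Ω Ω' M)
    (hφ : IsNearIdentity φ Ω ε) (hκ0 : 0 ≤ κ) (hκ : (M : ℝ) ^ N ≤ 1 + κ) (hκ1 : κ ≤ 1) {C : ℝ}
    (hC : 0 ≤ C) {v : Fin N → L2 Ω} {u : Fin N → L2 Ω'}
    (hv : ∀ i, v i =ᵐ[volume.restrict Ω] fun x => ∑ l, jac φ i l x * h.comp (u l) x) :
    |∑ i, ‖v i‖ ^ 2 - ∑ i, ‖u i‖ ^ 2| ≤ N * (termDefect N C ε κ * ∑ i, ‖u i‖ ^ 2) := by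
  have hε := hφ.nonneg
  set Z := Real.sqrt (∑ i, ‖u i‖ ^ 2) with hZ
  have hZ0 : 0 ≤ Z := Real.sqrt_nonneg _
  have hZ2 : Z ^ 2 = ∑ i, ‖u i‖ ^ 2 := Real.sq_sqrt (by positivity)
  have hN : (N : ℝ) ≤ N ^ 2 := by exact_mod_cast Nat.le_self_pow two_ne_zero N
  have h1 : ∀ i, |‖v i‖ ^ 2 - ‖u i‖ ^ 2| ≤ termDefect N C ε κ * Z ^ 2 := fun i => by
    refine h.abs_norm_sq_sub_norm_sq_le hφ.le_one hκ0 hκ1 hκ (D := 6 * (N ^ 2 + N * C))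
      (by positivity) (norm_le_sqrt_sum_sq u i)
      ((h.norm_sum_jac_sub_le hφ hκ hκ1 (hv i) (norm_le_sqrt_sum_sq u)).trans ?_)
    have h2 : (2 : ℝ) * N ≤ 6 * (N ^ 2 + N * C) := by
      have : 0 ≤ (N : ℝ) * C := by positivity
      nlinarith [(Nat.cast_nonneg N : (0 : ℝ) ≤ N)]
    exact mul_le_mul_of_nonneg_right (mul_le_mul_of_nonneg_right h2 hε) hZ0
  have h2 := abs_sum_sub_sum_le h1
  rwa [Fintype.card_fin, hZ2] at h2

/-- The energy changes by a relative amount that does not depend on `t` and `k`. -/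
theorem abs_energyForm_energyMap_sub_le (h : IsTransport φ ψ Ω Ω' M)
    (hφ : IsNearIdentity φ Ω ε) (hκ0 : 0 ≤ κ) (hκ : (M : ℝ) ^ N ≤ 1 + κ) (hκ1 : κ ≤ 1) {C : ℝ}
    (hC : 0 ≤ C) (hP : ∀ u : H10 Ω', ‖val u‖ ^ 2 ≤ C ^ 2 * ∑ i, ‖wderiv i u‖ ^ 2)
    (P : Params) (U : EnergySpace Ω') :
    |energyForm P (h.energyMap U) (h.energyMap U) - energyForm P U U| ≤
      formDefect N P.lam P.mu C ε κ * energyForm P U U := by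
  have hε := hφ.nonneg
  have b1 := h.abs_sum_norm_wderiv_energyMap_sub_le hφ hκ0 hκ hκ1 hC hP U
  have b2 := h.abs_norm_divergence_energyMap_sub_le hφ hκ0 hκ hκ1 hC hP U
  have b3 := h.abs_sum_norm_sub_le hφ hκ0 hκ hκ1 hC (h.ae_shear_energyMap U)
  have hK : 0 ≤ termDefect N C ε κ := hκ0.trans (le_termDefect hC hε)
  have hG : gradNorm U.1 ^ 2 = ∑ i, ∑ j, ‖wderiv j (U.1 i)‖ ^ 2 := Real.sq_sqrt (by positivity)
  have hmu := P.mu_pos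
  have hlam := P.lam_pos
  have hk := P.k_pos
  have ht := P.t_pos
  rw [energyForm_self, energyForm_self, formDefect]
  rw [← hG] at b1 ⊢
  set K := termDefect N C ε κ
  set a := P.mu / 12 with ha
  set b := (P.mu + P.lam) / 12 with hb
  set c := P.mu * P.k / P.t ^ 2 with hc
  set g := gradNorm U.1 ^ 2
  set s := ∑ i, ‖shear U i‖ ^ 2
  set d := ‖divergence U.1‖ ^ 2
  have ha0 : 0 ≤ a := by positivity
  have hb0 : 0 ≤ b := by positivity
  have hc0 : 0 ≤ c := by positivity
  have hg0 : 0 ≤ g := sq_nonneg _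
  have hs0 : 0 ≤ s := Finset.sum_nonneg fun i _ => sq_nonneg _
  have hd0 : 0 ≤ d := sq_nonneg _
  set r := (P.mu + P.lam) / P.mu with hr
  have hr0 : 0 ≤ r := by positivity
  have hba : b = r * a := by
    rw [hb, hr, ha]
    field_simp
  have c1 := mul_le_mul_of_nonneg_left b1 ha0
  have c2 := mul_le_mul_of_nonneg_left b2 hb0
  have c3 := mul_le_mul_of_nonneg_left b3 hc0
  rw [← abs_of_nonneg ha0, ← abs_mul, abs_of_nonneg ha0] at c1
  rw [← abs_of_nonneg hb0, ← abs_mul, abs_of_nonneg hb0] at c2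
  rw [← abs_of_nonneg hc0, ← abs_mul, abs_of_nonneg hc0] at c3
  refine le_trans (le_of_eq (congrArg _ ?_)) ((abs_add_three _ _ _).trans
    ((add_le_add (add_le_add c1 c2) c3).trans ?_))
  · ring
  · exact energyDefect_le N.cast_nonneg hr0 hK (mul_nonneg ha0 hg0) (mul_nonneg hb0 hd0)
      (mul_nonneg hc0 hs0) hba

/-- The mass changes by a relative amount that does not depend on `t`. -/
theorem abs_massForm_energyMap_sub_le (h : IsTransport φ ψ Ω Ω' M)
    (hφ : IsNearIdentity φ Ω ε) (hκ0 : 0 ≤ κ) (hκ : (M : ℝ) ^ N ≤ 1 + κ) (hκ1 : κ ≤ 1) {C : ℝ}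
    (hC : 0 ≤ C) (P : Params) (U : EnergySpace Ω') :
    |massForm P (h.energyMap U) (h.energyMap U) - massForm P U U| ≤
      formDefect N P.lam P.mu C ε κ * massForm P U U := by
  have hε := hφ.nonneg
  have b1 := h.abs_norm_comp_sq_sub_le hκ0 hκ (val U.2)
  rw [← val_energyMap_snd] at b1
  have b2 := h.abs_sum_norm_sub_le hφ hκ0 hκ hκ1 hC (h.ae_val_energyMap_fst U)
  have hκK : κ ≤ termDefect N C ε κ := le_termDefect hC hε
  have hmu := P.mu_pos
  have hlam := P.lam_pos
  rw [massForm_self, massForm_self, formDefect]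
  set K := termDefect N C ε κ
  have hK : 0 ≤ K := hκ0.trans hκK
  set c := P.t ^ 2 / 12 with hc
  set s := ∑ i, ‖val (U.1 i)‖ ^ 2
  set d := ‖val U.2‖ ^ 2
  have hc0 : 0 ≤ c := by positivity
  have hs0 : 0 ≤ s := Finset.sum_nonneg fun i _ => sq_nonneg _
  have hd0 : 0 ≤ d := sq_nonneg _
  set r := (P.mu + P.lam) / P.mu with hr
  have hr0 : 0 ≤ r := by positivity
  have c1 := b1.trans (mul_le_mul_of_nonneg_right hκK hd0)
  have c2 := mul_le_mul_of_nonneg_left b2 hc0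
  rw [← abs_of_nonneg hc0, ← abs_mul, abs_of_nonneg hc0] at c2
  refine le_trans (le_of_eq (congrArg _ ?_)) ((abs_add_le _ _).trans
    ((add_le_add c1 c2).trans ?_))
  · ring
  · exact massDefect_le N.cast_nonneg hr0 hK hd0 (mul_nonneg hc0 hs0)

end IsTransport

/-! ### Discreteness of the spectrum -/

section HilbertSum

variable {ι E X : Type*} [Fintype ι] [NormedAddCommGroup E] [NormedSpace ℝ E]
  [NormedAddCommGroup X] [InnerProductSpace ℝ X]

/-- The operator into a finite Hilbert sum with the components `f i`. -/
def hilbertSumMap (f : ι → E →L[ℝ] X) : E →L[ℝ] PiLp 2 (fun _ : ι => X) :=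
  (PiLp.continuousLinearEquiv 2 ℝ (fun _ : ι => X)).symm.toContinuousLinearMap ∘L
    ContinuousLinearMap.pi f

theorem inner_hilbertSumMap (f : ι → E →L[ℝ] X) (u w : E) :
    inner ℝ (hilbertSumMap f u) (hilbertSumMap f w) = ∑ i, inner ℝ (f i u) (f i w) :=
  PiLp.inner_apply _ _

theorem norm_le_norm_hilbertSumMap (f : ι → E →L[ℝ] X) (u : E) (i : ι) :
    ‖f i u‖ ≤ ‖hilbertSumMap f u‖ :=
  PiLp.norm_apply_le (hilbertSumMap f u) i

theorem isCompactOperator_hilbertSumMap {f : ι → E →L[ℝ] X} (h : ∀ i, IsCompactOperator (f i)) :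
    IsCompactOperator (hilbertSumMap f) := by
  have h1 : IsCompactOperator (ContinuousLinearMap.pi f) := by
    choose Q hQ hQ' using h
    refine ⟨univ.pi Q, isCompact_univ_pi hQ, ?_⟩
    filter_upwards [eventually_all.2 hQ'] with u hu i _ using hu i
  exact h1.clm_comp (PiLp.continuousLinearEquiv 2 ℝ (fun _ : ι => X)).symm.toContinuousLinearMap

end HilbertSum

variable {N : ℕ} {Ω : Set (Space N)}

instance : CompleteSpace (H10 Ω) :=
  (testPairs Ω).isClosed_topologicalClosure.completeSpace_coe

/-- The continuous version of `val`. -/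
def valL : H10 Ω →L[ℝ] L2 Ω :=
  ContinuousLinearMap.fst ℝ (L2 Ω) (Fin N → L2 Ω) ∘L (H10 Ω).subtypeL

/-- The continuous version of `wderiv`. -/
def wderivL (i : Fin N) : H10 Ω →L[ℝ] L2 Ω :=
  ContinuousLinearMap.proj i ∘L ContinuousLinearMap.snd ℝ (L2 Ω) (Fin N → L2 Ω) ∘L
    (H10 Ω).subtypeL

/-- The projection `(β, w) ↦ β_i`. -/
def fieldL (i : Fin N) : EnergySpace Ω →L[ℝ] H10 Ω :=
  ContinuousLinearMap.proj i ∘L ContinuousLinearMap.fst ℝ (Fin N → H10 Ω) (H10 Ω)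

/-- The projection `(β, w) ↦ w`. -/
def deflectionL : EnergySpace Ω →L[ℝ] H10 Ω :=
  ContinuousLinearMap.snd ℝ (Fin N → H10 Ω) (H10 Ω)

/-- The family of the weighted fields `∂_j β_i`, `div β` and `∂_i w - β_i`, whose total squared
norm is the energy. -/
def energyFields (P : Params) :
    (Fin N × Fin N) ⊕ (Unit ⊕ Fin N) → EnergySpace Ω →L[ℝ] L2 Ω :=
  Sum.elim (fun q => Real.sqrt (P.mu / 12) • (wderivL q.2 ∘L fieldL q.1))
    (Sum.elim (fun _ => Real.sqrt ((P.mu + P.lam) / 12) • ∑ i, wderivL i ∘L fieldL i)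
      (fun i => Real.sqrt (P.mu * P.k / P.t ^ 2) •
        (wderivL i ∘L deflectionL - valL ∘L fieldL i)))

/-- The family of the weighted functions `w` and `β_i`, whose total squared norm is the mass. -/
def massFields (P : Params) : Unit ⊕ Fin N → EnergySpace Ω →L[ℝ] L2 Ω :=
  Sum.elim (fun _ => valL ∘L deflectionL) (fun i => Real.sqrt (P.t ^ 2 / 12) • (valL ∘L fieldL i))

theorem energyForm_eq_inner (P : Params) (U W : EnergySpace Ω) :
    energyForm P U W =
      inner ℝ (hilbertSumMap (energyFields P) U) (hilbertSumMap (energyFields P) W) := by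
  have hmu := P.mu_pos
  have hlam := P.lam_pos
  have hk := P.k_pos
  have h1 : 0 ≤ P.mu / 12 := by positivity
  have h2 : 0 ≤ (P.mu + P.lam) / 12 := by positivity
  have h3 : 0 ≤ P.mu * P.k / P.t ^ 2 := by positivity
  have hs : ∀ {a : ℝ} (_ : 0 ≤ a) (f g : L2 Ω),
      inner ℝ (Real.sqrt a • f) (Real.sqrt a • g) = a * inner ℝ f g := fun {a} ha f g => by
    rw [real_inner_smul_left, real_inner_smul_right, ← mul_assoc, Real.mul_self_sqrt ha]
  rw [inner_hilbertSumMap, Fintype.sum_sum_type, Fintype.sum_sum_type, Fintype.sum_prod_type]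
  simp only [energyFields, Sum.elim_inl, Sum.elim_inr, smul_apply, hs h1,
    hs h2, hs h3, Finset.univ_unique, Finset.sum_singleton, ← Finset.mul_sum,
    sum_apply]
  exact add_assoc _ _ _

theorem massForm_eq_inner (P : Params) (U W : EnergySpace Ω) :
    massForm P U W =
      inner ℝ (hilbertSumMap (massFields P) U) (hilbertSumMap (massFields P) W) := by
  have hs : ∀ {a : ℝ} (_ : 0 ≤ a) (f g : L2 Ω),
      inner ℝ (Real.sqrt a • f) (Real.sqrt a • g) = a * inner ℝ f g := fun {a} ha f g => by
    rw [real_inner_smul_left, real_inner_smul_right, ← mul_assoc, Real.mul_self_sqrt ha]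
  have h1 : 0 ≤ P.t ^ 2 / 12 := by positivity
  rw [inner_hilbertSumMap, Fintype.sum_sum_type]
  simp only [massFields, Sum.elim_inl, Sum.elim_inr, smul_apply, hs h1,
    Finset.univ_unique, Finset.sum_singleton, ← Finset.mul_sum]
  rfl

/-- By Poincaré's inequality the norm of the gradient is equivalent to that of `H¹₀(Ω)`. -/
theorem norm_le_mul_sum_norm_wderiv {C : ℝ} (hC : 0 ≤ C)
    (hP : ∀ u : H10 Ω, ‖val u‖ ^ 2 ≤ C ^ 2 * ∑ i, ‖wderiv i u‖ ^ 2) (u : H10 Ω) :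
    ‖u‖ ≤ (C + 1) * ∑ i, ‖wderiv i u‖ := by
  have h0 : 0 ≤ ∑ i, ‖wderiv i u‖ := Finset.sum_nonneg fun i _ => norm_nonneg _
  have h1 : ‖val u‖ ≤ C * ∑ i, ‖wderiv i u‖ := by
    refine le_of_sq_le_sq ((hP u).trans ?_) (mul_nonneg hC h0)
    rw [mul_pow]
    exact mul_le_mul_of_nonneg_left
      (Finset.sum_sq_le_sq_sum_of_nonneg fun i _ => norm_nonneg _) (sq_nonneg C)
  change ‖(u : L2Pair Ω)‖ ≤ _
  refine (Prod.norm_def _).trans_le (max_le (h1.trans ?_) ?_)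
  · exact mul_le_mul_of_nonneg_right (by linarith) h0
  · refine (pi_norm_le_iff_of_nonneg (by positivity)).2 fun i => ?_
    have h2 : ‖wderiv i u‖ ≤ ∑ i, ‖wderiv i u‖ :=
      Finset.single_le_sum (f := fun i => ‖wderiv i u‖) (fun i _ => norm_nonneg _)
        (Finset.mem_univ i)
    exact h2.trans (le_mul_of_one_le_left h0 (by linarith))

/-- The energy controls the norm of the energy space. -/
theorem exists_norm_le_mul_norm_energyFields (P : Params) {C : ℝ} (hC : 0 ≤ C)
    (hP : ∀ u : H10 Ω, ‖val u‖ ^ 2 ≤ C ^ 2 * ∑ i, ‖wderiv i u‖ ^ 2) :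
    ∃ c : ℝ≥0, ∀ U : EnergySpace Ω, ‖U‖ ≤ c * ‖hilbertSumMap (energyFields P) U‖ := by
  have hmu := P.mu_pos
  have hk := P.k_pos
  have ht := P.t_pos
  set r := Real.sqrt (P.mu / 12) with hr
  set q := Real.sqrt (P.mu * P.k / P.t ^ 2) with hq
  have hr0 : 0 < r := Real.sqrt_pos.2 (by positivity)
  have hq0 : 0 < q := Real.sqrt_pos.2 (by positivity)
  set D := C + 1 with hD
  have hD0 : 0 ≤ D := by positivity
  refine ⟨Real.toNNReal (D * (N * r⁻¹) + D * (N * (q⁻¹ + D * (N * r⁻¹)))), fun U => ?_⟩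
  rw [Real.coe_toNNReal _ (by positivity)]
  set n := ‖hilbertSumMap (energyFields P) U‖
  have hn : 0 ≤ n := norm_nonneg _
  have h1 : ∀ i j, ‖wderiv j (U.1 i)‖ ≤ r⁻¹ * n := fun i j => by
    have h := norm_le_norm_hilbertSumMap (energyFields P) U (Sum.inl (i, j))
    have e : energyFields P (Sum.inl (i, j)) U = r • wderiv j (U.1 i) := rfl
    rw [e, norm_smul, Real.norm_of_nonneg hr0.le] at h
    rwa [inv_mul_eq_div, le_div_iff₀' hr0]
  have h2 : ∀ i, ‖shear U i‖ ≤ q⁻¹ * n := fun i => by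
    have h := norm_le_norm_hilbertSumMap (energyFields P) U (Sum.inr (Sum.inr i))
    have e : energyFields P (Sum.inr (Sum.inr i)) U = q • shear U i := rfl
    rw [e, norm_smul, Real.norm_of_nonneg hq0.le] at h
    rwa [inv_mul_eq_div, le_div_iff₀' hq0]
  have hsum : ∀ {f : Fin N → ℝ} {c : ℝ}, (∀ i, f i ≤ c) → ∑ i, f i ≤ N * c := fun {f c} h => by
    simpa using Finset.sum_le_sum (s := Finset.univ) fun i _ => h i
  have h3 : ∀ i, ‖U.1 i‖ ≤ D * (N * (r⁻¹ * n)) := fun i =>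
    (norm_le_mul_sum_norm_wderiv hC hP (U.1 i)).trans
      (mul_le_mul_of_nonneg_left (hsum (h1 i)) hD0)
  have h4 : ∀ i, ‖wderiv i U.2‖ ≤ q⁻¹ * n + D * (N * (r⁻¹ * n)) := fun i => by
    have e : wderiv i U.2 = shear U i + val (U.1 i) := by rw [shear, sub_add_cancel]
    rw [e]
    refine (norm_add_le _ _).trans (add_le_add (h2 i) (le_trans ?_ (h3 i)))
    exact le_max_left _ _
  have h5 : ‖U.2‖ ≤ D * (N * (q⁻¹ * n + D * (N * (r⁻¹ * n)))) :=
    (norm_le_mul_sum_norm_wderiv hC hP U.2).trans (mul_le_mul_of_nonneg_left (hsum h4) hD0)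
  have e : (D * (N * r⁻¹) + D * (N * (q⁻¹ + D * (N * r⁻¹)))) * n =
      D * (N * (r⁻¹ * n)) + D * (N * (q⁻¹ * n + D * (N * (r⁻¹ * n)))) := by ring
  rw [e]
  have p1 : 0 ≤ D * (N * (r⁻¹ * n)) := by positivity
  have p2 : 0 ≤ D * (N * (q⁻¹ * n + D * (N * (r⁻¹ * n)))) := by positivity
  refine (Prod.norm_def _).trans_le (max_le ?_ (h5.trans (by linarith)))
  exact ((pi_norm_le_iff_of_nonneg p1).2 h3).trans (by linarith)

/-- There are infinitely many test functions with disjoint supports. -/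
theorem exists_test_sequence (hN : 1 ≤ N) (hΩ : IsOpen Ω) (hne : Ω.Nonempty) :
    ∃ f : ℕ → Space N → ℝ, (∀ n, IsTestFunction Ω (f n)) ∧ (∀ n, ∃ x ∈ Ω, f n x ≠ 0) ∧
      ∀ m n, m ≠ n → ∀ x, f m x * f n x = 0 := by
  have : Nontrivial (Space N) := by
    have : Nonempty (Fin N) := ⟨⟨0, hN⟩⟩
    infer_instance
  obtain ⟨x, hx⟩ := hne
  have hinf : Infinite Ω := (infinite_of_mem_nhds x (hΩ.mem_nhds hx)).to_subtype
  obtain ⟨U, hU1, hU2, hU3⟩ := exists_seq_infinite_isOpen_pairwise_disjoint Ω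
  choose p hp using fun n => (hU1 n).nonempty
  have hnhds : ∀ n, Subtype.val '' U n ∈ 𝓝 (p n : Space N) := fun n =>
    (hΩ.isOpenMap_subtype_val _ (hU2 n)).mem_nhds ⟨p n, hp n, rfl⟩
  choose f hf1 hf2 hf3 _ hf5 using fun n => exists_contDiff_tsupport_subset (n := ⊤) (hnhds n)
  refine ⟨f, fun n => ⟨hf3 n, hf2 n, (hf1 n).trans (Subtype.coe_image_subset Ω _)⟩,
    fun n => ⟨p n, (p n).2, by simp [hf5]⟩, fun m n hmn y => ?_⟩
  by_contra hy
  obtain ⟨a, ha, ha'⟩ := hf1 m (subset_tsupport _ (left_ne_zero_of_mul hy))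
  obtain ⟨b, hb, hb'⟩ := hf1 n (subset_tsupport _ (right_ne_zero_of_mul hy))
  obtain rfl : a = b := Subtype.ext (ha'.trans hb'.symm)
  exact disjoint_left.1 (hU3 hmn) ha hb

theorem exists_val_ae_eq {f : Space N → ℝ} (hf : IsTestFunction Ω f) :
    ∃ u : H10 Ω, val u =ᵐ[volume.restrict Ω] f := by
  have hm : MemLp f 2 (volume.restrict Ω) :=
    (hf.smooth.continuous.memLp_of_hasCompactSupport hf.compact_support).restrict Ω
  have hd : ∀ i, MemLp (partialDeriv i f) 2 (volume.restrict Ω) := fun i =>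
    ((hf.partialDeriv_continuous i).memLp_of_hasCompactSupport
      (hf.partialDeriv_compact i)).restrict Ω
  refine ⟨⟨(hm.toLp, fun i => (hd i).toLp), (testPairs Ω).le_topologicalClosure
    ⟨f, hf, hm.coeFn_toLp, fun i => (hd i).coeFn_toLp⟩⟩, hm.coeFn_toLp⟩

/-- Bumps with disjoint supports are orthogonal in `L²(Ω)`, hence linearly independent. -/
theorem not_finiteDimensional_energySpace (hN : 1 ≤ N) (hΩ : IsOpen Ω) (hne : Ω.Nonempty) :
    ¬ FiniteDimensional ℝ (EnergySpace Ω) := by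
  intro hfin
  obtain ⟨f, hf, hf0, hfd⟩ := exists_test_sequence hN hΩ hne
  choose u hu using fun n => exists_val_ae_eq (hf n)
  have hli : LinearIndependent ℝ fun n => val (u n) := by
    refine linearIndependent_of_ne_zero_of_inner_eq_zero (𝕜 := ℝ) (fun n h => ?_) fun m n hmn => ?_
    · obtain ⟨x, hx, hx0⟩ := hf0 n
      have h1 : f n =ᵐ[volume.restrict Ω] fun _ => (0 : ℝ) := by
        refine (hu n).symm.trans ?_
        rw [h]
        exact Lp.coeFn_zero _ _ _
      exact hx0 (Measure.eqOn_open_of_ae_eq h1 hΩ (hf n).smooth.continuous.continuousOn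
        continuousOn_const hx)
    · change inner ℝ (val (u m)) (val (u n)) = 0
      rw [L2.inner_def]
      refine integral_eq_zero_of_ae ?_
      filter_upwards [hu m, hu n] with x h1 h2
      rw [h1, h2]
      have := hfd n m hmn.symm x
      simpa using this
  have hli' : LinearIndependent ℝ fun n => ((0, u n) : EnergySpace Ω) :=
    LinearIndependent.of_comp (val ∘ₗ LinearMap.snd ℝ (Fin N → H10 Ω) (H10 Ω)) hli
  have := hli'.finite
  exact not_finite ℕ

/-- Coercivity of the energy and Rellich's theorem give the discreteness of the spectrum. -/
theorem hasDiscreteSpectrum (hN : 1 ≤ N) (hΩ : IsOpen Ω) (hne : Ω.Nonempty)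
    (hfin : volume Ω ≠ ⊤) {C : ℝ} (hC : 0 ≤ C)
    (hP : ∀ u : H10 Ω, ‖val u‖ ^ 2 ≤ C ^ 2 * ∑ i, ‖wderiv i u‖ ^ 2) (P : Params) :
    HasDiscreteSpectrum (fun U : EnergySpace Ω => energyForm P U U)
      (fun U : EnergySpace Ω => massForm P U U) (eigenspace P Ω) := by
  obtain ⟨c, hc⟩ := exists_norm_le_mul_norm_energyFields P hC hP
  set A := hilbertSumMap (energyFields (Ω := Ω) P)
  set B := hilbertSumMap (massFields (Ω := Ω) P)
  have hA : AntilipschitzWith c A := A.antilipschitz_of_bound hc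
  have hcl : IsClosed (range A) := hA.isClosed_range A.uniformContinuous
  let e := ContinuousLinearMap.equivRange hA.injective hcl
  have : CompleteSpace A.range := hcl.completeSpace_coe
  have hcomp : IsCompactOperator B := by
    refine isCompactOperator_hilbertSumMap ?_
    have hv : IsCompactOperator (valL : H10 Ω →L[ℝ] L2 Ω) := isCompactOperator_val hΩ hfin
    rintro (_ | i)
    · exact hv.comp_clm deflectionL
    · exact (hv.comp_clm (fieldL i)).smul (Real.sqrt (P.t ^ 2 / 12))
  have ht := P.t_pos
  have hBinj : Function.Injective B := by
    refine (injective_iff_map_eq_zero B).2 fun U hU => ?_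
    have h1 : ∀ s, massFields P s U = 0 := fun s => by
      have := norm_le_norm_hilbertSumMap (massFields P) U s
      change _ ≤ ‖B U‖ at this
      rw [hU, norm_zero] at this
      exact norm_le_zero_iff.1 this
    refine Prod.ext (funext fun i => val_injective hΩ ?_) (val_injective hΩ ?_)
    · rw [Prod.fst_zero, Pi.zero_apply, map_zero]
      have h2 : Real.sqrt (P.t ^ 2 / 12) • val (U.1 i) = 0 := h1 (Sum.inr i)
      exact (smul_eq_zero.1 h2).resolve_left (Real.sqrt_pos.2 (by positivity)).ne'
    · rw [Prod.snd_zero, map_zero]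
      exact h1 (Sum.inl ())
  have hC' : ∀ U, (B ∘L e.symm.toContinuousLinearMap) (e U) = B U := fun U =>
    congrArg B (e.symm_apply_apply U)
  refine hasDiscreteSpectrum_of_isCompactOperator e.toLinearEquiv
    (C := B ∘L e.symm.toContinuousLinearMap) (hcomp.comp_clm _)
    (hBinj.comp e.symm.injective) (not_finiteDimensional_energySpace hN hΩ hne)
    (fun U W => ?_) (fun U W => ?_) fun γ U => Iff.rfl
  · exact energyForm_eq_inner P U W
  · refine (massForm_eq_inner P U W).trans ?_
    exact (congrArg₂ (inner ℝ) (hC' U) (hC' W)).symm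

theorem exists_le_volume_ball (hN : 1 ≤ N) (V : ℝ≥0) :
    ∃ R : ℝ, 0 < R ∧ (V : ℝ≥0∞) ≤ volume (Metric.ball (0 : Space N) R) := by
  have : Nontrivial (Space N) := by
    have : Nonempty (Fin N) := ⟨⟨0, hN⟩⟩
    infer_instance
  have : NoncompactSpace (Space N) := NormedSpace.noncompactSpace ℝ _
  have h := tendsto_measure_iUnion_atTop (μ := (volume : Measure (Space N)))
    (s := fun n : ℕ => Metric.ball (0 : Space N) n)
    fun m n hmn => Metric.ball_subset_ball (Nat.cast_le.2 hmn)
  rw [Metric.iUnion_ball_nat, measure_univ_of_isAddLeftInvariant] at h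
  obtain ⟨n, hn, hn'⟩ := ((h.eventually (lt_mem_nhds (ENNReal.coe_lt_top (r := V)))).and
    (eventually_gt_atTop 0)).exists
  exact ⟨n, Nat.cast_pos.2 hn', hn.le⟩

/-! ### Diffeomorphisms close to the identity -/

section NearIdentity

variable {N : ℕ} {Ω : Set (Space N)} {φ : Space N → Space N}

theorem norm_le_sum_norm_apply_basisVec (L : Space N →L[ℝ] Space N) :
    ‖L‖ ≤ ∑ i, ‖L (basisVec i)‖ := by
  refine L.opNorm_le_bound (Finset.sum_nonneg fun i _ => norm_nonneg _) fun v => ?_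
  have h : L v = ∑ i, v i • L (basisVec i) := by
    conv_lhs => rw [← (EuclideanSpace.basisFun (Fin N) ℝ).sum_repr v]
    simp
  rw [h, Finset.sum_mul]
  refine (norm_sum_le _ _).trans (Finset.sum_le_sum fun i _ => ?_)
  rw [norm_smul, mul_comm]
  exact mul_le_mul_of_nonneg_left (PiLp.norm_apply_le v i) (norm_nonneg _)

theorem IsC11On.hasFDerivAt (h : IsC11On φ Ω) (hΩ : IsOpen Ω) {x : Space N} (hx : x ∈ Ω) :
    HasFDerivAt φ (fderiv ℝ φ x) x :=
  ((h.1.contDiffAt (hΩ.mem_nhds hx)).differentiableAt (by simp)).hasFDerivAt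

theorem IsC11On.ae_differentiableAt_fderiv (h : IsC11On φ Ω) (hΩ : IsOpen Ω) :
    ∀ᵐ x ∂(volume.restrict Ω), DifferentiableAt ℝ (fderiv ℝ φ) x := by
  obtain ⟨K, hK⟩ := h.2
  rw [ae_restrict_iff' hΩ.measurableSet]
  filter_upwards [hK.ae_differentiableWithinAt_of_mem (μ := volume)] with x h1 hx
  exact (h1 hx).differentiableAt (hΩ.mem_nhds hx)

theorem IsC11On.partialDeriv_sub_id (h : IsC11On φ Ω) (hΩ : IsOpen Ω) {x : Space N} (hx : x ∈ Ω)
    (i : Fin N) : partialDeriv i (fun x => φ x - x) x = partialDeriv i φ x - basisVec i := by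
  have h1 : HasFDerivAt (fun x => φ x - x) (fderiv ℝ φ x - ContinuousLinearMap.id ℝ _) x :=
    (h.hasFDerivAt hΩ hx).sub (hasFDerivAt_id x)
  rw [partialDeriv, h1.fderiv]
  rfl

theorem IsC11On.partialDeriv_partialDeriv_sub_id (h : IsC11On φ Ω) (hΩ : IsOpen Ω) {x : Space N}
    (hx : x ∈ Ω) (i j : Fin N) :
    partialDeriv j (partialDeriv i fun x => φ x - x) x = partialDeriv j (partialDeriv i φ) x := by
  have h1 : partialDeriv i (fun x => φ x - x) =ᶠ[𝓝 x] fun y => partialDeriv i φ y - basisVec i := by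
    filter_upwards [hΩ.mem_nhds hx] with y hy using h.partialDeriv_sub_id hΩ hy i
  rw [partialDeriv, h1.fderiv_eq, fderiv_sub_const, partialDeriv]

theorem norm_partialDeriv_sub_basisVec_le (h : IsC11On φ Ω) (hΩ : IsOpen Ω)
    (hfin : distortion Ω φ ≠ ⊤) {x : Space N} (hx : x ∈ Ω) (i : Fin N) :
    ‖partialDeriv i φ x - basisVec i‖ ≤ (distortion Ω φ).toReal := by
  rw [← h.partialDeriv_sub_id hΩ hx, ← toReal_enorm]
  refine ENNReal.toReal_mono hfin (le_trans ?_ (le_max_left _ _))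
  exact (le_iSup₂ (f := fun x (_ : x ∈ Ω) => ‖partialDeriv i (fun x => φ x - x) x‖ₑ) x hx).trans
    (le_iSup (fun i => ⨆ x ∈ Ω, ‖partialDeriv i (fun x => φ x - x) x‖ₑ) i)

theorem ae_norm_partialDeriv_partialDeriv_le (h : IsC11On φ Ω) (hΩ : IsOpen Ω)
    (hfin : distortion Ω φ ≠ ⊤) :
    ∀ᵐ x ∂(volume.restrict Ω), ∀ i j,
      ‖partialDeriv j (partialDeriv i φ) x‖ ≤ (distortion Ω φ).toReal := by
  refine ae_all_iff.2 fun i => ae_all_iff.2 fun j => ?_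
  filter_upwards [ENNReal.ae_le_essSup (μ := volume.restrict Ω)
      fun x => ‖partialDeriv j (partialDeriv i fun x => φ x - x) x‖ₑ,
    ae_restrict_mem hΩ.measurableSet] with x h1 hx
  rw [← h.partialDeriv_partialDeriv_sub_id hΩ hx, ← toReal_enorm]
  refine ENNReal.toReal_mono hfin (h1.trans (le_trans ?_ (le_max_right _ _)))
  exact (le_iSup (fun i => essSup (fun x => ‖partialDeriv j (partialDeriv i
      fun x => φ x - x) x‖ₑ) (volume.restrict Ω)) i).trans
    (le_iSup (fun j => ⨆ i, essSup (fun x => ‖partialDeriv j (partialDeriv i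
      fun x => φ x - x) x‖ₑ) (volume.restrict Ω)) j)

theorem isNearIdentity_distortion (h : IsC11On φ Ω) (hΩ : IsOpen Ω)
    (hfin : distortion Ω φ ≠ ⊤) (h1 : (distortion Ω φ).toReal ≤ 1) :
    IsNearIdentity φ Ω (distortion Ω φ).toReal where
  nonneg := ENNReal.toReal_nonneg
  le_one := h1
  jac_sub_le x hx i l := by
    have h2 := (PiLp.norm_apply_le (partialDeriv i φ x - basisVec i) l).trans
      (norm_partialDeriv_sub_basisVec_le h hΩ hfin hx i)
    have e : (partialDeriv i φ x - basisVec i) l = jac φ i l x - if i = l then 1 else 0 := by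
      simp [jac, eq_comm]
    rwa [e, Real.norm_eq_abs] at h2
  partialDeriv_jac_le := by
    filter_upwards [ae_norm_partialDeriv_partialDeriv_le h hΩ hfin,
      h.ae_differentiableAt_fderiv hΩ] with x h2 h3 i j l
    have h4 : DifferentiableAt ℝ (partialDeriv i φ) x := h3.clm_apply (differentiableAt_const _)
    have h5 : HasFDerivAt (jac φ i l)
        ((EuclideanSpace.proj l : Space N →L[ℝ] ℝ) ∘L fderiv ℝ (partialDeriv i φ) x) x :=
      (EuclideanSpace.proj l : Space N →L[ℝ] ℝ).hasFDerivAt.comp x h4.hasFDerivAt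
    rw [partialDeriv, h5.fderiv]
    exact (PiLp.norm_apply_le (partialDeriv j (partialDeriv i φ) x) l).trans (h2 i j)

theorem norm_fderiv_sub_id_le (h : IsC11On φ Ω) (hΩ : IsOpen Ω)
    (hfin : distortion Ω φ ≠ ⊤) {x : Space N} (hx : x ∈ Ω) :
    ‖fderiv ℝ φ x - ContinuousLinearMap.id ℝ (Space N)‖ ≤ N * (distortion Ω φ).toReal := by
  refine (norm_le_sum_norm_apply_basisVec _).trans ((Finset.sum_le_sum
    fun i _ => norm_partialDeriv_sub_basisVec_le h hΩ hfin hx i).trans (le_of_eq ?_))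
  simp

/-- The inverse of a linear map close to the identity has norm close to `1`. -/
theorem norm_le_of_comp_eq_id {E : Type*} [NormedAddCommGroup E] [NormedSpace ℝ E]
    {T L : E →L[ℝ] E} {s : ℝ} (hs : s ≤ 1 / 2) (hTL : T ∘L L = ContinuousLinearMap.id ℝ E)
    (hL : ‖L - ContinuousLinearMap.id ℝ E‖ ≤ s) : ‖T‖ ≤ 1 + 2 * s := by
  have h1 : T = ContinuousLinearMap.id ℝ E - T ∘L (L - ContinuousLinearMap.id ℝ E) := by
    rw [ContinuousLinearMap.comp_sub, hTL, ContinuousLinearMap.comp_id]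
    abel
  have h2 : ‖T‖ ≤ 1 + ‖T‖ * s := by
    conv_lhs => rw [h1]
    refine (norm_sub_le _ _).trans (add_le_add ContinuousLinearMap.norm_id_le ?_)
    exact (T.opNorm_comp_le _).trans (mul_le_mul_of_nonneg_left hL (norm_nonneg _))
  have h3 : 0 ≤ s := (norm_nonneg _).trans hL
  -- Absorption gives the rough bound `2`, which is then inserted in `h2`.
  have h4 : ‖T‖ ≤ 2 := by nlinarith [norm_nonneg T]
  nlinarith

/-- A diffeomorphism close to the identity has a gradient and an inverse gradient of norm close to
`1`, and it changes volumes little. -/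
theorem exists_isTransport (hφ : IsC11Diffeo φ Ω) (hΩ : IsOpen Ω) (hV : volume Ω ≠ ⊤)
    (hfin : distortion Ω φ ≠ ⊤) {M : ℝ≥0} (hM : (M : ℝ) = 1 + 2 * (N * (distortion Ω φ).toReal))
    (hs : N * (distortion Ω φ).toReal ≤ 1 / 2) :
    (∃ ψ, IsTransport φ ψ Ω (φ '' Ω) M) ∧ volume (φ '' Ω) ≤ (M : ℝ≥0∞) ^ N * volume Ω := by
  obtain ⟨ψ, hψ, hψ'⟩ := hφ.inverse
  have hs0 : 0 ≤ N * (distortion Ω φ).toReal := by positivity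
  have hsub := fun {x} (hx : x ∈ Ω) => norm_fderiv_sub_id_le hφ.isC11On hΩ hfin hx
  have hnorm : ∀ x ∈ Ω, ‖fderiv ℝ φ x‖ ≤ M := fun x hx => by
    rw [hM, ← sub_add_cancel (fderiv ℝ φ x) (ContinuousLinearMap.id ℝ (Space N))]
    exact (norm_add_le _ _).trans
      (by linarith [hsub hx, ContinuousLinearMap.norm_id_le (𝕜 := ℝ) (E := Space N)])
  have hvol : volume (φ '' Ω) ≤ (M : ℝ≥0∞) ^ N * volume Ω := by
    refine (addHaar_image_le_lintegral_abs_det_fderiv volume hΩ.measurableSet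
      fun x hx => (hφ.isC11On.hasFDerivAt hΩ hx).hasFDerivWithinAt).trans ?_
    rw [← setLIntegral_const]
    refine setLIntegral_mono' hΩ.measurableSet fun x hx => ?_
    rw [← ENNReal.coe_pow, ← ENNReal.ofReal_coe_nnreal]
    refine ENNReal.ofReal_le_ofReal ((abs_det_le_norm_pow _).trans ?_)
    rw [NNReal.coe_pow]
    exact pow_le_pow_left₀ (norm_nonneg _) (hnorm x hx) N
  refine ⟨⟨ψ, hΩ, hφ.isOpen_image, hV, ?_, mapsTo_image φ Ω, ?_, hψ, ?_, hφ.isC11On, hψ', hnorm,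
    ?_⟩, hvol⟩
  · exact ne_top_of_le_ne_top (ENNReal.mul_ne_top (by simp) hV) hvol
  · rintro _ ⟨x, hx, rfl⟩
    rwa [hψ hx]
  · rintro _ ⟨x, hx, rfl⟩
    rw [hψ hx]
  · rintro _ ⟨x, hx, rfl⟩
    rw [hM]
    refine norm_le_of_comp_eq_id hs ?_ (hsub hx)
    have h1 : HasFDerivAt (fun x => ψ (φ x)) (fderiv ℝ ψ (φ x) ∘L fderiv ℝ φ x) x :=
      (hψ'.hasFDerivAt hφ.isOpen_image (mem_image_of_mem φ hx)).comp x
        (hφ.isC11On.hasFDerivAt hΩ hx)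
    refine h1.unique ((hasFDerivAt_id x).congr_of_eventuallyEq ?_)
    filter_upwards [hΩ.mem_nhds hx] with y hy using hψ hy

end NearIdentity

/-! ### Comparison of the eigenvalues -/

theorem one_add_pow_le {t : ℝ} (h0 : 0 ≤ t) (h1 : t ≤ 1) (n : ℕ) :
    (1 + t) ^ n ≤ 1 + (2 ^ n - 1) * t := by
  induction n with
  | zero => simp
  | succ n ih =>
    have h2 : (0 : ℝ) ≤ 2 ^ n - 1 := sub_nonneg.2 (one_le_pow₀ one_le_two)
    rw [pow_succ, pow_succ]
    nlinarith [mul_le_mul_of_nonneg_right ih (by linarith : 0 ≤ 1 + t),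
      mul_nonneg h2 (mul_nonneg h0 (sub_nonneg.2 h1))]

/-- A relative perturbation of both forms perturbs the eigenvalues relatively, by min-max. -/
theorem abs_countedEigenvalue_sub_le {V V' : Type*} [AddCommGroup V] [Module ℝ V]
    [AddCommGroup V'] [Module ℝ V'] {a m : V → ℝ} {a' m' : V' → ℝ} {E : ℝ → Submodule ℝ V}
    {E' : ℝ → Submodule ℝ V'} (h : HasDiscreteSpectrum a m E) (h' : HasDiscreteSpectrum a' m' E')
    (S : V' ≃ₗ[ℝ] V) {κ : ℝ} (h0 : 0 ≤ κ) (h1 : κ ≤ 1 / 2)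
    (ha : ∀ u, |a (S u) - a' u| ≤ κ * a' u) (hm : ∀ u, |m (S u) - m' u| ≤ κ * m' u) {n : ℕ}
    (hn : 1 ≤ n) :
    |countedEigenvalue E' n - countedEigenvalue E n| ≤ 4 * κ * countedEigenvalue E n := by
  have hk : 0 < 1 - κ := by linarith
  have b1 : countedEigenvalue E n ≤ (1 + κ) * (1 - κ)⁻¹ * countedEigenvalue E' n := by
    refine h'.countedEigenvalue_le h S.toLinearMap S.injective (by positivity) (fun u => ?_) (fun u => ?_) hn
    · change a (S u) ≤ _
      linarith [(abs_le.1 (ha u)).2]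
    · change _ ≤ _ * m (S u)
      rw [inv_mul_eq_div, le_div_iff₀ hk]
      linarith [(abs_le.1 (hm u)).1]
  have b2 : countedEigenvalue E' n ≤ (1 - κ)⁻¹ * (1 + κ) * countedEigenvalue E n := by
    refine h.countedEigenvalue_le h' S.symm.toLinearMap S.symm.injective (by positivity) (fun u => ?_)
      (fun u => ?_) hn
    · change a' (S.symm u) ≤ _
      have h2 := (abs_le.1 (ha (S.symm u))).1
      rw [S.apply_symm_apply] at h2
      rw [inv_mul_eq_div, le_div_iff₀ hk]
      linarith
    · change _ ≤ _ * m' (S.symm u)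
      have h2 := (abs_le.1 (hm (S.symm u))).2
      rw [S.apply_symm_apply] at h2
      linarith
  have c := h.countedEigenvalue_pos hn
  have c' := h'.countedEigenvalue_pos hn
  rw [mul_right_comm, ← div_eq_mul_inv, le_div_iff₀ hk] at b1
  rw [mul_assoc, inv_mul_eq_div, le_div_iff₀ hk] at b2
  refine abs_le.2 ⟨?_, ?_⟩ <;> nlinarith [mul_nonneg h0 c.le, mul_nonneg h0 c'.le]

theorem formDefect_mul (N : ℕ) (lam mu C κ ε : ℝ) :
    formDefect N lam mu C ε (κ * ε) = formDefect N lam mu C 1 κ * ε := by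
  simp only [formDefect, termDefect]
  ring

end ReissnerMindlin

end

theorem mainTheorem1 (N : ℕ) (hN : 1 ≤ N) (lam mu M₁ M₂ : ℝ) (hlam : 0 < lam) (hmu : 0 < mu)
    (hM₁ : 0 < M₁) (hM₂ : 0 < M₂) (V : ℝ≥0) :
    ∃ c : ℝ, 0 < c ∧
      ∀ (Ω : Set (ReissnerMindlin.Space N)), IsOpen Ω → Ω.Nonempty → volume Ω = V →
      ∀ (P : ReissnerMindlin.Params), P.lam = lam → P.mu = mu →
      ∀ (φ : ReissnerMindlin.Space N → ReissnerMindlin.Space N),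
        ReissnerMindlin.IsC11Diffeo φ Ω →
        ReissnerMindlin.derivSup Ω φ < ENNReal.ofReal M₁ →
        ENNReal.ofReal M₂ < ⨅ x ∈ Ω, ENNReal.ofReal |(fderiv ℝ φ x).det| →
        ReissnerMindlin.distortion Ω φ < ENNReal.ofReal c⁻¹ →
        ReissnerMindlin.IsEigenvalueSequence P Ω (ReissnerMindlin.eigenvalue P Ω) ∧
        ReissnerMindlin.IsEigenvalueSequence P (φ '' Ω)
          (ReissnerMindlin.eigenvalue P (φ '' Ω)) ∧
        ∀ n : ℕ, 1 ≤ n →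
          |ReissnerMindlin.eigenvalue P (φ '' Ω) n - ReissnerMindlin.eigenvalue P Ω n| ≤
            c * ReissnerMindlin.eigenvalue P Ω n * (ReissnerMindlin.distortion Ω φ).toReal := by
  -- The radius makes Poincaré's inequality hold in every open set of measure at most `2 * V`.
  obtain ⟨R, hR0, hR⟩ := ReissnerMindlin.exists_le_volume_ball hN (4 * V)
  -- Volumes change by a factor of at most `(1 + 2Nδ) ^ N ≤ 1 + κ₁ δ`.
  set κ₁ : ℝ := 2 ^ N * (2 * N) with hκ₁
  -- Both forms change by a relative amount of at most `A δ`.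
  set A := ReissnerMindlin.formDefect N lam mu (2 * R) 1 κ₁ with hA
  have hA0 : 0 ≤ A := by
    rw [hA, ReissnerMindlin.formDefect, ReissnerMindlin.termDefect]
    positivity
  have hκ₁0 : 0 ≤ κ₁ := by positivity
  -- The first term is the factor in the comparison of the eigenvalues. The condition `c δ < 1` also
  -- makes `A δ` and `N δ` less than `1 / 2`, and `κ₁ δ` and `δ` less than `1`.
  set c : ℝ := 4 * A + κ₁ + 2 * N + 1 with hc
  have hc0 : 0 < c := by positivity
  refine ⟨c, hc0, fun Ω hΩ hne hV P hlamP hmuP φ hφ _ _ hδ => ?_⟩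
  have hfin : ReissnerMindlin.distortion Ω φ ≠ ⊤ := hδ.ne_top
  set δ := (ReissnerMindlin.distortion Ω φ).toReal with hδdef
  have hδ0 : 0 ≤ δ := ENNReal.toReal_nonneg
  have hcδ : c * δ < 1 := by
    have h1 := (ENNReal.lt_ofReal_iff_toReal_lt hfin).1 hδ
    calc c * δ < c * c⁻¹ := mul_lt_mul_of_pos_left h1 hc0
      _ = 1 := mul_inv_cancel₀ hc0.ne'
  have hAδ : 0 ≤ A * δ := mul_nonneg hA0 hδ0
  have hκδ : 0 ≤ κ₁ * δ := mul_nonneg hκ₁0 hδ0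
  have hNδ : 0 ≤ N * δ := mul_nonneg N.cast_nonneg hδ0
  have hsum : 4 * (A * δ) + κ₁ * δ + 2 * (N * δ) + δ < 1 := by
    refine lt_of_eq_of_lt ?_ hcδ
    rw [hc]
    ring
  have hpow : ((1 + 2 * (N * δ)).toNNReal : ℝ) ^ N ≤ 1 + κ₁ * δ := by
    rw [Real.coe_toNNReal _ (by positivity)]
    refine (ReissnerMindlin.one_add_pow_le (by linarith) (by linarith) N).trans ?_
    rw [hκ₁]
    linarith
  obtain ⟨⟨ψ, h⟩, hvol⟩ := ReissnerMindlin.exists_isTransport hφ hΩ (by simp [hV]) hfin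
    (M := (1 + 2 * (N * δ)).toNNReal) (Real.coe_toNNReal _ (by positivity)) (by linarith)
  have hvol2 : volume (φ '' Ω) ≤ 2 * V := by
    rw [← hV]
    refine hvol.trans (mul_le_mul_left ?_ _)
    have h1 : (1 + 2 * (N * δ)).toNNReal ^ N ≤ 2 := by
      rw [← NNReal.coe_le_coe, NNReal.coe_pow]
      exact hpow.trans (by norm_num; linarith)
    exact_mod_cast h1
  have hball : ∀ W : Set (ReissnerMindlin.Space N), volume W ≤ 2 * V →
      2 * volume W ≤ volume (Metric.ball (0 : ReissnerMindlin.Space N) R) := fun W hW => by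
    refine le_trans (mul_le_mul_right hW 2) (le_trans (le_of_eq ?_) hR)
    push_cast
    ring
  have hP : ∀ W : Set (ReissnerMindlin.Space N), IsOpen W → volume W ≤ 2 * V →
      ∀ u : ReissnerMindlin.H10 W, ‖ReissnerMindlin.val u‖ ^ 2 ≤
        (2 * R) ^ 2 * ∑ i, ‖ReissnerMindlin.wderiv i u‖ ^ 2 := fun W hWo hW u => by
    refine (ReissnerMindlin.norm_val_sq_le hWo hR0 (hball W hW) u).trans (le_of_eq ?_)
    ring
  have hV2 : volume Ω ≤ 2 * V := by
    rw [hV, two_mul]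
    exact le_self_add
  have hR2 : 0 ≤ 2 * R := by positivity
  have hs := ReissnerMindlin.hasDiscreteSpectrum hN hΩ hne h.finite hR2 (hP Ω hΩ hV2) P
  have hs' := ReissnerMindlin.hasDiscreteSpectrum hN h.isOpen' (hne.image φ) h.finite' hR2
    (hP _ h.isOpen' hvol2) P
  refine ⟨hs.isEigenvalueSequence, hs'.isEigenvalueSequence, fun n hn => ?_⟩
  have hnear := ReissnerMindlin.isNearIdentity_distortion hφ.isC11On hΩ hfin (by linarith)
  have hdef : ReissnerMindlin.formDefect N P.lam P.mu (2 * R) δ (κ₁ * δ) = A * δ := by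
    rw [ReissnerMindlin.formDefect_mul, hlamP, hmuP]
  have hmain := ReissnerMindlin.abs_countedEigenvalue_sub_le hs hs' h.energyEquiv hAδ
    (by linarith)
    (fun U => hdef ▸ h.abs_energyForm_energyMap_sub_le hnear hκδ hpow (by linarith) hR2
      (hP _ h.isOpen' hvol2) P U)
    (fun U => hdef ▸ h.abs_massForm_energyMap_sub_le hnear hκδ hpow (by linarith) hR2 P U) hn
  have hpos := hs.countedEigenvalue_pos hn
  refine hmain.trans ?_
  change _ ≤ c * ReissnerMindlin.countedEigenvalue (ReissnerMindlin.eigenspace P Ω) n * δ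
  rw [mul_right_comm c]
  refine mul_le_mul_of_nonneg_right ?_ hpos.le
  rw [← mul_assoc]
  exact mul_le_mul_of_nonneg_right (by linarith [(Nat.cast_nonneg N : (0 : ℝ) ≤ N)]) hδ0
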